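/- Let $d \ge 3$. For $s,b\in\mathbb{R}$ and a tempered distribution $u$ on $\mathbb{R}^d\times\mathbb{R}$ whose space-time Fourier transform $\hat u(\xi,\tau)$ (normalized by $\hat u(\xi,\tau)=\int e^{-2\pi i(x\cdot\xi+t\tau)}u(x,t)\,dx\,dt$) is a function, put $$\|u\|_{X^{s,b}_{\tau=\pm|\xi|}} := \big\| \langle\xi\rangle^s\,\langle|\tau|-|\xi|\rangle^b\,\hat u(\xi,\tau)\big\|_{L^2_{\xi,\tau}(\mathbb{R}^d\times\mathbb{R})},\qquad \langle r\rangle=(1+r^2)^{1/2},\ \langle\xi\rangle=\langle|\xi|\rangle,$$ and put $\|u\|_{X^{s,b}_{\tau=\pm|\xi|}}=\infty$ if $\hat u$ is not a function. For $1\le i<j\le d$ let $Q_{ij}(\phi,\psi)=\partial_i\phi\,\partial_j\psi-\partial_j\phi\,\partial_i\psi$ (spatial derivatives), and let $D^{-1}$ be a spatial Fourier multiplier, $\widehat{D^{-1}u}(\xi,\tau)=p(\xi)\hat u(\xi,\tau)$, whose symbol $p:\mathbb{R}^d\to\mathbb{C}$ is measurable and of order $-1$ in the homogeneous sense: $|p(\xi)|\le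 A|\xi|^{-1}$ for some $A$ and all $\xi\neq0$. (In particular $p$ may be any function smooth away from the origin and positively homogeneous of degree $-1$.) There are constants $C_0,\varepsilon_0>0$ depending only on $d$ such that for all $C\ge C_0$ and $0<\varepsilon<\varepsilon_0$, with $s:=\frac d2-\frac34+C\varepsilon$, and for every such $D^{-1}$, there is a finite constant $K$ (independent of $i,j,\phi,\psi$) with $$\|D^{-1}Q_{ij}(\phi,\psi)\|_{X^{s-1,-1/4+\varepsilon}_{\tau=\pm|\xi|}}\le K\,\|\phi\|_{X^{s,3/4+\varepsilon}_{\tau=\pm|\xi|}}\|\psi\|_{X^{s,3/4+\varepsilon}_{\tau=\pm|\xi|}}$$ and $$\|Q_{ij}(D^{-1}\phi,\psi)\|_{X^{s-1,-1/4+\varepsilon}_{\tau=\pm|\xi|}}\le K\,\|\phi\|_{X^{s,3/4+\varepsilon}_{\tau=\pm|\xi|}}\|\psi\|_{X^{s,3/4+\varepsilon}_{\tau=\pm|\xi|}}.$$ Both estimates hold for all complex Schwartz functions $\phi,\psi$ on $\mathbb{R}^d\times\mathbb{R}$, and, more generally, for all $\phi,\psi$ with $\|\phi\|_{X^{s,3/4+\varepsilon}_{\tau=\pm|\xi|}},\|\psi\|_{X^{s,3/4+\varepsilon}_{\tau=\pm|\xi|}}<\infty$,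 where in the latter case $D^{-1}Q_{ij}(\phi,\psi)$ and $Q_{ij}(D^{-1}\phi,\psi)$ are the tempered distributions with Fourier transform $$\zeta\mapsto\int_{\zeta_1+\zeta_2=\zeta} m(\xi_1,\xi_2)\,\hat\phi(\zeta_1)\,\hat\psi(\zeta_2),\qquad \zeta_k=(\xi_k,\tau_k),$$ (the integral converging absolutely for a.e. $\zeta$), with $m=p(\xi_1+\xi_2)\,q_{ij}$ and $m=p(\xi_1)\,q_{ij}$ respectively, where $q_{ij}(\xi_1,\xi_2)=(2\pi i)^2\big((\xi_1)_i(\xi_2)_j-(\xi_1)_j(\xi_2)_i\big)$. -/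

import Mathlib

open MeasureTheory FourierTransform TemperedDistribution LineDeriv
open scoped SchwartzMap ENNReal NNReal

noncomputable section

/-- The space `ℝ^d` with its Euclidean norm. -/
abbrev Space (d : ℕ) := EuclideanSpace ℝ (Fin d)

/-- Space-time `ℝ^d × ℝ` with its Euclidean norm and Lebesgue measure. A point is written
`(x, t)` in physical space and `(ξ, τ)` in frequency space; `z.fst` is the spatial component
and `z.snd` the temporal one. -/
abbrev SpaceTime (d : ℕ) := WithLp 2 (Space d × ℝ)

/-- The `i`-th spatial unit vector of `ℝ^d × ℝ`. -/
def spaceVec {d : ℕ} (i : Fin d) : SpaceTime d :=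
  WithLp.toLp 2 (EuclideanSpace.single i (1 : ℝ), (0 : ℝ))

/-- The bracket `⟨r⟩ = (1 + r²)^{1/2}`. -/
def bracket (r : ℝ) : ℝ := Real.sqrt (1 + r ^ 2)

/-- The weight `⟨ξ⟩^s ⟨|τ| - |ξ|⟩^b` attached to the light cone `τ = ± |ξ|`. -/
def waveWeight {d : ℕ} (s b : ℝ) (ζ : SpaceTime d) : ℝ :=
  bracket ‖ζ.fst‖ ^ s * bracket (|ζ.snd| - ‖ζ.fst‖) ^ b

/-- The (distributional) Fourier transform of the tempered distribution `u` is given by integration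
against the function `f`. The normalization is `∫ e^{-2πi x·ξ} u(x) dx`. -/
def HasFourierTransform {d : ℕ} (u : 𝓢'(SpaceTime d, ℂ)) (f : SpaceTime d → ℂ) : Prop :=
  AEStronglyMeasurable f volume ∧
    ∀ θ : 𝓢(SpaceTime d, ℂ),
      Integrable (fun ζ => θ ζ * f ζ) volume ∧ (𝓕 u) θ = ∫ ζ, θ ζ * f ζ

/-- The norm `‖⟨ξ⟩^s ⟨|τ| - |ξ|⟩^b û(ξ, τ)‖_{L²}` of the space `X^{s,b}_{τ = ± |ξ|}(ℝ^d × ℝ)`.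
The function representing `û` is unique up to null sets, so the infimum runs over one value; it
is `∞` if `û` is not a function. -/
def xNorm {d : ℕ} (s b : ℝ) (u : 𝓢'(SpaceTime d, ℂ)) : ℝ≥0∞ :=
  ⨅ (f : SpaceTime d → ℂ) (_ : HasFourierTransform u f),
    eLpNorm (fun ζ => (waveWeight s b ζ : ℂ) * f ζ) 2 volume

/-- `p` is a measurable symbol on `ℝ^d` with `|p(ξ)| ≤ A |ξ|^m` away from the origin. -/
def HasSymbolBound {d : ℕ} (m : ℝ) (p : Space d → ℂ) : Prop :=
  Measurable p ∧ ∃ A : ℝ, ∀ ξ : Space d, ξ ≠ 0 → ‖p ξ‖ ≤ A * ‖ξ‖ ^ m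

/-- A positively homogeneous symbol of order `m` that is continuous (in particular, one that is
smooth) away from the origin obeys `HasSymbolBound m`. -/
theorem hasSymbolBound_of_homogeneous {d : ℕ} {m : ℝ} {p : Space d → ℂ}
    (hp : ContinuousOn p {0}ᶜ)
    (hom : ∀ (t : ℝ) (ξ : Space d), 0 < t → ξ ≠ 0 → p (t • ξ) = ((t ^ m : ℝ) : ℂ) * p ξ) :
    HasSymbolBound m p := by
  constructor
  · have h0 : ContinuousOn p {(0 : Space d)} := continuousOn_singleton p 0
    refine measurable_of_restrict_of_restrict_compl (measurableSet_singleton (0 : Space d)) ?_ ?_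
    · exact (continuousOn_iff_continuous_domRestrict.1 h0).measurable
    · exact (continuousOn_iff_continuous_domRestrict.1 hp).measurable
  · have hs : IsCompact (Metric.sphere (0 : Space d) 1) := isCompact_sphere 0 1
    obtain ⟨A, hA⟩ := hs.exists_bound_of_continuousOn
      (hp.mono fun x hx => by
        rintro rfl
        simp at hx)
    refine ⟨A, fun ξ hξ => ?_⟩
    have hn : 0 < ‖ξ‖ := norm_pos_iff.2 hξ
    have h1 : ‖ξ‖⁻¹ • ξ ∈ Metric.sphere (0 : Space d) 1 := by
      simp [norm_smul, hn.ne']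
    have h2 := hom ‖ξ‖ (‖ξ‖⁻¹ • ξ) hn (by simp [hξ])
    rw [smul_smul, mul_inv_cancel₀ hn.ne', one_smul] at h2
    rw [h2, norm_mul, Complex.norm_real, Real.norm_of_nonneg (by positivity), mul_comm]
    exact mul_le_mul_of_nonneg_right (hA _ h1) (by positivity)

/-- `v` is the image of `u` under the spatial Fourier multiplier with symbol `p`, that is
`v̂(ξ, τ) = p(ξ) û(ξ, τ)`. Such a `v` is unique. -/
def IsFourierMultiplier {d : ℕ} (p : Space d → ℂ) (u v : 𝓢'(SpaceTime d, ℂ)) : Prop :=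
  ∃ f : SpaceTime d → ℂ, HasFourierTransform u f ∧ HasFourierTransform v (fun ζ => p ζ.fst * f ζ)

/-- The null form `Q_{ij}(u, ψ) = ∂_i u ∂_j ψ - ∂_j u ∂_i ψ` of a tempered distribution `u` and a
Schwartz function `ψ`, with spatial derivatives in the sense of distributions. -/
def nullForm {d : ℕ} (i j : Fin d) (u : 𝓢'(SpaceTime d, ℂ)) (ψ : 𝓢(SpaceTime d, ℂ)) :
    𝓢'(SpaceTime d, ℂ) :=
  smulLeftCLM ℂ (fun z => (∂_{spaceVec j} ψ) z) (∂_{spaceVec i} u) -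
    smulLeftCLM ℂ (fun z => (∂_{spaceVec i} ψ) z) (∂_{spaceVec j} u)

/-- `u` is the image of `(φ, ψ)` under the bilinear Fourier multiplier with symbol `m(ξ₁, ξ₂)`:
`û(ζ) = ∫_{ζ₁ + ζ₂ = ζ} m(ξ₁, ξ₂) φ̂(ζ₁) ψ̂(ζ₂)`, the integral being absolutely convergent for
almost every `ζ`. Such a `u` is unique. -/
def IsBilinearMultiplier {d : ℕ} (m : Space d → Space d → ℂ) (φ ψ u : 𝓢'(SpaceTime d, ℂ)) : Prop :=
  ∃ f g : SpaceTime d → ℂ, HasFourierTransform φ f ∧ HasFourierTransform ψ g ∧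
    (∀ᵐ ζ : SpaceTime d, Integrable (fun η => m (ζ - η).fst η.fst * f (ζ - η) * g η) volume) ∧
    HasFourierTransform u (fun ζ => ∫ η, m (ζ - η).fst η.fst * f (ζ - η) * g η)

/-- The symbol `(2πi)² (ξ₁ⁱ ξ₂ʲ - ξ₁ʲ ξ₂ⁱ)` of the null form `Q_{ij}`. -/
def nullSymbol {d : ℕ} (i j : Fin d) (ξ₁ ξ₂ : Space d) : ℂ :=
  (2 * Real.pi * Complex.I) ^ 2 * ((ξ₁ i * ξ₂ j - ξ₁ j * ξ₂ i : ℝ) : ℂ)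

/-- `u = D⁻¹ Q_{ij}(φ, ψ)` for general tempered distributions, where `D⁻¹` has symbol `p`. -/
def IsInvNullForm {d : ℕ} (p : Space d → ℂ) (i j : Fin d) (φ ψ u : 𝓢'(SpaceTime d, ℂ)) : Prop :=
  IsBilinearMultiplier (fun ξ₁ ξ₂ => p (ξ₁ + ξ₂) * nullSymbol i j ξ₁ ξ₂) φ ψ u

/-- `u = Q_{ij}(D⁻¹ φ, ψ)` for general tempered distributions, where `D⁻¹` has symbol `p`. -/
def IsNullFormInv {d : ℕ} (p : Space d → ℂ) (i j : Fin d) (φ ψ u : 𝓢'(SpaceTime d, ℂ)) : Prop :=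
  IsBilinearMultiplier (fun ξ₁ ξ₂ => p ξ₁ * nullSymbol i j ξ₁ ξ₂) φ ψ u

end

/-! Write ξ₀ = ξ₁ + ξ₂, and let W be the absolute value of the (i, j) minor of (ξ₁, ξ₂). Both
symbols are at most a constant times W / min(|ξ₀|, |ξ₁|, |ξ₂|), so on the Fourier side both
estimates reduce to one L² × L² → L² bound for the nonnegative kernel `nullKernel`. Its square
contains W twice, and each copy is used differently.

Null form gain. By Heron's formula for the triangle with sides |ξ₀|, |ξ₁|, |ξ₂| (`wedge_heron`), W
is small when one side nearly equals the sum of the others, and `resonance_le` bounds one of these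
three defects by the sum of the three modulations. With L₀, L₁, L₂ the brackets of the modulations,
a = min|ξₖ| and β = 1/2 - 2ε, one factor W/a thus gains (L₀L₁L₂/⟨a⟩)^β (`div_le_mul_rpow`). The
power of L₀ is cancelled exactly by the output weight, and (L₁L₂)^(-(1+2ε)), integrable in each
modulation, is left over.

Jacobian. The other factor becomes W/(|ξ₁||ξ₂|), which is bounded by two partial derivatives of the
phase σ₁|ξ| + σ₂|a - ξ|, now with a the output frequency (`wedge_div_le`). It is therefore the
Jacobian for taking the phase as variable along a coordinate line; this uses up both modulations and
leaves an integral over d - 1 variables (`lintegral_wedge_le`).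

Counting powers. The surviving weight is ⟨min|ξₖ|⟩^(-ρ) with ρ = d - 1 + 2ε. When an input frequency
is smallest, this is integrable over d - 1 variables and Cauchy-Schwarz suffices. When ξ₀ is
smallest, the weight does not decay in the integration variable; Cauchy-Schwarz is then applied on
balls of radius ⟨ξ₀⟩, whose slices have volume of order ⟨ξ₀⟩^(d-1), and the surplus ⟨ξ₀⟩^(-2ε) pays
for averaging over the centres (`exists_lintegral_sq_bilinear_le_of_ball`). -/

/-! ### Change of variables along lines -/

/-- On each of the two intervals where the derivative has a fixed sign `f` is injective, so the
change of variables formula applies; the zeros of `f'` contribute nothing. The two intervals account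
for the factor 2. -/
theorem lintegral_abs_deriv_mul_comp_le {f f' : ℝ → ℝ} (hf : ∀ t, HasDerivAt f (f' t) t)
    (hpos : Convex ℝ {t | 0 < f' t}) (hneg : Convex ℝ {t | f' t < 0}) (g : ℝ → ℝ≥0∞) :
    ∫⁻ t, ENNReal.ofReal |f' t| * g (f t) ≤ 2 * ∫⁻ t, g t := by
  have hd : ∀ t, deriv f t = f' t := fun t => (hf t).deriv
  have hc : Continuous f := continuous_iff_continuousAt.2 fun t => (hf t).continuousAt
  have key : ∀ s : Set ℝ, Convex ℝ s → Set.InjOn f s →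
      ∫⁻ t in s, ENNReal.ofReal |f' t| * g (f t) ≤ ∫⁻ t, g t := by
    intro s hs hinj
    rw [← lintegral_image_eq_lintegral_abs_deriv_mul hs.ordConnected.measurableSet
      (fun x _ => (hf x).hasDerivWithinAt) hinj g]
    exact setLIntegral_le_lintegral _ _
  have h1 := key _ hpos (strictMonoOn_of_deriv_pos hpos hc.continuousOn fun x hx => by
    rw [hd]; exact interior_subset (s := {t | 0 < f' t}) hx).injOn
  have h2 := key _ hneg (strictAntiOn_of_deriv_neg hneg hc.continuousOn fun x hx => by
    rw [hd]; exact interior_subset (s := {t | f' t < 0}) hx).injOn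
  have hm1 := hpos.ordConnected.measurableSet
  have hm2 := hneg.ordConnected.measurableSet
  calc ∫⁻ t, ENNReal.ofReal |f' t| * g (f t)
      = ∫⁻ t in {t | 0 < f' t} ∪ {t | f' t < 0}, ENNReal.ofReal |f' t| * g (f t) := by
        rw [← lintegral_indicator (hm1.union hm2)]
        refine lintegral_congr fun t => ?_
        by_cases ht : t ∈ {t | 0 < f' t} ∪ {t | f' t < 0}
        · rw [Set.indicator_of_mem ht]
        · rw [Set.indicator_of_notMem ht]
          have : f' t = 0 := by
            simp only [Set.mem_union, Set.mem_ofPred_eq, not_or, not_lt] at ht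
            exact le_antisymm ht.1 ht.2
          simp [this]
    _ ≤ _ := lintegral_union_le _ _ _
    _ ≤ _ := by rw [two_mul]; exact add_le_add h1 h2

/-- Since `u / √(u² + p²)` is `sin (arctan (u / p))`, it is increasing in `u / p`, and the
comparison becomes linear. -/
theorem div_sqrt_sq_add_sq_lt_iff {u v p q : ℝ} (hp : 0 < p) (hq : 0 < q) :
    v / √(v ^ 2 + q ^ 2) < u / √(u ^ 2 + p ^ 2) ↔ v * p < u * q := by
  have key : ∀ (u p : ℝ), 0 < p → u / √(u ^ 2 + p ^ 2) = Real.sin (Real.arctan (u / p)) := by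
    intro u p hp
    rw [Real.sin_arctan]
    have : √(u ^ 2 + p ^ 2) = p * √(1 + (u / p) ^ 2) := by
      rw [show u ^ 2 + p ^ 2 = p ^ 2 * (1 + (u / p) ^ 2) by field_simp; ring,
        Real.sqrt_mul (by positivity), Real.sqrt_sq hp.le]
    rw [this]
    have : 0 < √(1 + (u / p) ^ 2) := by positivity
    field_simp
  rw [key u p hp, key v q hq]
  have := Real.sin_arctan_strictMono.lt_iff_lt (a := v / q) (b := u / p)
  rw [this, div_lt_div_iff₀ hq hp]

theorem convex_setOf_affine_pos (a b : ℝ) : Convex ℝ {t : ℝ | 0 < a * t + b} := by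
  intro x hx y hy r s hr hs hrs
  simp only [Set.mem_ofPred_eq, smul_eq_mul] at *
  have h1 : a * (r * x + s * y) + b = r * (a * x + b) + s * (a * y + b) := by
    linear_combination -b * hrs
  rw [h1]
  rcases hr.eq_or_lt with rfl | hr
  · have : s = 1 := by linarith
    subst this; simpa using hy
  · nlinarith [mul_pos hr hx, mul_nonneg hs hy.le]

/-- After the signs are absorbed into the arguments, the derivative has the sign of an affine
function of `t`. Hence it is positive and negative on convex sets, also when `σ₁ ≠ σ₂` and the phase
is not convex. -/
theorem lintegral_abs_deriv_sqrt_mul_comp_le {σ₁ σ₂ p q : ℝ} (h₁ : σ₁ ^ 2 = 1) (h₂ : σ₂ ^ 2 = 1)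
    (hp : 0 < p) (hq : 0 < q) (c : ℝ) (g : ℝ → ℝ≥0∞) :
    ∫⁻ t, ENNReal.ofReal |σ₁ * (t / √(t ^ 2 + p ^ 2)) -
        σ₂ * ((c - t) / √((c - t) ^ 2 + q ^ 2))| *
      g (σ₁ * √(t ^ 2 + p ^ 2) + σ₂ * √((c - t) ^ 2 + q ^ 2)) ≤ 2 * ∫⁻ t, g t := by
  have hs1 : ∀ t : ℝ, (σ₁ * t) / √((σ₁ * t) ^ 2 + p ^ 2) = σ₁ * (t / √(t ^ 2 + p ^ 2)) := by
    intro t; rw [mul_pow, h₁, one_mul, mul_div_assoc]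
  have hs2 : ∀ t : ℝ, (σ₂ * t) / √((σ₂ * t) ^ 2 + q ^ 2) = σ₂ * (t / √(t ^ 2 + q ^ 2)) := by
    intro t; rw [mul_pow, h₂, one_mul, mul_div_assoc]
  refine lintegral_abs_deriv_mul_comp_le
    (f := fun t => σ₁ * √(t ^ 2 + p ^ 2) + σ₂ * √((c - t) ^ 2 + q ^ 2)) ?_ ?_ ?_ g
  · intro t
    have e (r s : ℝ) (hr : 0 < r) : HasDerivAt (fun t : ℝ => √(t ^ 2 + r ^ 2))
        (s / √(s ^ 2 + r ^ 2)) s := by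
      have e0 : HasDerivAt (fun t : ℝ => t ^ 2 + r ^ 2) (2 * s) s := by
        simpa using (hasDerivAt_pow 2 s).add_const (r ^ 2)
      exact (e0.sqrt (by positivity)).congr_deriv (by field_simp)
    have e2 : HasDerivAt (fun t : ℝ => √((c - t) ^ 2 + q ^ 2))
        (-((c - t) / √((c - t) ^ 2 + q ^ 2))) t :=
      ((e q (c - t) hq).comp t ((hasDerivAt_id t).const_sub c)).congr_deriv (by ring)
    exact (((e p t hp).const_mul σ₁).add (e2.const_mul σ₂)).congr_deriv (by ring)
  · convert convex_setOf_affine_pos (σ₁ * q + σ₂ * p) (-(σ₂ * c * p)) using 1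
    ext t
    simp only [Set.mem_ofPred_eq]
    rw [sub_pos, ← hs1, ← hs2, div_sqrt_sq_add_sq_lt_iff hp hq, ← sub_pos]
    ring_nf
  · convert convex_setOf_affine_pos (-(σ₁ * q + σ₂ * p)) (σ₂ * c * p) using 1
    ext t
    simp only [Set.mem_ofPred_eq]
    rw [sub_neg, ← hs1, ← hs2, div_sqrt_sq_add_sq_lt_iff hq hp, ← sub_pos]
    ring_nf

/-! ### Integration along a coordinate direction -/

theorem lintegral_euclideanSpace_succ {n : ℕ} (i : Fin (n + 1)) {f : Space (n + 1) → ℝ≥0∞}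
    (hf : Measurable f) :
    ∫⁻ x, f x = ∫⁻ y : Fin n → ℝ, ∫⁻ t : ℝ, f (WithLp.toLp 2 (i.insertNth t y)) := by
  have h1 := (PiLp.volume_preserving_toLp (Fin (n + 1))).lintegral_comp hf
  have h2 := ((volume_preserving_piFinSuccAbove (fun _ : Fin (n + 1) => ℝ) i).symm
    _).lintegral_comp (hf.comp (WithLp.measurable_toLp 2 _))
  rw [← h1]
  simp only [Function.comp_apply] at h2
  rw [← h2, Measure.volume_eq_prod, lintegral_prod_symm]
  · rfl
  · exact (hf.comp ((WithLp.measurable_toLp 2 _).comp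
      (MeasurableEquiv.measurable _))).aemeasurable

theorem norm_insertNth {n : ℕ} (i : Fin (n + 1)) (t : ℝ) (y : Fin n → ℝ) :
    ‖(WithLp.toLp 2 (i.insertNth t y : Fin (n + 1) → ℝ) : Space (n + 1))‖ =
      √(t ^ 2 + ‖(WithLp.toLp 2 y : Space n)‖ ^ 2) := by
  rw [EuclideanSpace.norm_eq, EuclideanSpace.norm_sq_eq, Fin.sum_univ_succAbove _ i]
  simp

/-- The `i`-th partial derivative of `σ₁ ‖x‖ + σ₂ ‖a - x‖`. -/
noncomputable def coneDeriv {d : ℕ} (σ₁ σ₂ : ℝ) (i : Fin d) (a x : Space d) : ℝ :=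
  σ₁ * (x i / ‖x‖) - σ₂ * ((a - x) i / ‖a - x‖)

theorem measurable_coneDeriv {d : ℕ} (σ₁ σ₂ : ℝ) (i : Fin d) (a : Space d) :
    Measurable (coneDeriv σ₁ σ₂ i a) := by
  unfold coneDeriv
  fun_prop

/-- On a line parallel to the `i`-th axis the two norms are `√(t² + p²)` and `√((c - t)² + q²)`,
with `p`, `q` the distances of the line from `0` and `a`, so the one-dimensional estimate applies on
each line. -/
theorem lintegral_coneDeriv_mul_le {n : ℕ} (hn : 1 ≤ n) {σ₁ σ₂ : ℝ} (h₁ : σ₁ ^ 2 = 1)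
    (h₂ : σ₂ ^ 2 = 1) (i : Fin (n + 1)) (a : Space (n + 1)) {g : ℝ → ℝ≥0∞} (hg : Measurable g)
    {ω : Space (n + 1) → ℝ≥0∞} (hω : Measurable ω) {ω' : (Fin n → ℝ) → ℝ≥0∞} (hω' : Measurable ω')
    (h : ∀ (t : ℝ) (y : Fin n → ℝ), ω (WithLp.toLp 2 (i.insertNth t y)) ≤ ω' y) :
    ∫⁻ x, ENNReal.ofReal |coneDeriv σ₁ σ₂ i a x| * ω x * g (σ₁ * ‖x‖ + σ₂ * ‖a - x‖) ≤
      2 * (∫⁻ t, g t) * ∫⁻ y, ω' y := by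
  have hmeas : Measurable fun x : Space (n + 1) =>
      ENNReal.ofReal |coneDeriv σ₁ σ₂ i a x| * ω x * g (σ₁ * ‖x‖ + σ₂ * ‖a - x‖) := by
    have := measurable_coneDeriv σ₁ σ₂ i a
    have h2 : Measurable fun x : Space (n + 1) => σ₁ * ‖x‖ + σ₂ * ‖a - x‖ := by fun_prop
    exact ((this.norm).ennreal_ofReal.mul hω).mul (hg.comp h2)
  rw [lintegral_euclideanSpace_succ i hmeas]
  set a' : Fin n → ℝ := i.removeNth a.ofLp with ha'
  -- The lines through `0` or `a`, where `p` or `q` vanishes, correspond to two points `y`, a null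
  -- set because `n ≥ 1`.
  have hne : ∀ᵐ y : Fin n → ℝ, y ≠ 0 ∧ y ≠ a' := by
    have : Nonempty (Fin n) := ⟨⟨0, hn⟩⟩
    have e1 : ∀ b : Fin n → ℝ, ∀ᵐ y : Fin n → ℝ, y ≠ b := fun b => by
      rw [ae_iff]; simp
    exact (e1 0).and (e1 a')
  have hpt : ∀ᵐ y : Fin n → ℝ, (∫⁻ t : ℝ, ENNReal.ofReal
      |coneDeriv σ₁ σ₂ i a (WithLp.toLp 2 (i.insertNth t y))| *
        ω (WithLp.toLp 2 (i.insertNth t y)) *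
        g (σ₁ * ‖(WithLp.toLp 2 (i.insertNth t y : Fin (n + 1) → ℝ) : Space (n + 1))‖ +
          σ₂ * ‖a - WithLp.toLp 2 (i.insertNth t y)‖)) ≤ (2 * ∫⁻ t, g t) * ω' y := by
    filter_upwards [hne] with y hy
    have hp : 0 < ‖(WithLp.toLp 2 y : Space n)‖ := by
      rw [norm_pos_iff]; intro h0; exact hy.1 (by simpa using h0)
    have hq : 0 < ‖(WithLp.toLp 2 (a' - y) : Space n)‖ := by
      rw [norm_pos_iff]; intro h0
      exact hy.2 (WithLp.toLp_injective 2 (sub_eq_zero.1 (by simpa using h0))).symm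
    have hsub : ∀ t : ℝ, a - WithLp.toLp 2 (i.insertNth t y) =
        (WithLp.toLp 2 (i.insertNth (a i - t) (a' - y) : Fin (n + 1) → ℝ) : Space (n + 1)) := by
      intro t
      ext k
      refine i.succAboveCases ?_ ?_ k
      · simp
      · intro j; simp [ha', Fin.removeNth]
    calc _ ≤ ∫⁻ t : ℝ, (ENNReal.ofReal |σ₁ * (t / √(t ^ 2 + ‖(WithLp.toLp 2 y : Space n)‖ ^ 2)) -
            σ₂ * ((a i - t) / √((a i - t) ^ 2 + ‖(WithLp.toLp 2 (a' - y) : Space n)‖ ^ 2))| *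
          g (σ₁ * √(t ^ 2 + ‖(WithLp.toLp 2 y : Space n)‖ ^ 2) +
            σ₂ * √((a i - t) ^ 2 + ‖(WithLp.toLp 2 (a' - y) : Space n)‖ ^ 2))) * ω' y := by
          refine lintegral_mono fun t => ?_
          simp only [coneDeriv, hsub, norm_insertNth]
          rw [mul_right_comm]
          refine mul_le_mul' (le_of_eq ?_) (h t y)
          simp
      _ ≤ _ := by
          rw [lintegral_mul_const]
          · exact mul_le_mul_left (lintegral_abs_deriv_sqrt_mul_comp_le h₁ h₂ hp hq _ g) _
          · refine Measurable.mul (by fun_prop) (hg.comp (by fun_prop))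
  exact (lintegral_mono_ae hpt).trans (lintegral_const_mul _ hω').le

/-- The absolute value of the `(i, j)` minor of the pair `(x, y)`. -/
noncomputable def wedge {d : ℕ} (i j : Fin d) (x y : Space d) : ℝ := |x i * y j - x j * y i|

theorem abs_coord_div_norm_le_one {d : ℕ} (x : Space d) (i : Fin d) : |x i / ‖x‖| ≤ 1 := by
  rw [abs_div, abs_norm]
  exact div_le_one_of_le₀ (PiLp.norm_apply_le x i) (norm_nonneg _)

/-- For the unit vectors u, v along `x` and `a - x`, v ∧ v = 0 gives σ₁ (u ∧ v) = (σ₁u - σ₂v) ∧ v,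
and the coordinates of v are at most 1 in absolute value. -/
theorem wedge_div_le {d : ℕ} {σ₁ : ℝ} (h₁ : σ₁ ^ 2 = 1) (σ₂ : ℝ) (i j : Fin d) (a x : Space d) :
    wedge i j x (a - x) / (‖x‖ * ‖a - x‖) ≤
      |coneDeriv σ₁ σ₂ i a x| + |coneDeriv σ₁ σ₂ j a x| := by
  have hσ : |σ₁| = 1 := by rw [← sq_eq_sq₀ (abs_nonneg _) zero_le_one, sq_abs, h₁, one_pow]
  have h : wedge i j x (a - x) / (‖x‖ * ‖a - x‖) =
      |x i / ‖x‖ * ((a - x) j / ‖a - x‖) - x j / ‖x‖ * ((a - x) i / ‖a - x‖)| := by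
    rw [wedge, div_mul_div_comm, div_mul_div_comm, ← sub_div, abs_div, abs_mul, abs_norm, abs_norm]
  have h2 : |x i / ‖x‖ * ((a - x) j / ‖a - x‖) - x j / ‖x‖ * ((a - x) i / ‖a - x‖)| =
      |coneDeriv σ₁ σ₂ i a x * ((a - x) j / ‖a - x‖) -
        coneDeriv σ₁ σ₂ j a x * ((a - x) i / ‖a - x‖)| := by
    rw [← one_mul |x i / ‖x‖ * ((a - x) j / ‖a - x‖) - x j / ‖x‖ * ((a - x) i / ‖a - x‖)|,
      ← hσ, ← abs_mul, coneDeriv, coneDeriv]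
    congr 1
    ring
  rw [h, h2]
  refine (abs_sub _ _).trans ?_
  rw [abs_mul, abs_mul]
  exact add_le_add (mul_le_of_le_one_right (abs_nonneg _) (abs_coord_div_norm_le_one _ _))
    (mul_le_of_le_one_right (abs_nonneg _) (abs_coord_div_norm_le_one _ _))

/-! ### Space-time integrals over pairs of half-cones -/

theorem lintegral_spaceTime {d : ℕ} {f : SpaceTime d → ℝ≥0∞} (hf : Measurable f) :
    ∫⁻ ζ, f ζ = ∫⁻ τ : ℝ, ∫⁻ ξ : Space d, f (WithLp.toLp 2 (ξ, τ)) := by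
  have h1 := (WithLp.volume_preserving_toLp (Space d) ℝ).lintegral_comp hf
  have hm : Measurable (@WithLp.toLp 2 (Space d × ℝ)) :=
    (WithLp.volume_preserving_toLp (Space d) ℝ).measurable
  exact h1.symm.trans (lintegral_prod_symm _ (hf.comp hm).aemeasurable)

@[fun_prop]
theorem measurable_spaceTime_fst {d : ℕ} : Measurable fun ζ : SpaceTime d => ζ.fst :=
  measurable_fst.comp (WithLp.volume_preserving_ofLp (Space d) ℝ).measurable

@[fun_prop]
theorem measurable_spaceTime_snd {d : ℕ} : Measurable fun ζ : SpaceTime d => ζ.snd :=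
  measurable_snd.comp (WithLp.volume_preserving_ofLp (Space d) ℝ).measurable

/-- `ω` is dominated, along each coordinate direction, by a function of the remaining variables of
integral at most `B`. -/
def SliceBound {n : ℕ} (ω : Space (n + 1) → ℝ≥0∞) (B : ℝ≥0∞) : Prop :=
  Measurable ω ∧ ∀ k : Fin (n + 1), ∃ ω' : (Fin n → ℝ) → ℝ≥0∞, Measurable ω' ∧
    (∀ (t : ℝ) (y : Fin n → ℝ), ω (WithLp.toLp 2 (k.insertNth t y)) ≤ ω' y) ∧ ∫⁻ y, ω' y ≤ B

/-- With u = τ - σ₁‖ξ‖ the second factor depends on ξ only through the phase. The slice estimate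
then applies for each fixed u, and the u-integral supplies the second power of `∫ g`. -/
theorem lintegral_lintegral_coneDeriv_le {n : ℕ} (hn : 1 ≤ n) {σ₁ σ₂ : ℝ} (h₁ : σ₁ ^ 2 = 1)
    (h₂ : σ₂ ^ 2 = 1) (k : Fin (n + 1)) (a : Space (n + 1)) (τ₀ : ℝ) {g : ℝ → ℝ≥0∞}
    (hg : Measurable g) {ω : Space (n + 1) → ℝ≥0∞} {B : ℝ≥0∞} (hω : SliceBound ω B) :
    ∫⁻ τ : ℝ, ∫⁻ ξ : Space (n + 1), ENNReal.ofReal |coneDeriv σ₁ σ₂ k a ξ| * ω ξ *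
      (g (τ - σ₁ * ‖ξ‖) * g (τ₀ - τ - σ₂ * ‖a - ξ‖)) ≤ 2 * (∫⁻ t, g t) ^ 2 * B := by
  obtain ⟨hωm, hω⟩ := hω
  obtain ⟨ω', hω', hle, hB⟩ := hω k
  have hc := measurable_coneDeriv σ₁ σ₂ k a
  rw [lintegral_lintegral_swap (by fun_prop)]
  have h1 : ∀ ξ : Space (n + 1), (∫⁻ τ : ℝ, ENNReal.ofReal |coneDeriv σ₁ σ₂ k a ξ| * ω ξ *
      (g (τ - σ₁ * ‖ξ‖) * g (τ₀ - τ - σ₂ * ‖a - ξ‖))) =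
      ∫⁻ u : ℝ, g u * (ENNReal.ofReal |coneDeriv σ₁ σ₂ k a ξ| * ω ξ *
        g (τ₀ - u - (σ₁ * ‖ξ‖ + σ₂ * ‖a - ξ‖))) := by
    intro ξ
    rw [← lintegral_add_right_eq_self _ (σ₁ * ‖ξ‖)]
    refine lintegral_congr fun u => ?_
    rw [add_sub_cancel_right, show τ₀ - (u + σ₁ * ‖ξ‖) - σ₂ * ‖a - ξ‖ =
      τ₀ - u - (σ₁ * ‖ξ‖ + σ₂ * ‖a - ξ‖) by ring]
    ring
  simp only [h1]
  rw [lintegral_lintegral_swap (by fun_prop)]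
  calc _ ≤ ∫⁻ u : ℝ, g u * (2 * (∫⁻ t, g t) * B) := by
        refine lintegral_mono fun u => ?_
        rw [lintegral_const_mul _ (by fun_prop)]
        refine mul_le_mul_right ?_ _
        have := lintegral_coneDeriv_mul_le hn h₁ h₂ k a (g := fun t => g (τ₀ - u - t))
          (hg.comp (by fun_prop)) hωm hω' hle
        rw [lintegral_sub_left_eq_self g (τ₀ - u)] at this
        exact this.trans (mul_le_mul_right hB _)
    _ = _ := by rw [lintegral_mul_const _ hg]; ring

theorem even_apply_abs_sub_le {g : ℝ → ℝ≥0∞} (hev : ∀ t, g (-t) = g t) (τ r : ℝ) :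
    g (|τ| - r) ≤ g (τ - 1 * r) + g (τ - (-1) * r) := by
  rcases abs_cases τ with ⟨h, _⟩ | ⟨h, _⟩ <;> rw [h]
  · rw [one_mul]; exact le_self_add
  · rw [← hev, show -(-τ - r) = τ - (-1) * r by ring]; exact le_add_self

theorem lintegral_lintegral_le_of_le_sum {ι α β : Type*} [Fintype ι] [MeasurableSpace α]
    [MeasurableSpace β] {μ : Measure α} {ν : Measure β} [SFinite ν] {D : ι → α → β → ℝ≥0∞}
    (hD : ∀ p, Measurable (Function.uncurry (D p))) {f : α → β → ℝ≥0∞}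
    (hf : ∀ x y, f x y ≤ ∑ p, D p x y) {C : ℝ≥0∞} (hC : ∀ p, ∫⁻ x, ∫⁻ y, D p x y ∂ν ∂μ ≤ C) :
    ∫⁻ x, ∫⁻ y, f x y ∂ν ∂μ ≤ Fintype.card ι * C := by
  calc _ ≤ ∫⁻ x, ∫⁻ y, ∑ p, D p x y ∂ν ∂μ := lintegral_mono fun x => lintegral_mono fun y => hf x y
    _ = ∑ p, ∫⁻ x, ∫⁻ y, D p x y ∂ν ∂μ := by
        refine (lintegral_congr fun x => lintegral_finsetSum _ fun p _ =>
          (hD p).comp measurable_prodMk_left).trans (lintegral_finsetSum _ fun p _ => ?_)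
        exact (hD p).lintegral_prod_right'
    _ ≤ ∑ _p : ι, C := Finset.sum_le_sum fun p _ => hC p
    _ = _ := by simp

/-- Two signs for each cone and two terms in `wedge_div_le` give eight integrals, each at most `2 (∫
g)² B`. -/
theorem lintegral_wedge_le {n : ℕ} (hn : 1 ≤ n) (i j : Fin (n + 1)) (ζ : SpaceTime (n + 1))
    {g : ℝ → ℝ≥0∞} (hg : Measurable g) (hev : ∀ t, g (-t) = g t)
    {ω : Space (n + 1) → ℝ≥0∞} {B : ℝ≥0∞} (hω : SliceBound ω B) :
    ∫⁻ η : SpaceTime (n + 1),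
      ENNReal.ofReal (wedge i j η.fst (ζ - η).fst / (‖η.fst‖ * ‖(ζ - η).fst‖)) * ω η.fst *
        (g (|η.snd| - ‖η.fst‖) * g (|(ζ - η).snd| - ‖(ζ - η).fst‖)) ≤
      16 * (∫⁻ t, g t) ^ 2 * B := by
  have hωm := hω.1
  have hw : Measurable fun ξ : Space (n + 1) =>
      wedge i j ξ (ζ.fst - ξ) / (‖ξ‖ * ‖ζ.fst - ξ‖) := by
    unfold wedge; fun_prop
  have hsub : ∀ η : SpaceTime (n + 1), (ζ - η).fst = ζ.fst - η.fst ∧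
    (ζ - η).snd = ζ.snd - η.snd := fun η => ⟨rfl, rfl⟩
  simp only [hsub]
  rw [lintegral_spaceTime]
  swap
  · have := hw.comp (measurable_spaceTime_fst (d := n + 1))
    refine (Measurable.mul this.ennreal_ofReal (by fun_prop)).mul (by fun_prop)
  have one : ∀ b : Bool, (bif b then (1 : ℝ) else -1) ^ 2 = 1 := by
    intro b; cases b <;> norm_num
  have main := lintegral_lintegral_le_of_le_sum (μ := (volume : Measure ℝ))
    (ν := (volume : Measure (Space (n + 1)))) (f := fun τ ξ =>
      ENNReal.ofReal (wedge i j ξ (ζ.fst - ξ) / (‖ξ‖ * ‖ζ.fst - ξ‖)) * ω ξ *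
        (g (|τ| - ‖ξ‖) * g (|ζ.snd - τ| - ‖ζ.fst - ξ‖)))
    (D := fun (p : Bool × Bool × Bool) τ ξ =>
      ENNReal.ofReal |coneDeriv (bif p.1 then (1 : ℝ) else -1) (bif p.2.1 then (1 : ℝ) else -1)
        (bif p.2.2 then i else j) ζ.fst ξ| * ω ξ *
      (g (τ - (bif p.1 then (1 : ℝ) else -1) * ‖ξ‖) *
        g (ζ.snd - τ - (bif p.2.1 then (1 : ℝ) else -1) * ‖ζ.fst - ξ‖)))
    (C := 2 * (∫⁻ t, g t) ^ 2 * B) ?_ ?_ ?_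
  · refine main.trans_eq ?_
    simp only [Fintype.card_prod, Fintype.card_bool]
    norm_num
    ring
  · intro p
    have hc := measurable_coneDeriv (bif p.1 then (1 : ℝ) else -1)
      (bif p.2.1 then (1 : ℝ) else -1) (bif p.2.2 then i else j) ζ.fst
    simp only [Function.uncurry_def]
    fun_prop
  · intro τ ξ
    have hk : ∀ σ₁ σ₂ : ℝ, σ₁ ^ 2 = 1 →
        ENNReal.ofReal (wedge i j ξ (ζ.fst - ξ) / (‖ξ‖ * ‖ζ.fst - ξ‖)) * ω ξ *
          (g (τ - σ₁ * ‖ξ‖) * g (ζ.snd - τ - σ₂ * ‖ζ.fst - ξ‖)) ≤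
        ENNReal.ofReal |coneDeriv σ₁ σ₂ i ζ.fst ξ| * ω ξ *
            (g (τ - σ₁ * ‖ξ‖) * g (ζ.snd - τ - σ₂ * ‖ζ.fst - ξ‖)) +
          ENNReal.ofReal |coneDeriv σ₁ σ₂ j ζ.fst ξ| * ω ξ *
            (g (τ - σ₁ * ‖ξ‖) * g (ζ.snd - τ - σ₂ * ‖ζ.fst - ξ‖)) := by
      intro σ₁ σ₂ h₁
      rw [← add_mul, ← add_mul, ← ENNReal.ofReal_add (abs_nonneg _) (abs_nonneg _)]
      gcongr
      exact wedge_div_le h₁ σ₂ i j _ _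
    simp only [Fintype.sum_prod_type, Fintype.sum_bool, cond_true, cond_false]
    calc _ ≤ ENNReal.ofReal (wedge i j ξ (ζ.fst - ξ) / (‖ξ‖ * ‖ζ.fst - ξ‖)) * ω ξ *
          ((g (τ - 1 * ‖ξ‖) + g (τ - (-1) * ‖ξ‖)) *
            (g (ζ.snd - τ - 1 * ‖ζ.fst - ξ‖) + g (ζ.snd - τ - (-1) * ‖ζ.fst - ξ‖))) := by
          gcongr
          · exact even_apply_abs_sub_le hev _ _
          · exact even_apply_abs_sub_le hev _ _
      _ = _ := by rw [add_mul (g _), mul_add (g _), mul_add (g _), mul_add, mul_add, mul_add]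
      _ ≤ _ := add_le_add (add_le_add (hk 1 1 (one true)) (hk 1 (-1) (one true)))
          (add_le_add (hk (-1) 1 (one false)) (hk (-1) (-1) (one false)))
  · rintro ⟨b₁, b₂, b₃⟩
    exact lintegral_lintegral_coneDeriv_le hn (one b₁) (one b₂) _ ζ.fst ζ.snd hg hω

/-! ### Bilinear operators bounded by the Cauchy-Schwarz inequality -/

theorem sq_lintegral_mul_le {α : Type*} [MeasurableSpace α] {μ : Measure α} {f g : α → ℝ≥0∞}
    (hf : AEMeasurable f μ) (hg : AEMeasurable g μ) :
    (∫⁻ x, f x * g x ∂μ) ^ 2 ≤ (∫⁻ x, f x ^ 2 ∂μ) * ∫⁻ x, g x ^ 2 ∂μ := by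
  have h := ENNReal.lintegral_mul_le_Lp_mul_Lq μ Real.HolderConjugate.two_two hf hg
  simp only [Pi.mul_apply, ENNReal.rpow_two] at h
  calc _ ≤ ((∫⁻ x, f x ^ 2 ∂μ) ^ (1 / 2 : ℝ) * (∫⁻ x, g x ^ 2 ∂μ) ^ (1 / 2 : ℝ)) ^ 2 := by gcongr
    _ = _ := by
      rw [mul_pow, ← ENNReal.rpow_two, ← ENNReal.rpow_two, ← ENNReal.rpow_mul, ← ENNReal.rpow_mul]
      norm_num

/-- Minkowski's integral inequality in `L²`. -/
theorem lintegral_sq_lintegral_le {α β : Type*} [MeasurableSpace α] [MeasurableSpace β]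
    {μ : Measure α} {ν : Measure β} [SFinite μ] [SFinite ν] {f : α → β → ℝ≥0∞}
    (hf : Measurable (Function.uncurry f)) :
    ∫⁻ x, (∫⁻ y, f x y ∂ν) ^ 2 ∂μ ≤ (∫⁻ y, (∫⁻ x, f x y ^ 2 ∂μ) ^ (1 / 2 : ℝ) ∂ν) ^ 2 := by
  have hx : ∀ x, Measurable (f x) := fun x => hf.comp measurable_prodMk_left
  have hy : ∀ y, Measurable fun x => f x y := fun y => hf.comp measurable_prodMk_right
  set N : β → ℝ≥0∞ := fun y => (∫⁻ x, f x y ^ 2 ∂μ) ^ (1 / 2 : ℝ) with hN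
  have hNm : Measurable N :=
    (Measurable.lintegral_prod_left' (f := fun p : α × β => f p.1 p.2 ^ 2) (hf.pow_const 2)).pow_const _
  have hsq : ∀ y, N y ^ 2 = ∫⁻ x, f x y ^ 2 ∂μ := fun y => by
    rw [hN, ← ENNReal.rpow_two, ← ENNReal.rpow_mul]; norm_num
  have h3 : Measurable fun p : (α × β) × β => f p.1.1 p.1.2 * f p.1.1 p.2 :=
    (hf.comp (by fun_prop : Measurable fun p : (α × β) × β => (p.1.1, p.1.2))).mul
      (hf.comp (by fun_prop : Measurable fun p : (α × β) × β => (p.1.1, p.2)))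
  -- The square is expanded as an integral over pairs (y, y'), and Cauchy-Schwarz in x is applied
  -- for each pair.
  calc ∫⁻ x, (∫⁻ y, f x y ∂ν) ^ 2 ∂μ
      = ∫⁻ x, ∫⁻ y, ∫⁻ y', f x y * f x y' ∂ν ∂ν ∂μ := by
        refine lintegral_congr fun x => ?_
        rw [lintegral_lintegral_mul (hx x).aemeasurable (hx x).aemeasurable, sq]
    _ = ∫⁻ y, ∫⁻ x, ∫⁻ y', f x y * f x y' ∂ν ∂μ ∂ν :=
        lintegral_lintegral_swap (Measurable.lintegral_prod_right' h3).aemeasurable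
    _ = ∫⁻ y, ∫⁻ y', ∫⁻ x, f x y * f x y' ∂μ ∂ν ∂ν := by
        refine lintegral_congr fun y => lintegral_lintegral_swap ?_
        exact (((hy y).comp measurable_fst).mul hf).aemeasurable
    _ ≤ ∫⁻ y, ∫⁻ y', N y * N y' ∂ν ∂ν := by
        refine lintegral_mono fun y => lintegral_mono fun y' => ?_
        refine (ENNReal.pow_le_pow_left_iff two_ne_zero).1 ?_
        rw [mul_pow, hsq, hsq]
        exact sq_lintegral_mul_le (hy y).aemeasurable (hy y').aemeasurable
    _ = _ := by rw [lintegral_lintegral_mul hNm.aemeasurable hNm.aemeasurable, sq]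

theorem lintegral_lintegral_sub_mul {Z : Type*} [MeasurableSpace Z] [AddCommGroup Z]
    [MeasurableAdd₂ Z] [MeasurableSub₂ Z] {μ : Measure Z} [SFinite μ] [μ.IsAddRightInvariant]
    {f g : Z → ℝ≥0∞} (hf : Measurable f) (hg : Measurable g) :
    ∫⁻ ζ, ∫⁻ η, f (ζ - η) * g η ∂μ ∂μ = (∫⁻ ζ, f ζ ∂μ) * ∫⁻ η, g η ∂μ := by
  rw [lintegral_lintegral_swap (by fun_prop)]
  calc _ = ∫⁻ η, (∫⁻ ζ, f ζ ∂μ) * g η ∂μ := by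
        refine lintegral_congr fun η => ?_
        rw [lintegral_mul_const _ (by fun_prop), lintegral_sub_right_eq_self f η]
    _ = _ := lintegral_const_mul _ hg

/-- Cauchy-Schwarz in `η` separates the kernel from the inputs; by translation invariance the
remaining double integral is a product. -/
theorem lintegral_sq_bilinear_le {Z : Type*} [MeasurableSpace Z] [AddCommGroup Z]
    [MeasurableAdd₂ Z] [MeasurableSub₂ Z] {μ : Measure Z} [SFinite μ] [μ.IsAddRightInvariant]
    {k : Z → Z → ℝ≥0∞} (hk : Measurable (Function.uncurry k)) {A : ℝ≥0∞}
    (hA : ∀ ζ, ∫⁻ η, k ζ η ^ 2 ∂μ ≤ A) {f g : Z → ℝ≥0∞} (hf : Measurable f) (hg : Measurable g) :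
    ∫⁻ ζ, (∫⁻ η, k ζ η * (f (ζ - η) * g η) ∂μ) ^ 2 ∂μ ≤
      A * ((∫⁻ ζ, f ζ ^ 2 ∂μ) * ∫⁻ η, g η ^ 2 ∂μ) := by
  have hk' : ∀ ζ, Measurable (k ζ) := fun ζ => hk.comp measurable_prodMk_left
  calc _ ≤ ∫⁻ ζ, A * ∫⁻ η, f (ζ - η) ^ 2 * g η ^ 2 ∂μ ∂μ := by
        refine lintegral_mono fun ζ => ?_
        refine (sq_lintegral_mul_le (hk' ζ).aemeasurable (by fun_prop)).trans ?_
        simp only [mul_pow]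
        exact mul_le_mul_left (hA ζ) _
    _ = A * ∫⁻ ζ, ∫⁻ η, f (ζ - η) ^ 2 * g η ^ 2 ∂μ ∂μ := by
        refine lintegral_const_mul _ ?_
        exact Measurable.lintegral_prod_right'
          (f := fun p : Z × Z => f (p.1 - p.2) ^ 2 * g p.2 ^ 2) (by fun_prop)
    _ = _ := by
        rw [lintegral_lintegral_sub_mul (f := fun x => f x ^ 2) (g := fun x => g x ^ 2)
          (hf.pow_const 2) (hg.pow_const 2)]

/-! ### The bracket -/

theorem one_le_bracket (r : ℝ) : 1 ≤ bracket r := by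
  unfold bracket
  exact Real.one_le_sqrt.2 (by nlinarith [sq_nonneg r])

theorem bracket_pos (r : ℝ) : 0 < bracket r := zero_lt_one.trans_le (one_le_bracket r)

theorem bracket_sq (r : ℝ) : bracket r ^ 2 = 1 + r ^ 2 := Real.sq_sqrt (by positivity)

@[fun_prop]
theorem continuous_bracket : Continuous bracket := by unfold bracket; fun_prop

@[fun_prop]
theorem measurable_bracket : Measurable bracket := continuous_bracket.measurable

theorem bracket_neg (r : ℝ) : bracket (-r) = bracket r := by unfold bracket; rw [neg_sq]

theorem le_bracket (r : ℝ) : r ≤ bracket r :=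
  le_of_abs_le (Real.abs_le_sqrt (by linarith : r ^ 2 ≤ 1 + r ^ 2))

theorem bracket_le_mul {a b c : ℝ} (hc : 1 ≤ c) (ha : 0 ≤ a) (h : a ≤ c * b) :
    bracket a ≤ c * bracket b := by
  refine Real.sqrt_le_iff.2 ⟨mul_nonneg (by linarith) (bracket_pos b).le, ?_⟩
  rw [mul_pow, bracket_sq]
  nlinarith [mul_self_le_mul_self ha h]

theorem bracket_le_one_add {r : ℝ} (hr : 0 ≤ r) : bracket r ≤ 1 + r :=
  Real.sqrt_le_iff.2 ⟨by linarith, by nlinarith⟩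

theorem one_add_le_two_mul_bracket (r : ℝ) : 1 + r ≤ 2 * bracket r := by
  linarith [one_le_bracket r, le_bracket r]

theorem bracket_rpow_neg_le {r ρ : ℝ} (hr : 0 ≤ r) (hρ : 0 ≤ ρ) :
    bracket r ^ (-ρ) ≤ 2 ^ ρ * (1 + r) ^ (-ρ) := by
  have h := Real.rpow_le_rpow (by positivity) (one_add_le_two_mul_bracket r) hρ
  rw [Real.mul_rpow (by norm_num) (bracket_pos r).le] at h
  rw [Real.rpow_neg (bracket_pos r).le, Real.rpow_neg (by positivity), ← div_eq_mul_inv,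
    ← one_div, div_le_div_iff₀ (Real.rpow_pos_of_pos (bracket_pos r) _) (by positivity)]
  linarith

theorem lintegral_bracket_rpow_lt_top {E : Type*} [NormedAddCommGroup E] [NormedSpace ℝ E]
    [FiniteDimensional ℝ E] [MeasurableSpace E] [BorelSpace E] (μ : Measure E)
    [μ.IsAddHaarMeasure] {ρ : ℝ} (hρ : (Module.finrank ℝ E : ℝ) < ρ) :
    ∫⁻ x : E, ENNReal.ofReal (bracket ‖x‖ ^ (-ρ)) ∂μ < ∞ := by
  have hρ0 : 0 ≤ ρ := (Nat.cast_nonneg _).trans hρ.le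
  calc _ ≤ ∫⁻ x : E, ENNReal.ofReal (2 ^ ρ) * ENNReal.ofReal ((1 + ‖x‖) ^ (-ρ)) ∂μ := by
        refine lintegral_mono fun x => ?_
        rw [← ENNReal.ofReal_mul (by positivity)]
        exact ENNReal.ofReal_le_ofReal (bracket_rpow_neg_le (norm_nonneg x) hρ0)
    _ = ENNReal.ofReal (2 ^ ρ) * ∫⁻ x : E, ENNReal.ofReal ((1 + ‖x‖) ^ (-ρ)) ∂μ :=
        lintegral_const_mul _ (by fun_prop)
    _ < ∞ := ENNReal.mul_lt_top ENNReal.ofReal_lt_top (finite_integral_one_add_norm hρ)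

/-! ### Bilinear operators localized to balls -/

theorem lintegral_indicator_closedBall {d : ℕ} (x : Space d) {R : ℝ} (hR : 0 ≤ R) :
    ∫⁻ y : Space d, {y | ‖x - y‖ ≤ R}.indicator 1 y =
      ENNReal.ofReal (R ^ d) * volume (Metric.ball (0 : Space d) 1) := by
  have : {y | ‖x - y‖ ≤ R} = Metric.closedBall x R := by
    ext y; simp [dist_eq_norm, norm_sub_rev]
  rw [this, lintegral_indicator_one Metric.isClosed_closedBall.measurableSet,
    Measure.addHaar_closedBall volume x hR]
  simp

/-- Here `z - x` and `x` are the input frequencies and `y` is the centre of a ball. If `‖x - y‖ ≤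
⟨z⟩`, the two brackets on the right are at most 3⟨z⟩ and 2⟨z⟩, so decay in the output frequency can
be traded for decay of each input away from its own centre, `-y` or `y`. -/
theorem indicator_mul_bracket_rpow_le {d : ℕ} {ρ : ℝ} (hρ : 0 ≤ ρ) (z x y : Space d) :
    {p : Space d × Space d × Space d | ‖p.2.1 - p.2.2‖ ≤ bracket ‖p.1‖}.indicator
        (1 : Space d × Space d × Space d → ℝ≥0∞) (z, x, y) * ENNReal.ofReal (bracket ‖z‖ ^ (-(2 * ρ))) ≤
      ENNReal.ofReal (6 ^ ρ) * (ENNReal.ofReal (bracket ‖(z - x) + y‖ ^ (-ρ)) *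
        ENNReal.ofReal (bracket ‖x - y‖ ^ (-ρ))) := by
  by_cases h : ‖x - y‖ ≤ bracket ‖z‖
  swap
  · rw [Set.indicator_of_notMem (by simpa using h)]; simp
  rw [Set.indicator_of_mem (by simpa using h), Pi.one_apply, one_mul,
    ← ENNReal.ofReal_mul (by have := bracket_pos ‖z - x + y‖; positivity),
    ← ENNReal.ofReal_mul (by positivity)]
  refine ENNReal.ofReal_le_ofReal ?_
  set R := bracket ‖z‖
  have hR1 : 1 ≤ R := one_le_bracket _
  have hR : 0 < R := bracket_pos _
  have h1 : bracket ‖x - y‖ ≤ 2 * R := (bracket_le_one_add (norm_nonneg _)).trans (by linarith)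
  have h2 : bracket ‖z - x + y‖ ≤ 3 * R := by
    refine (bracket_le_one_add (norm_nonneg _)).trans ?_
    have : ‖z - x + y‖ ≤ ‖z‖ + ‖x - y‖ := by
      rw [show z - x + y = z - (x - y) by abel]; exact norm_sub_le _ _
    linarith [le_bracket ‖z‖]
  have b1 := bracket_pos ‖x - y‖
  have b2 := bracket_pos ‖z - x + y‖
  have h3 : (bracket ‖z - x + y‖ * bracket ‖x - y‖) ^ ρ ≤ (6 * (R * R)) ^ ρ :=
    Real.rpow_le_rpow (by positivity) (by nlinarith) hρ
  rw [Real.mul_rpow (x := 6) (by norm_num) (by positivity)] at h3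
  rw [← Real.mul_rpow b2.le b1.le, Real.rpow_neg hR.le, Real.rpow_neg (by positivity),
    show R ^ (2 * ρ) = (R * R) ^ ρ by rw [← sq, Real.rpow_mul hR.le]; norm_num,
    ← div_eq_mul_inv, ← one_div, div_le_div_iff₀ (by positivity) (by positivity)]
  linarith

set_option maxHeartbeats 400000 in
-- Almost orthogonality without a discrete decomposition. With R = ⟨ζ.fst⟩, the `η`-integral is
-- averaged over the centres `y` of balls of radius R, Cauchy-Schwarz is used in each ball, and
-- Minkowski moves the L² norm inside the `y`-integral. The surplus R^(-ρ) turns the normalization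
-- R^(-2d) into R^(-2ρ') with ρ' > d, which, once shared between the inputs, is integrable in `y`.
theorem exists_lintegral_sq_bilinear_le_of_ball (d : ℕ) {ρ : ℝ} (hρ : 0 < ρ) :
    ∃ C : ℝ≥0, ∀ (k : SpaceTime d → SpaceTime d → ℝ≥0∞) (_ : Measurable (Function.uncurry k))
      (A : ℝ≥0∞) (_ : ∀ ζ y, ∫⁻ η : SpaceTime d,
        {ξ : Space d | ‖ξ - y‖ ≤ bracket ‖ζ.fst‖}.indicator 1 η.fst * k ζ η ^ 2 ≤
          A * ENNReal.ofReal (bracket ‖ζ.fst‖ ^ (-ρ)))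
      (f g : SpaceTime d → ℝ≥0∞) (_ : Measurable f) (_ : Measurable g),
      ∫⁻ ζ, (∫⁻ η, k ζ η * (f (ζ - η) * g η)) ^ 2 ≤
        C * A * ((∫⁻ ζ, f ζ ^ 2) * ∫⁻ η, g η ^ 2) := by
  set c : ℝ≥0∞ := volume (Metric.ball (0 : Space d) 1) with hc
  have hc0 : c ≠ 0 := (Metric.measure_ball_pos volume _ one_pos).ne'
  have hct : c ≠ ∞ := measure_ball_lt_top.ne
  set ρ' : ℝ := d + ρ / 2 with hρ'
  have hρ'0 : 0 ≤ ρ' := by positivity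
  set Θ : ℝ≥0∞ := ∫⁻ x : Space d, ENNReal.ofReal (bracket ‖x‖ ^ (-ρ')) with hΘ
  have hΘt : Θ ≠ ∞ := by
    refine (lintegral_bracket_rpow_lt_top volume ?_).ne
    rw [finrank_euclideanSpace_fin]; linarith
  set C₀ : ℝ≥0∞ := ENNReal.ofReal (6 ^ ρ') * Θ ^ 2 * (c⁻¹) ^ 2 with hC₀
  have hC₀t : C₀ ≠ ∞ := by
    refine ENNReal.mul_ne_top (ENNReal.mul_ne_top ENNReal.ofReal_ne_top (ENNReal.pow_ne_top hΘt)) ?_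
    exact ENNReal.pow_ne_top (ENNReal.inv_ne_top.2 hc0)
  refine ⟨C₀.toNNReal, fun k hk A hA f g hf hg => ?_⟩
  rw [ENNReal.coe_toNNReal hC₀t]
  set u : Space d × Space d × Space d → ℝ≥0∞ :=
    {p | ‖p.2.1 - p.2.2‖ ≤ bracket ‖p.1‖}.indicator 1 with hu
  have hum : Measurable u :=
    measurable_one.indicator (measurableSet_le (by fun_prop) (by fun_prop))
  have husq : ∀ p, u p ^ 2 = u p := fun p => by
    simp only [hu, Set.indicator_apply]; split_ifs <;> simp
  have hk' : ∀ ζ, Measurable (k ζ) := fun ζ => hk.comp measurable_prodMk_left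
  set S : SpaceTime d → Space d → ℝ≥0∞ := fun ζ y =>
    (A * ∫⁻ η : SpaceTime d, u (ζ.fst, η.fst, y) * ENNReal.ofReal (bracket ‖ζ.fst‖ ^ (-(2 * ρ'))) *
      (f (ζ - η) ^ 2 * g η ^ 2)) ^ (1 / 2 : ℝ) with hS
  have hJm : Measurable fun p : SpaceTime d × Space d => ∫⁻ η : SpaceTime d,
      u (p.1.fst, η.fst, p.2) * ENNReal.ofReal (bracket ‖p.1.fst‖ ^ (-(2 * ρ'))) *
      (f (p.1 - η) ^ 2 * g η ^ 2) :=
    Measurable.lintegral_prod_right' (f := fun q : (SpaceTime d × Space d) × SpaceTime d =>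
      u (q.1.1.fst, q.2.fst, q.1.2) * ENNReal.ofReal (bracket ‖q.1.1.fst‖ ^ (-(2 * ρ'))) *
      (f (q.1.1 - q.2) ^ 2 * g q.2 ^ 2)) (by fun_prop)
  have hJy : ∀ y : Space d, Measurable fun ζ : SpaceTime d => ∫⁻ η : SpaceTime d,
      u (ζ.fst, η.fst, y) * ENNReal.ofReal (bracket ‖ζ.fst‖ ^ (-(2 * ρ'))) *
      (f (ζ - η) ^ 2 * g η ^ 2) := fun y =>
    Measurable.lintegral_prod_right' (f := fun q : SpaceTime d × SpaceTime d =>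
      u (q.1.fst, q.2.fst, y) * ENNReal.ofReal (bracket ‖q.1.fst‖ ^ (-(2 * ρ'))) *
      (f (q.1 - q.2) ^ 2 * g q.2 ^ 2)) (by fun_prop)
  have hSm : Measurable (Function.uncurry S) := (hJm.const_mul A).pow_const _
  have hSsq : ∀ ζ y, S ζ y ^ 2 = A * ∫⁻ η : SpaceTime d, u (ζ.fst, η.fst, y) *
      ENNReal.ofReal (bracket ‖ζ.fst‖ ^ (-(2 * ρ'))) * (f (ζ - η) ^ 2 * g η ^ 2) := fun ζ y => by
    rw [hS, ← ENNReal.rpow_two, ← ENNReal.rpow_mul]; norm_num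
  -- The indicator `u` has `y`-integral `c R^d`; this explains the prefactor `c` and the
  -- normalization `R^(-d)`.
  have step1 : ∀ ζ, c * ∫⁻ η, k ζ η * (f (ζ - η) * g η) ≤ ∫⁻ y, S ζ y := by
    intro ζ
    have hR := bracket_pos ‖ζ.fst‖
    set R := bracket ‖ζ.fst‖ with hRdef
    have e1 : ∀ η : SpaceTime d, ∫⁻ y, u (ζ.fst, η.fst, y) = ENNReal.ofReal (R ^ d) * c :=
      fun η => lintegral_indicator_closedBall η.fst hR.le
    calc c * ∫⁻ η, k ζ η * (f (ζ - η) * g η)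
        = ENNReal.ofReal (R ^ (-(d : ℝ))) *
            ∫⁻ η, (∫⁻ y, u (ζ.fst, η.fst, y)) * (k ζ η * (f (ζ - η) * g η)) := by
          simp only [e1]
          rw [lintegral_const_mul _ (by fun_prop), ← mul_assoc, ← mul_assoc,
            ← ENNReal.ofReal_mul (by positivity), ← Real.rpow_natCast, ← Real.rpow_add hR]
          simp
      _ = ENNReal.ofReal (R ^ (-(d : ℝ))) *
            ∫⁻ y, ∫⁻ η, u (ζ.fst, η.fst, y) * (k ζ η * (f (ζ - η) * g η)) := by
          congr 1
          rw [← lintegral_lintegral_swap]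
          · refine lintegral_congr fun η => ?_
            rw [lintegral_mul_const _ (by fun_prop)]
          · refine Measurable.aemeasurable ?_
            have := hk' ζ
            simp only [Function.uncurry_def]
            fun_prop
      _ = ∫⁻ y, ENNReal.ofReal (R ^ (-(d : ℝ))) *
            ∫⁻ η, u (ζ.fst, η.fst, y) * (k ζ η * (f (ζ - η) * g η)) := by
          rw [lintegral_const_mul']
          exact ENNReal.ofReal_ne_top
      _ ≤ ∫⁻ y, S ζ y := by
          refine lintegral_mono fun y => ?_
          refine (ENNReal.pow_le_pow_left_iff two_ne_zero).1 ?_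
          have huy : Measurable fun η : SpaceTime d => u (ζ.fst, η.fst, y) := by fun_prop
          have e2 : (∫⁻ η, u (ζ.fst, η.fst, y) * (k ζ η * (f (ζ - η) * g η))) ^ 2 ≤
              (A * ENNReal.ofReal (R ^ (-ρ))) *
                ∫⁻ η, u (ζ.fst, η.fst, y) * (f (ζ - η) ^ 2 * g η ^ 2) := by
            have := sq_lintegral_mul_le (μ := volume)
              (f := fun η => u (ζ.fst, η.fst, y) * k ζ η)
              (g := fun η => u (ζ.fst, η.fst, y) * (f (ζ - η) * g η))
              (huy.mul (hk' ζ)).aemeasurable (by fun_prop)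
            simp only [mul_pow, husq] at this
            refine le_trans (le_of_eq ?_) (this.trans (mul_le_mul_left (hA ζ y) _))
            congr 1
            refine lintegral_congr fun η => ?_
            rw [mul_mul_mul_comm, ← sq, husq]
          rw [mul_pow, hSsq]
          have e3 : ∀ η, u (ζ.fst, η.fst, y) * ENNReal.ofReal (R ^ (-(2 * ρ'))) *
              (f (ζ - η) ^ 2 * g η ^ 2) = ENNReal.ofReal (R ^ (-(2 * ρ'))) *
              (u (ζ.fst, η.fst, y) * (f (ζ - η) ^ 2 * g η ^ 2)) := fun η => by ring
          simp only [← hRdef, e3]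
          rw [lintegral_const_mul _ (by fun_prop)]
          calc _ ≤ ENNReal.ofReal (R ^ (-(d : ℝ))) ^ 2 * ((A * ENNReal.ofReal (R ^ (-ρ))) *
                ∫⁻ η, u (ζ.fst, η.fst, y) * (f (ζ - η) ^ 2 * g η ^ 2)) := by gcongr
            _ = _ := by
              have : ENNReal.ofReal (R ^ (-(2 * ρ'))) =
                  ENNReal.ofReal (R ^ (-(d : ℝ))) ^ 2 * ENNReal.ofReal (R ^ (-ρ)) := by
                rw [← ENNReal.ofReal_pow (by positivity), ← ENNReal.ofReal_mul (by positivity),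
                  ← Real.rpow_natCast, ← Real.rpow_mul hR.le, ← Real.rpow_add hR]
                congr 2
                rw [hρ']; push_cast; ring
              rw [this]; ring
  -- `P y` and `Q y` measure the mass of `f²` near `-y` and of `g²` near `y`; their `y`-integrals
  -- cost only the constant `Θ`, finite because `ρ' > d`.
  set P : Space d → ℝ≥0∞ := fun y =>
    ∫⁻ ζ : SpaceTime d, f ζ ^ 2 * ENNReal.ofReal (bracket ‖ζ.fst + y‖ ^ (-ρ')) with hP
  set Q : Space d → ℝ≥0∞ := fun y =>
    ∫⁻ ζ : SpaceTime d, g ζ ^ 2 * ENNReal.ofReal (bracket ‖ζ.fst - y‖ ^ (-ρ')) with hQ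
  have hPm : Measurable P := Measurable.lintegral_prod_right'
    (f := fun q : Space d × SpaceTime d =>
      f q.2 ^ 2 * ENNReal.ofReal (bracket ‖q.2.fst + q.1‖ ^ (-ρ'))) (by fun_prop)
  have hQm : Measurable Q := Measurable.lintegral_prod_right'
    (f := fun q : Space d × SpaceTime d =>
      g q.2 ^ 2 * ENNReal.ofReal (bracket ‖q.2.fst - q.1‖ ^ (-ρ'))) (by fun_prop)
  have hPI : ∫⁻ y, P y = (∫⁻ ζ, f ζ ^ 2) * Θ := by
    rw [hP, lintegral_lintegral_swap (by fun_prop), ← lintegral_mul_const _ (by fun_prop)]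
    refine lintegral_congr fun ζ => ?_
    rw [lintegral_const_mul _ (by fun_prop), lintegral_add_left_eq_self
      (fun y : Space d => ENNReal.ofReal (bracket ‖y‖ ^ (-ρ')))]
  have hQI : ∫⁻ y, Q y = (∫⁻ ζ, g ζ ^ 2) * Θ := by
    rw [hQ, lintegral_lintegral_swap (by fun_prop), ← lintegral_mul_const _ (by fun_prop)]
    refine lintegral_congr fun ζ => ?_
    rw [lintegral_const_mul _ (by fun_prop), lintegral_sub_left_eq_self
      (fun y : Space d => ENNReal.ofReal (bracket ‖y‖ ^ (-ρ')))]
  have step2 : ∀ y, ∫⁻ ζ, S ζ y ^ 2 ≤ A * (ENNReal.ofReal (6 ^ ρ') * (P y * Q y)) := by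
    intro y
    simp only [hSsq]
    rw [lintegral_const_mul _ (hJy y)]
    refine mul_le_mul_right ?_ _
    calc _ ≤ ∫⁻ ζ : SpaceTime d, ∫⁻ η : SpaceTime d, ENNReal.ofReal (6 ^ ρ') *
          ((f (ζ - η) ^ 2 * ENNReal.ofReal (bracket ‖(ζ - η).fst + y‖ ^ (-ρ'))) *
            (g η ^ 2 * ENNReal.ofReal (bracket ‖η.fst - y‖ ^ (-ρ')))) := by
          refine lintegral_mono fun ζ => lintegral_mono fun η => ?_
          refine (mul_le_mul_left (indicator_mul_bracket_rpow_le hρ'0 ζ.fst η.fst y) _).trans_eq ?_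
          rw [show (ζ - η).fst = ζ.fst - η.fst from rfl]
          ring
      _ = ENNReal.ofReal (6 ^ ρ') * ∫⁻ ζ : SpaceTime d, ∫⁻ η : SpaceTime d, 
          ((f (ζ - η) ^ 2 * ENNReal.ofReal (bracket ‖(ζ - η).fst + y‖ ^ (-ρ'))) *
            (g η ^ 2 * ENNReal.ofReal (bracket ‖η.fst - y‖ ^ (-ρ')))) := by
          rw [← lintegral_const_mul' _ _ ENNReal.ofReal_ne_top]
          exact lintegral_congr fun ζ => lintegral_const_mul' _ _ ENNReal.ofReal_ne_top
      _ = _ := by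
          rw [lintegral_lintegral_sub_mul
            (f := fun ζ : SpaceTime d => f ζ ^ 2 * ENNReal.ofReal (bracket ‖ζ.fst + y‖ ^ (-ρ')))
            (g := fun η : SpaceTime d => g η ^ 2 * ENNReal.ofReal (bracket ‖η.fst - y‖ ^ (-ρ')))
            (by fun_prop) (by fun_prop)]
  have step3 : c ^ 2 * ∫⁻ ζ, (∫⁻ η, k ζ η * (f (ζ - η) * g η)) ^ 2 ≤
      A * (ENNReal.ofReal (6 ^ ρ') * (((∫⁻ ζ, f ζ ^ 2) * Θ) * ((∫⁻ ζ, g ζ ^ 2) * Θ))) := by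
    calc _ = ∫⁻ ζ, (c * ∫⁻ η, k ζ η * (f (ζ - η) * g η)) ^ 2 := by
          simp only [mul_pow]
          rw [lintegral_const_mul' _ _ (ENNReal.pow_ne_top hct)]
      _ ≤ ∫⁻ ζ, (∫⁻ y, S ζ y) ^ 2 := lintegral_mono fun ζ => by gcongr; exact step1 ζ
      _ ≤ (∫⁻ y, (∫⁻ ζ, S ζ y ^ 2) ^ (1 / 2 : ℝ)) ^ 2 := lintegral_sq_lintegral_le hSm
      _ ≤ (∫⁻ y, (A * ENNReal.ofReal (6 ^ ρ')) ^ (1 / 2 : ℝ) *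
            (P y ^ (1 / 2 : ℝ) * Q y ^ (1 / 2 : ℝ))) ^ 2 := by
          gcongr with y
          refine (ENNReal.rpow_le_rpow (step2 y) (by norm_num)).trans_eq ?_
          rw [← mul_assoc, ENNReal.mul_rpow_of_nonneg _ _ (by norm_num),
            ENNReal.mul_rpow_of_nonneg (P y) _ (by norm_num)]
      _ = (A * ENNReal.ofReal (6 ^ ρ')) *
            (∫⁻ y, (P y ^ (1 / 2 : ℝ) * Q y ^ (1 / 2 : ℝ))) ^ 2 := by
          rw [lintegral_const_mul _ (by fun_prop), mul_pow, ← ENNReal.rpow_two,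
            ← ENNReal.rpow_mul]
          norm_num
      _ ≤ (A * ENNReal.ofReal (6 ^ ρ')) * ((∫⁻ y, (P y ^ (1 / 2 : ℝ)) ^ 2) *
            ∫⁻ y, (Q y ^ (1 / 2 : ℝ)) ^ 2) := by
          gcongr
          exact sq_lintegral_mul_le (by fun_prop) (by fun_prop)
      _ = _ := by
          have : ∀ x : ℝ≥0∞, (x ^ (1 / 2 : ℝ)) ^ 2 = x := fun x => by
            rw [← ENNReal.rpow_two, ← ENNReal.rpow_mul]; norm_num
          simp only [this]
          rw [hPI, hQI]; ring
  have hcc : (c⁻¹) ^ 2 * c ^ 2 = 1 := by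
    rw [← mul_pow, ENNReal.inv_mul_cancel hc0 hct, one_pow]
  calc _ = (c⁻¹) ^ 2 * (c ^ 2 * ∫⁻ ζ, (∫⁻ η, k ζ η * (f (ζ - η) * g η)) ^ 2) := by
        rw [← mul_assoc, hcc, one_mul]
    _ ≤ _ := mul_le_mul_right step3 _
    _ = _ := by rw [hC₀]; ring

/-! ### Pointwise bounds for the kernel -/

theorem le_rpow_of_sq_le {r X β : ℝ} (hr1 : r ≤ 1) (hX : 0 < X) (h : r ^ 2 ≤ X)
    (hβ : 0 ≤ β) (hβ2 : β ≤ 1 / 2) : r ≤ X ^ β := by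
  rcases le_total 1 X with h1 | h1
  · exact hr1.trans (Real.one_le_rpow h1 hβ)
  · calc r ≤ √X := Real.le_sqrt_of_sq_le h
      _ = X ^ (1 / 2 : ℝ) := Real.sqrt_eq_rpow X
      _ ≤ X ^ β := Real.rpow_le_rpow_of_exponent_ge hX h1 hβ2

/-- Since `a` is the shortest side, the smallest defect is `a + min p q - max p q`, so it is at most
`h` whichever alternative holds. For `p ≤ q` the other three factors are at most `6p`, `2p` and
`2a`. -/
theorem sq_le_of_heron {a p q W h : ℝ} (ha : 0 ≤ a) (hap : a ≤ p) (haq : a ≤ q) (hpq : p ≤ a + q)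
    (hqp : q ≤ a + p) (hW : 4 * W ^ 2 ≤ (a + p + q) * (p + q - a) * (a + p - q) * (a + q - p))
    (hh : a + p - q ≤ h ∨ a + q - p ≤ h ∨ p + q - a ≤ h) : W ^ 2 ≤ 6 * a * p * q * h := by
  have key : ∀ {p q : ℝ}, a ≤ p → p ≤ q → q ≤ a + p →
      4 * W ^ 2 ≤ (a + p + q) * (p + q - a) * (a + p - q) * (a + q - p) → a + p - q ≤ h →
      W ^ 2 ≤ 6 * a * p * q * h := by
    intro p q hap hpq hqp hW hh
    have hp : 0 ≤ p := ha.trans hap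
    have hh0 : 0 ≤ h := by linarith
    have h1 : (a + p + q) * (p + q - a) ≤ (6 * p) * (2 * p) :=
      mul_le_mul (by linarith) (by linarith) (by linarith) (by linarith)
    have h2 : (a + p - q) * (a + q - p) ≤ h * (2 * a) :=
      mul_le_mul hh (by linarith) (by linarith) hh0
    have h3 : (a + p + q) * (p + q - a) * ((a + p - q) * (a + q - p)) ≤
        ((6 * p) * (2 * p)) * (h * (2 * a)) :=
      mul_le_mul h1 h2 (mul_nonneg (by linarith) (by linarith)) (by positivity)
    have h4 : a * p * h * p ≤ a * p * h * q := by gcongr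
    nlinarith
  rcases le_total p q with h | h
  · exact key hap h hqp hW (by rcases hh with h | h | h <;> linarith)
  · have := key haq h (by linarith) (hW.trans_eq (by ring))
      (by rcases hh with h | h | h <;> linarith)
    exact this.trans_eq (by ring)

/-- The ratio `W / (a p)` is at most 1 and its square at most `72Λ/⟨a⟩`, so the ratio is bounded by
any power `β ∈ [0, 1/2]` of the latter. For `a ≥ 1` the square is estimated with `q ≤ 2p` and `⟨a⟩ ≤
2a`; for `a ≤ 1` the quantity `72Λ/⟨a⟩` is at least 1. -/
theorem div_le_mul_rpow {a p q W Λ β : ℝ} (ha : 0 < a) (hap : a ≤ p)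
    (hqp : q ≤ a + p) (haq : a ≤ q) (hW0 : 0 ≤ W) (hWp : W ≤ a * p) (hΛ : 1 ≤ Λ)
    (hW : W ^ 2 ≤ 6 * a * p * q * (3 * Λ)) (hβ : 0 ≤ β) (hβ2 : β ≤ 1 / 2) :
    W / a ≤ p * (72 ^ β * Λ ^ β * bracket a ^ (-β)) := by
  have hp : 0 < p := ha.trans_le hap
  have hB := bracket_pos a
  have h1 : W / (a * p) ≤ (72 * Λ / bracket a) ^ β := by
    refine le_rpow_of_sq_le (div_le_one_of_le₀ hWp (by positivity))
      (by positivity) ?_ hβ hβ2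
    rcases le_total a 1 with h | h
    · have : W / (a * p) ≤ 1 := div_le_one_of_le₀ hWp (by positivity)
      have h2 : bracket a ≤ 2 := (bracket_le_one_add ha.le).trans (by linarith)
      have h3 : 1 ≤ 72 * Λ / bracket a := by rw [le_div_iff₀ hB]; linarith
      have h4 : 0 ≤ W / (a * p) := by positivity
      nlinarith
    · have h2 : bracket a ≤ 2 * a := (bracket_le_one_add ha.le).trans (by linarith)
      rw [div_pow, div_le_div_iff₀ (by positivity) hB]
      have hq2 : q ≤ 2 * p := by linarith
      have hq : 0 < q := ha.trans_le haq
      calc W ^ 2 * bracket a ≤ (6 * a * p * q * (3 * Λ)) * (2 * a) := by gcongr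
        _ ≤ (6 * a * p * (2 * p) * (3 * Λ)) * (2 * a) := by gcongr
        _ = _ := by ring
  have h2 : (72 * Λ / bracket a) ^ β = 72 ^ β * Λ ^ β * bracket a ^ (-β) := by
    rw [Real.div_rpow (by positivity) hB.le, Real.mul_rpow (by norm_num) (by positivity),
      Real.rpow_neg hB.le, div_eq_mul_inv]
  rw [← h2]
  calc W / a = p * (W / (a * p)) := by field_simp
    _ ≤ _ := by gcongr

/-- The powers of `L₀` cancel exactly, and the exponent of `L₁L₂` becomes `-1 - 4ε`. -/
theorem modulation_le {L₀ L₁ L₂ ε : ℝ} (h₀ : 1 ≤ L₀) (h₁ : 1 ≤ L₁) (h₂ : 1 ≤ L₂) (hε : 0 ≤ ε) :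
    (L₀ * L₁ * L₂) ^ (1 / 2 - 2 * ε) *
        (L₀ ^ (-(1 / 2 - 2 * ε)) * (L₁ * L₂) ^ (-(3 / 2 + 2 * ε))) ≤
      (L₁ * L₂) ^ (-(1 + 2 * ε)) := by
  have p0 : 0 < L₀ := by linarith
  have p12 : 1 ≤ L₁ * L₂ := one_le_mul_of_one_le_of_one_le h₁ h₂
  have p : 0 < L₁ * L₂ := by linarith
  rw [mul_assoc, Real.mul_rpow p0.le p.le, mul_mul_mul_comm, ← Real.rpow_add p0,
    ← Real.rpow_add p, add_neg_cancel, Real.rpow_zero, one_mul]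
  exact Real.rpow_le_rpow_of_exponent_le p12 (by linarith)

/-- An input frequency `n₁` is smallest, so `n₀ ≤ 2n₂` and `n₂ ≤ 2n₀`. The weights of the two high
frequencies cancel, and the low one collects the decay `2s + β`. -/
theorem frequency_le_of_low_factor {n₀ n₁ n₂ W s β ρ : ℝ} (h0 : 0 ≤ n₀) (h1 : 0 < n₁) (h2 : 0 < n₂)
    (h20 : n₂ ≤ n₁ + n₀) (h02 : n₀ ≤ n₁ + n₂) (h10 : n₁ ≤ n₀) (h12 : n₁ ≤ n₂) (hW : 0 ≤ W)
    (hs : 0 ≤ s) (hρ : ρ ≤ 2 * s + β) :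
    W / n₁ * (n₀ * bracket n₁ ^ (-β)) *
        (bracket n₀ ^ (2 * s - 2) * bracket n₁ ^ (-(2 * s)) * bracket n₂ ^ (-(2 * s))) ≤
      2 * 2 ^ (2 * s) * (W / (n₁ * n₂) * bracket n₁ ^ (-ρ)) := by
  have B0 := bracket_pos n₀
  have B1 := bracket_pos n₁
  have B2 := bracket_pos n₂
  have e1 : bracket n₁ ^ (-β) * bracket n₁ ^ (-(2 * s)) ≤ bracket n₁ ^ (-ρ) := by
    rw [← Real.rpow_add B1]
    exact Real.rpow_le_rpow_of_exponent_le (one_le_bracket _) (by linarith)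
  have e2 : n₂ * n₀ * (bracket n₀ ^ (2 * s - 2) * bracket n₂ ^ (-(2 * s))) ≤ 2 * 2 ^ (2 * s) := by
    have e3 : bracket n₀ ^ (2 * s) ≤ 2 ^ (2 * s) * bracket n₂ ^ (2 * s) := by
      rw [← Real.mul_rpow (by norm_num) B2.le]
      exact Real.rpow_le_rpow B0.le (bracket_le_mul (by norm_num) h0 (by linarith)) (by linarith)
    calc _ ≤ (2 * bracket n₀) * bracket n₀ *
          (bracket n₀ ^ (2 * s - 2) * bracket n₂ ^ (-(2 * s))) := by
          gcongr
          · linarith [le_bracket n₀]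
          · exact le_bracket n₀
      _ = 2 * bracket n₀ ^ (2 * s) * bracket n₂ ^ (-(2 * s)) := by
          rw [Real.rpow_sub B0, Real.rpow_two]; field_simp
      _ ≤ 2 * (2 ^ (2 * s) * bracket n₂ ^ (2 * s)) * bracket n₂ ^ (-(2 * s)) := by gcongr
      _ = _ := by
          rw [mul_assoc, mul_assoc, ← Real.rpow_add B2, add_neg_cancel, Real.rpow_zero]; ring
  calc _ = (W / (n₁ * n₂)) * (bracket n₁ ^ (-β) * bracket n₁ ^ (-(2 * s))) *
        (n₂ * n₀ * (bracket n₀ ^ (2 * s - 2) * bracket n₂ ^ (-(2 * s)))) := by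
        field_simp
    _ ≤ (W / (n₁ * n₂)) * bracket n₁ ^ (-ρ) * (2 * 2 ^ (2 * s)) := by gcongr
    _ = _ := by ring

/-- The output frequency is smallest. The inputs are comparable and leave `⟨n₁⟩^(3-4s)`, which is at
most `⟨n₀⟩^(3-4s)` because `s ≥ 3/4`; the exponents of `⟨n₀⟩` then add up to `-(2s + β)`. The
condition `n₀ ≥ 1` allows `1/n₀` to be replaced by `2/⟨n₀⟩`. -/
theorem frequency_le_of_low_product {n₀ n₁ n₂ W s β ρ : ℝ} (h0 : 1 ≤ n₀) (h12 : n₁ ≤ n₀ + n₂) (h01 : n₀ ≤ n₁) (h02 : n₀ ≤ n₂) (hW : 0 ≤ W)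
    (hs : 3 / 4 ≤ s) (hρ : ρ ≤ 2 * s + β) :
    W / n₀ * (n₁ * bracket n₀ ^ (-β)) *
        (bracket n₀ ^ (2 * s - 2) * bracket n₁ ^ (-(2 * s)) * bracket n₂ ^ (-(2 * s))) ≤
      2 * 2 ^ (2 * s) * (W / (n₁ * n₂) * bracket n₀ ^ (-ρ)) := by
  have B0 := bracket_pos n₀
  have B1 := bracket_pos n₁
  have B2 := bracket_pos n₂
  have p0 : 0 < n₀ := by linarith
  have p1 : 0 < n₁ := by linarith
  have p2 : 0 < n₂ := by linarith
  have e0 : 1 / n₀ ≤ 2 / bracket n₀ := by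
    rw [div_le_div_iff₀ p0 B0]
    linarith [bracket_le_one_add p0.le]
  have hB01 : bracket n₀ ≤ bracket n₁ := by
    simpa using bracket_le_mul le_rfl p0.le (by simpa using h01)
  have e1 : bracket n₂ ^ (1 - 2 * s) ≤ 2 ^ (2 * s) * bracket n₁ ^ (1 - 2 * s) := by
    have : bracket n₁ ^ (2 * s - 1) ≤ 2 ^ (2 * s - 1) * bracket n₂ ^ (2 * s - 1) := by
      rw [← Real.mul_rpow (by norm_num) B2.le]
      exact Real.rpow_le_rpow B1.le (bracket_le_mul (by norm_num) p1.le (by linarith))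
        (by linarith)
    have h22 : (2 : ℝ) ^ (2 * s - 1) ≤ 2 ^ (2 * s) :=
      Real.rpow_le_rpow_of_exponent_le (by norm_num) (by linarith)
    rw [show 1 - 2 * s = -(2 * s - 1) by ring, Real.rpow_neg B2.le, Real.rpow_neg B1.le,
      ← div_eq_mul_inv, ← one_div, div_le_div_iff₀ (by positivity) (by positivity), one_mul]
    exact this.trans (by gcongr)
  have e2 : n₁ * n₁ * n₂ * (bracket n₁ ^ (-(2 * s)) * bracket n₂ ^ (-(2 * s))) ≤
      2 ^ (2 * s) * bracket n₀ ^ (3 - 4 * s) := by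
    calc _ ≤ bracket n₁ * bracket n₁ * bracket n₂ *
          (bracket n₁ ^ (-(2 * s)) * bracket n₂ ^ (-(2 * s))) := by
          gcongr <;> exact le_bracket _
      _ = bracket n₁ ^ (2 - 2 * s) * bracket n₂ ^ (1 - 2 * s) := by
          rw [sub_eq_add_neg 2, sub_eq_add_neg 1, Real.rpow_add B1, Real.rpow_add B2,
            Real.rpow_two, Real.rpow_one]; ring
      _ ≤ bracket n₁ ^ (2 - 2 * s) * (2 ^ (2 * s) * bracket n₁ ^ (1 - 2 * s)) := by gcongr
      _ = 2 ^ (2 * s) * bracket n₁ ^ (3 - 4 * s) := by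
          rw [mul_left_comm, ← Real.rpow_add B1]; ring_nf
      _ ≤ _ := by
          gcongr 2 ^ (2 * s) * ?_
          exact Real.rpow_le_rpow_of_nonpos B0 hB01 (by linarith)
  have e3 : bracket n₀ ^ (-β) * bracket n₀ ^ (2 * s - 2) * (1 / bracket n₀) *
      bracket n₀ ^ (3 - 4 * s) ≤ bracket n₀ ^ (-ρ) := by
    rw [one_div, ← Real.rpow_neg_one, ← Real.rpow_add B0, ← Real.rpow_add B0, ← Real.rpow_add B0]
    exact Real.rpow_le_rpow_of_exponent_le (one_le_bracket _) (by linarith)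
  calc _ = (W / (n₁ * n₂)) * (bracket n₀ ^ (-β) * bracket n₀ ^ (2 * s - 2)) * (1 / n₀) *
        (n₁ * n₁ * n₂ * (bracket n₁ ^ (-(2 * s)) * bracket n₂ ^ (-(2 * s)))) := by
        field_simp
    _ ≤ (W / (n₁ * n₂)) * (bracket n₀ ^ (-β) * bracket n₀ ^ (2 * s - 2)) * (2 / bracket n₀) *
        (2 ^ (2 * s) * bracket n₀ ^ (3 - 4 * s)) := by gcongr
    _ = 2 * 2 ^ (2 * s) * (W / (n₁ * n₂) * (bracket n₀ ^ (-β) * bracket n₀ ^ (2 * s - 2) *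
          (1 / bracket n₀) * bracket n₀ ^ (3 - 4 * s))) := by ring
    _ ≤ _ := by gcongr

/-- Near `n₀ = 0` the factor `1/n₀` is not controlled by `1/⟨n₀⟩`, so `W` is spent on cancelling it.
As `⟨n₀⟩ ≤ 2`, any power of it is free; `ρ + 1` is chosen because, without the Jacobian, a full ball
volume has to be paid later in place of a slice volume. -/
theorem frequency_le_of_small_product {n₀ n₁ n₂ W s β ρ : ℝ} (h0 : 0 < n₀) (h0' : n₀ ≤ 1)
    (h1 : 0 ≤ n₁) (h2 : 0 ≤ n₂) (hW : W ≤ n₀ * n₂)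
    (hs : 3 / 4 ≤ s) (hρ : 0 ≤ ρ) (hβ0 : 0 ≤ β) (hβ : β ≤ 1 / 2) :
    W / n₀ * (n₁ * bracket n₀ ^ (-β)) *
        (bracket n₀ ^ (2 * s - 2) * bracket n₁ ^ (-(2 * s)) * bracket n₂ ^ (-(2 * s))) ≤
      2 ^ (2 * s + ρ) * bracket n₀ ^ (-(ρ + 1)) := by
  have B0 := bracket_pos n₀
  have B1 := bracket_pos n₁
  have B2 := bracket_pos n₂
  have e0 : W / n₀ ≤ n₂ := by rw [div_le_iff₀ h0]; linarith
  have e1 : ∀ n : ℝ, n * bracket n ^ (-(2 * s)) ≤ 1 := fun n => by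
    have B := bracket_pos n
    calc n * bracket n ^ (-(2 * s)) ≤ bracket n ^ (1 : ℝ) * bracket n ^ (-(2 * s)) := by
          rw [Real.rpow_one]; gcongr; exact le_bracket n
      _ ≤ 1 := by
          rw [← Real.rpow_add B]
          exact Real.rpow_le_one_of_one_le_of_nonpos (one_le_bracket _) (by linarith)
  have e2 : bracket n₀ ^ (-β) * bracket n₀ ^ (2 * s - 2) ≤
      2 ^ (2 * s + ρ) * bracket n₀ ^ (-(ρ + 1)) := by
    have hb2 : bracket n₀ ≤ 2 := (bracket_le_one_add h0.le).trans (by linarith)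
    calc _ = bracket n₀ ^ (2 * s - 1 - β + ρ) * bracket n₀ ^ (-(ρ + 1)) := by
          rw [← Real.rpow_add B0, ← Real.rpow_add B0]; ring_nf
      _ ≤ 2 ^ (2 * s + ρ) * bracket n₀ ^ (-(ρ + 1)) := by
          gcongr
          exact (Real.rpow_le_rpow B0.le hb2 (by linarith)).trans
            (Real.rpow_le_rpow_of_exponent_le (by norm_num) (by linarith))
  calc _ ≤ n₂ * (n₁ * bracket n₀ ^ (-β)) *
        (bracket n₀ ^ (2 * s - 2) * bracket n₁ ^ (-(2 * s)) * bracket n₂ ^ (-(2 * s))) := by gcongr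
    _ = (n₁ * bracket n₁ ^ (-(2 * s))) * (n₂ * bracket n₂ ^ (-(2 * s))) *
        (bracket n₀ ^ (-β) * bracket n₀ ^ (2 * s - 2)) := by ring
    _ ≤ 1 * 1 * (bracket n₀ ^ (-β) * bracket n₀ ^ (2 * s - 2)) := by
        gcongr
        · exact e1 n₁
        · exact e1 n₂
    _ ≤ _ := by simpa using e2

/-- Of the two factors W/min in the square, one is replaced by the null form gain and the other is
kept to produce `W / (n₁ n₂)`. The cases follow the smallest frequency, with a further split at `n₀
= 1`. -/
theorem exists_kernel_sq_le {s ε ρ : ℝ} (hs : 3 / 4 ≤ s) (hε : 0 ≤ ε) (hε' : ε ≤ 1 / 4)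
    (hρ0 : 0 ≤ ρ) (hρ : ρ ≤ 2 * s + (1 / 2 - 2 * ε)) :
    ∃ C : ℝ, 0 ≤ C ∧ ∀ n₀ n₁ n₂ W L₀ L₁ L₂ : ℝ, 0 ≤ n₀ → 0 ≤ n₁ → 0 ≤ n₂ → 0 < W →
      W ≤ n₀ * n₁ → W ≤ n₀ * n₂ → W ≤ n₁ * n₂ → n₀ ≤ n₁ + n₂ → n₁ ≤ n₀ + n₂ → n₂ ≤ n₀ + n₁ →
      1 ≤ L₀ → 1 ≤ L₁ → 1 ≤ L₂ →
      4 * W ^ 2 ≤ (n₀ + n₁ + n₂) * (n₁ + n₂ - n₀) * (n₀ + n₁ - n₂) * (n₀ + n₂ - n₁) →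
      (n₁ + n₂ - n₀ ≤ 3 * (L₀ * L₁ * L₂) ∨ n₀ + n₁ - n₂ ≤ 3 * (L₀ * L₁ * L₂) ∨
        n₀ + n₂ - n₁ ≤ 3 * (L₀ * L₁ * L₂)) →
      (W / min n₀ (min n₁ n₂) * (bracket n₀ ^ (s - 1) * L₀ ^ (-1 / 4 + ε)) /
        ((bracket n₁ ^ s * L₁ ^ (3 / 4 + ε)) * (bracket n₂ ^ s * L₂ ^ (3 / 4 + ε)))) ^ 2 ≤
      C * ((W / (n₁ * n₂) * (bracket n₁ ^ (-ρ) + bracket n₂ ^ (-ρ)) +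
        (W / (n₁ * n₂) * bracket n₀ ^ (-ρ) + bracket n₀ ^ (-(ρ + 1)))) *
          (L₁ * L₂) ^ (-(1 + 2 * ε))) := by
  set β : ℝ := 1 / 2 - 2 * ε with hβ
  have hβ0 : 0 ≤ β := by linarith
  have hβ2 : β ≤ 1 / 2 := by linarith
  have hD1 : (0 : ℝ) ≤ 2 * 2 ^ (2 * s) := by positivity
  have hD2 : (0 : ℝ) ≤ 2 ^ (2 * s + ρ) := by positivity
  set D : ℝ := 2 * 2 ^ (2 * s) + 2 ^ (2 * s + ρ) with hD
  refine ⟨72 ^ β * D, by positivity, ?_⟩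
  intro n₀ n₁ n₂ W L₀ L₁ L₂ h0 h1 h2 hW hW01 hW02 hW12 t0 t1 t2 hL0 hL1 hL2 hH hM
  have p1 : 0 < n₁ := h1.lt_of_ne (by rintro rfl; linarith)
  have p2 : 0 < n₂ := h2.lt_of_ne (by rintro rfl; linarith)
  have p0 : 0 < n₀ := h0.lt_of_ne (by rintro rfl; linarith)
  have B0 := bracket_pos n₀
  have B1 := bracket_pos n₁
  have B2 := bracket_pos n₂
  have q0 : 0 < L₀ := by linarith
  have q1 : 0 < L₁ := by linarith
  have q2 : 0 < L₂ := by linarith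
  set Λ := L₀ * L₁ * L₂ with hΛ
  have hΛ1 : 1 ≤ Λ :=
    one_le_mul_of_one_le_of_one_le (one_le_mul_of_one_le_of_one_le hL0 hL1) hL2
  set m := W / min n₀ (min n₁ n₂) with hm
  have hm0 : 0 ≤ m := by positivity
  set Φ := bracket n₀ ^ (2 * s - 2) * bracket n₁ ^ (-(2 * s)) * bracket n₂ ^ (-(2 * s)) with hΦ
  have hΦ0 : 0 ≤ Φ := by positivity
  set RHS := W / (n₁ * n₂) * (bracket n₁ ^ (-ρ) + bracket n₂ ^ (-ρ)) +
        (W / (n₁ * n₂) * bracket n₀ ^ (-ρ) + bracket n₀ ^ (-(ρ + 1))) with hRHS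
  have hsq : (m * (bracket n₀ ^ (s - 1) * L₀ ^ (-1 / 4 + ε)) /
        ((bracket n₁ ^ s * L₁ ^ (3 / 4 + ε)) * (bracket n₂ ^ s * L₂ ^ (3 / 4 + ε)))) ^ 2 =
      m * m * Φ * (L₀ ^ (-β) * (L₁ * L₂) ^ (-(3 / 2 + 2 * ε))) := by
    have e : ∀ x t : ℝ, 0 < x → (x ^ t) ^ 2 = x ^ (2 * t) := fun x t hx => by
      rw [← Real.rpow_natCast, ← Real.rpow_mul hx.le]; push_cast; ring_nf
    rw [div_pow, mul_pow, mul_pow, mul_pow, mul_pow, mul_pow, e _ _ B0, e _ _ B1, e _ _ B2,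
      e _ _ q0, e _ _ q1, e _ _ q2, hΦ, Real.mul_rpow q1.le q2.le, Real.rpow_neg B1.le,
      Real.rpow_neg B2.le, Real.rpow_neg q1.le, Real.rpow_neg q2.le,
      show 2 * (-1 / 4 + ε) = -β by rw [hβ]; ring, show 2 * (s - 1) = 2 * s - 2 by ring,
      show 2 * (3 / 4 + ε) = 3 / 2 + 2 * ε by ring]
    field_simp
  -- it suffices to bound the symbol once by the null form gain
  have main : ∀ p a : ℝ, 0 ≤ p → 0 < a → m ≤ p * (72 ^ β * Λ ^ β * bracket a ^ (-β)) →
      m * (p * bracket a ^ (-β)) * Φ ≤ D * RHS →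
      (m * (bracket n₀ ^ (s - 1) * L₀ ^ (-1 / 4 + ε)) /
        ((bracket n₁ ^ s * L₁ ^ (3 / 4 + ε)) * (bracket n₂ ^ s * L₂ ^ (3 / 4 + ε)))) ^ 2 ≤
      72 ^ β * D * (RHS * (L₁ * L₂) ^ (-(1 + 2 * ε))) := by
    intro p a hp ha hmp hfr
    have Ba := bracket_pos a
    have hmod := modulation_le hL0 hL1 hL2 hε
    rw [hsq]
    calc _ ≤ m * (p * (72 ^ β * Λ ^ β * bracket a ^ (-β))) * Φ *
          (L₀ ^ (-β) * (L₁ * L₂) ^ (-(3 / 2 + 2 * ε))) := by gcongr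
      _ = 72 ^ β * (m * (p * bracket a ^ (-β)) * Φ) *
          (Λ ^ β * (L₀ ^ (-β) * (L₁ * L₂) ^ (-(3 / 2 + 2 * ε)))) := by ring
      _ ≤ 72 ^ β * (D * RHS) * (L₁ * L₂) ^ (-(1 + 2 * ε)) := by
          gcongr
      _ = _ := by ring
  have hV : 0 ≤ W / (n₁ * n₂) := by positivity
  have r1 : W / (n₁ * n₂) * bracket n₁ ^ (-ρ) ≤ RHS := by
    have : 0 ≤ W / (n₁ * n₂) * bracket n₂ ^ (-ρ) + (W / (n₁ * n₂) * bracket n₀ ^ (-ρ) +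
      bracket n₀ ^ (-(ρ + 1))) := by positivity
    rw [hRHS]; linarith
  have r2 : W / (n₁ * n₂) * bracket n₂ ^ (-ρ) ≤ RHS := by
    have : 0 ≤ W / (n₁ * n₂) * bracket n₁ ^ (-ρ) + (W / (n₁ * n₂) * bracket n₀ ^ (-ρ) +
      bracket n₀ ^ (-(ρ + 1))) := by positivity
    rw [hRHS]; linarith
  have r3 : W / (n₁ * n₂) * bracket n₀ ^ (-ρ) ≤ RHS := by
    have : 0 ≤ W / (n₁ * n₂) * (bracket n₁ ^ (-ρ) + bracket n₂ ^ (-ρ)) +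
      bracket n₀ ^ (-(ρ + 1)) := by positivity
    rw [hRHS]; linarith
  have r4 : bracket n₀ ^ (-(ρ + 1)) ≤ RHS := by
    have : 0 ≤ W / (n₁ * n₂) * (bracket n₁ ^ (-ρ) + bracket n₂ ^ (-ρ)) +
      W / (n₁ * n₂) * bracket n₀ ^ (-ρ) := by positivity
    rw [hRHS]; linarith
  have hs0 : 0 ≤ s := by linarith
  have hR0 : 0 ≤ RHS := le_trans (by positivity) r4
  have hD1' : 2 * 2 ^ (2 * s) ≤ D := by linarith
  have hD2' : 2 ^ (2 * s + ρ) ≤ D := by linarith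
  have hmin : (n₁ ≤ n₀ ∧ n₁ ≤ n₂) ∨ (n₂ ≤ n₀ ∧ n₂ ≤ n₁) ∨ (n₀ ≤ n₁ ∧ n₀ ≤ n₂) := by
    rcases le_total n₁ n₀ with a | a <;> rcases le_total n₁ n₂ with b | b <;>
      rcases le_total n₀ n₂ with c | c <;> simp [a, b, c] <;> grind
  rcases hmin with ⟨a, b⟩ | ⟨a, b⟩ | ⟨a, b⟩
  · have hm1 : m = W / n₁ := by rw [hm, min_eq_left b, min_eq_right a]
    refine main n₀ n₁ h0 p1 ?_ ?_
    · rw [hm1]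
      exact div_le_mul_rpow p1 a (by linarith) b hW.le (by linarith) hΛ1
        (sq_le_of_heron h1 a b (by linarith) (by linarith) (hH.trans_eq (by ring))
          (by rcases hM with h | h | h
              · right; left; linarith
              · left; linarith
              · right; right; linarith)) hβ0 hβ2
    · rw [hm1]
      refine (frequency_le_of_low_factor h0 p1 p2 (by linarith) (by linarith) a b hW.le hs0
        hρ).trans ?_
      exact mul_le_mul hD1' r1 (by positivity) (by positivity)
  · have hm1 : m = W / n₂ := by rw [hm, min_eq_right b, min_eq_right a]
    refine main n₀ n₂ h0 p2 ?_ ?_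
    · rw [hm1]
      exact div_le_mul_rpow p2 a (by linarith) b hW.le (by linarith) hΛ1
        (sq_le_of_heron h2 a b (by linarith) (by linarith) (hH.trans_eq (by ring))
          (by rcases hM with h | h | h
              · right; left; linarith
              · right; right; linarith
              · left; linarith)) hβ0 hβ2
    · rw [hm1, hΦ, mul_right_comm (bracket n₀ ^ (2 * s - 2))]
      refine (frequency_le_of_low_factor h0 p2 p1 (by linarith) (by linarith) a b hW.le hs0
        hρ).trans ?_
      rw [mul_comm n₂ n₁]
      exact mul_le_mul hD1' r2 (by positivity) (by positivity)
  · have hm1 : m = W / n₀ := by rw [hm, min_eq_left (le_min a b)]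
    refine main n₁ n₀ h1 p0 ?_ ?_
    · rw [hm1]
      exact div_le_mul_rpow p0 a (by linarith) b hW.le hW01 hΛ1
        (sq_le_of_heron h0 a b (by linarith) (by linarith) (hH.trans_eq (by ring))
          (by rcases hM with h | h | h
              · right; right; linarith
              · left; linarith
              · right; left; linarith)) hβ0 hβ2
    · rw [hm1]
      rcases le_total 1 n₀ with h | h
      · refine (frequency_le_of_low_product h (by linarith) a b hW.le hs hρ).trans ?_
        exact mul_le_mul hD1' r3 (by positivity) (by positivity)
      · refine (frequency_le_of_small_product p0 h h1 h2 hW02 hs hρ0 hβ0 hβ2).trans ?_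
        exact mul_le_mul hD2' r4 (by positivity) (by positivity)

/-! ### The null form kernel -/

theorem wedge_nonneg {d : ℕ} (i j : Fin d) (x y : Space d) : 0 ≤ wedge i j x y := abs_nonneg _

theorem wedge_comm {d : ℕ} (i j : Fin d) (x y : Space d) : wedge i j x y = wedge i j y x := by
  unfold wedge
  rw [← abs_neg]
  congr 1
  ring

theorem wedge_add_left {d : ℕ} (i j : Fin d) (x y : Space d) :
    wedge i j (x + y) y = wedge i j x y := by
  unfold wedge
  congr 1
  simp only [PiLp.add_apply]
  ring

theorem sq_add_sq_le_norm_sq {d : ℕ} {i j : Fin d} (hij : i ≠ j) (x : Space d) :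
    x i ^ 2 + x j ^ 2 ≤ ‖x‖ ^ 2 := by
  rw [EuclideanSpace.real_norm_sq_eq, ← Finset.sum_pair (f := fun k => x k ^ 2) hij]
  exact Finset.sum_le_sum_of_subset_of_nonneg (Finset.subset_univ _) fun k _ _ => sq_nonneg _

/-- The multiple `z` of the component of `x` orthogonal to `y` satisfies z ∧ y = ‖y‖² (x ∧ y), while
`‖z‖²` is `‖y‖²` times the Gram determinant. The claim reduces to the planar inequality for the (i,
j) projections of `z` and `y`. -/
theorem wedge_sq_le {d : ℕ} {i j : Fin d} (hij : i ≠ j) (x y : Space d) :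
    wedge i j x y ^ 2 ≤ ‖x‖ ^ 2 * ‖y‖ ^ 2 - inner ℝ x y ^ 2 := by
  rcases eq_or_ne y 0 with rfl | hy
  · simp [wedge]
  have hy : 0 < ‖y‖ ^ 2 := by positivity
  set z := ‖y‖ ^ 2 • x - inner ℝ x y • y with hz
  have h1 : ‖z‖ ^ 2 = ‖y‖ ^ 2 * (‖x‖ ^ 2 * ‖y‖ ^ 2 - inner ℝ x y ^ 2) := by
    rw [hz, norm_sub_sq_real, norm_smul, norm_smul, inner_smul_left, inner_smul_right, mul_pow,
      mul_pow, Real.norm_eq_abs, Real.norm_eq_abs, sq_abs, sq_abs]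
    simp only [conj_trivial]
    ring
  have h2 : (z i * y j - z j * y i) ^ 2 ≤ ‖z‖ ^ 2 * ‖y‖ ^ 2 := by
    have e1 := sq_add_sq_le_norm_sq hij z
    have e2 := sq_add_sq_le_norm_sq hij y
    calc _ ≤ (z i ^ 2 + z j ^ 2) * (y i ^ 2 + y j ^ 2) := by
          nlinarith [sq_nonneg (z i * y i + z j * y j)]
      _ ≤ _ := by gcongr
  have h3 : z i * y j - z j * y i = ‖y‖ ^ 2 * (x i * y j - x j * y i) := by
    simp only [hz, PiLp.sub_apply, PiLp.smul_apply, smul_eq_mul]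
    ring
  rw [h3, h1] at h2
  unfold wedge
  rw [sq_abs]
  have h4 : (‖y‖ ^ 2) ^ 2 * (x i * y j - x j * y i) ^ 2 ≤
      (‖y‖ ^ 2) ^ 2 * (‖x‖ ^ 2 * ‖y‖ ^ 2 - inner ℝ x y ^ 2) := by linarith
  exact le_of_mul_le_mul_left h4 (by positivity)

theorem wedge_le {d : ℕ} {i j : Fin d} (hij : i ≠ j) (x y : Space d) :
    wedge i j x y ≤ ‖x‖ * ‖y‖ := by
  refine le_of_sq_le_sq ?_ (by positivity)
  have := wedge_sq_le hij x y
  rw [mul_pow]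
  linarith [sq_nonneg (inner ℝ x y)]

/-- The right side is four times the Gram determinant of `x` and `y`, that is, sixteen times the
squared area of the triangle with sides `x`, `y`, `x + y`. -/
theorem wedge_heron {d : ℕ} {i j : Fin d} (hij : i ≠ j) (x y : Space d) :
    4 * wedge i j x y ^ 2 ≤ (‖x + y‖ + ‖x‖ + ‖y‖) * (‖x‖ + ‖y‖ - ‖x + y‖) *
      (‖x + y‖ + ‖x‖ - ‖y‖) * (‖x + y‖ + ‖y‖ - ‖x‖) := by
  have h1 := wedge_sq_le hij x y
  have h2 := norm_add_sq_real x y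
  have h3 : (‖x + y‖ + ‖x‖ + ‖y‖) * (‖x‖ + ‖y‖ - ‖x + y‖) *
      (‖x + y‖ + ‖x‖ - ‖y‖) * (‖x + y‖ + ‖y‖ - ‖x‖) =
      4 * ‖x‖ ^ 2 * ‖y‖ ^ 2 - (‖x + y‖ ^ 2 - ‖x‖ ^ 2 - ‖y‖ ^ 2) ^ 2 := by ring
  rw [h3, h2]
  linarith

/-- One of `|t₁ + t₂|`, `|t₁|`, `|t₂|` is the sum of the other two, according to the signs; in the
corresponding combination of the `n`'s the times cancel. -/
theorem resonance_le (n₀ n₁ n₂ t₁ t₂ : ℝ) :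
    let h := |(|t₁ + t₂| - n₀)| + |(|t₁| - n₁)| + |(|t₂| - n₂)|
    n₁ + n₂ - n₀ ≤ h ∨ n₀ + n₁ - n₂ ≤ h ∨ n₀ + n₂ - n₁ ≤ h := by
  intro h
  have a0 := abs_le.1 (le_refl |(|t₁ + t₂| - n₀)|)
  have a1 := abs_le.1 (le_refl |(|t₁| - n₁)|)
  have a2 := abs_le.1 (le_refl |(|t₂| - n₂)|)
  rcases abs_cases t₁ with ⟨e1, _⟩ | ⟨e1, _⟩ <;> rcases abs_cases t₂ with ⟨e2, _⟩ | ⟨e2, _⟩ <;>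
    rcases abs_cases (t₁ + t₂) with ⟨e0, _⟩ | ⟨e0, _⟩ <;>
    simp only [h, e0, e1, e2] at * <;>
    first
    | (left; linarith)
    | (right; left; linarith)
    | (right; right; linarith)

/-- The kernel of the bilinear form attached to the symbol
`|ξ₁ ∧ ξ₂| / min (|ξ₁ + ξ₂|, |ξ₁|, |ξ₂|)` and to the weights of the norms. -/
noncomputable def nullKernel {d : ℕ} (i j : Fin d) (s ε : ℝ) (ζ η : SpaceTime d) : ℝ :=
  wedge i j (ζ - η).fst η.fst / min ‖ζ.fst‖ (min ‖(ζ - η).fst‖ ‖η.fst‖) *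
    waveWeight (s - 1) (-1 / 4 + ε) ζ /
    (waveWeight s (3 / 4 + ε) (ζ - η) * waveWeight s (3 / 4 + ε) η)

/-- The modulation `⟨|τ| - |ξ|⟩`. -/
noncomputable def modulation {d : ℕ} (ζ : SpaceTime d) : ℝ := bracket (|ζ.snd| - ‖ζ.fst‖)

theorem exists_nullKernel_sq_le {s ε ρ : ℝ} (hs : 3 / 4 ≤ s) (hε : 0 ≤ ε) (hε' : ε ≤ 1 / 4)
    (hρ0 : 0 ≤ ρ) (hρ : ρ ≤ 2 * s + (1 / 2 - 2 * ε)) :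
    ∃ C : ℝ, 0 ≤ C ∧ ∀ (d : ℕ) (i j : Fin d), i ≠ j → ∀ ζ η : SpaceTime d,
      nullKernel i j s ε ζ η ^ 2 ≤ C * ((wedge i j (ζ - η).fst η.fst /
          (‖(ζ - η).fst‖ * ‖η.fst‖) * (bracket ‖(ζ - η).fst‖ ^ (-ρ) + bracket ‖η.fst‖ ^ (-ρ)) +
        (wedge i j (ζ - η).fst η.fst / (‖(ζ - η).fst‖ * ‖η.fst‖) * bracket ‖ζ.fst‖ ^ (-ρ) +
          bracket ‖ζ.fst‖ ^ (-(ρ + 1)))) *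
          (modulation (ζ - η) * modulation η) ^ (-(1 + 2 * ε))) := by
  obtain ⟨C, hC, h⟩ := exists_kernel_sq_le hs hε hε' hρ0 hρ
  refine ⟨C, hC, fun d i j hij ζ η => ?_⟩
  have hζ : ζ.fst = (ζ - η).fst + η.fst := by
    rw [show (ζ - η).fst = ζ.fst - η.fst from rfl, sub_add_cancel]
  have hζt : ζ.snd = (ζ - η).snd + η.snd := by
    rw [show (ζ - η).snd = ζ.snd - η.snd from rfl, sub_add_cancel]
  rcases (wedge_nonneg i j (ζ - η).fst η.fst).eq_or_lt with hW | hW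
  · have b0 := bracket_pos ‖ζ.fst‖
    have b1 : 0 < modulation (ζ - η) := bracket_pos _
    have b2 : 0 < modulation η := bracket_pos _
    rw [nullKernel, ← hW]
    simp only [zero_div, zero_mul, zero_add]
    rw [zero_pow two_ne_zero]
    positivity
  have key := h ‖ζ.fst‖ ‖(ζ - η).fst‖ ‖η.fst‖ (wedge i j (ζ - η).fst η.fst) (modulation ζ)
    (modulation (ζ - η)) (modulation η) (norm_nonneg _) (norm_nonneg _) (norm_nonneg _) hW
    -- Replacing one of ξ₁, ξ₂ by their sum leaves the minor unchanged up to sign, so it is also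
    -- bounded by products involving the output frequency.
    (by rw [wedge_comm, ← wedge_add_left, add_comm η.fst, ← hζ]; exact wedge_le hij _ _)
    (by rw [← wedge_add_left, ← hζ]; exact wedge_le hij _ _)
    (wedge_le hij _ _)
    (by rw [hζ]; exact norm_add_le _ _)
    (by calc ‖(ζ - η).fst‖ = ‖ζ.fst - η.fst‖ := rfl
          _ ≤ _ := norm_sub_le _ _)
    (by calc ‖η.fst‖ = ‖ζ.fst - (ζ - η).fst‖ := by rw [hζ]; simp
          _ ≤ _ := norm_sub_le _ _)
    (one_le_bracket _) (one_le_bracket _) (one_le_bracket _)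
    (by have := wedge_heron hij (ζ - η).fst η.fst
        rwa [← hζ] at this)
    (by
      have hres := resonance_le ‖ζ.fst‖ ‖(ζ - η).fst‖ ‖η.fst‖ (ζ - η).snd η.snd
      rw [← hζt] at hres
      have l0 : 1 ≤ modulation ζ := one_le_bracket _
      have l1 : 1 ≤ modulation (ζ - η) := one_le_bracket _
      have l2 : 1 ≤ modulation η := one_le_bracket _
      have habs : ∀ r : ℝ, |r| ≤ bracket r := fun r => by
        rcases abs_cases r with ⟨e, _⟩ | ⟨e, _⟩ <;> rw [e]
        · exact le_bracket r
        · rw [← bracket_neg]; exact le_bracket _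
      have m0 : |(|ζ.snd| - ‖ζ.fst‖)| ≤ modulation ζ := habs _
      have m1 : |(|(ζ - η).snd| - ‖(ζ - η).fst‖)| ≤ modulation (ζ - η) := habs _
      have m2 : |(|η.snd| - ‖η.fst‖)| ≤ modulation η := habs _
      -- All brackets are at least 1, so each is at most their product; this is where the factor 3
      -- comes from.
      have p12 := one_le_mul_of_one_le_of_one_le l1 l2
      have p01 := one_le_mul_of_one_le_of_one_le l0 l1
      have g0 : modulation ζ ≤ modulation ζ * modulation (ζ - η) * modulation η := by
        rw [mul_assoc]; exact le_mul_of_one_le_right (by linarith) p12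
      have g2 : modulation η ≤ modulation ζ * modulation (ζ - η) * modulation η :=
        le_mul_of_one_le_left (by linarith) p01
      have g1 : modulation (ζ - η) ≤ modulation ζ * modulation (ζ - η) * modulation η :=
        (le_mul_of_one_le_left (by linarith) l0).trans
          (le_mul_of_one_le_right (by linarith) l2)
      rcases hres with h | h | h
      · left; linarith
      · right; left; linarith
      · right; right; linarith)
  exact key

/-! ### The weighted bilinear estimate -/

theorem norm_sub_removeNth_le {n : ℕ} (k : Fin (n + 1)) (a : Space (n + 1)) (t : ℝ)
    (y : Fin n → ℝ) :
    ‖y - k.removeNth a.ofLp‖ ≤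
      ‖(WithLp.toLp 2 (k.insertNth t y : Fin (n + 1) → ℝ) : Space (n + 1)) - a‖ := by
  refine (pi_norm_le_iff_of_nonneg (norm_nonneg _)).2 fun j => ?_
  have := PiLp.norm_apply_le
    ((WithLp.toLp 2 (k.insertNth t y : Fin (n + 1) → ℝ) : Space (n + 1)) - a) (k.succAbove j)
  simpa [Fin.removeNth] using this

/-- Deleting a coordinate, and passing from the Euclidean to the sup norm, can only decrease the
norm, so an antitone profile can only increase. -/
theorem sliceBound_norm_sub {n : ℕ} {h : ℝ → ℝ≥0∞} (hm : Measurable h)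
    (ha : AntitoneOn h (Set.Ici 0)) (a : Space (n + 1)) :
    SliceBound (fun x : Space (n + 1) => h ‖x - a‖) (∫⁻ y : Fin n → ℝ, h ‖y‖) := by
  refine ⟨by fun_prop, fun k => ⟨fun y => h ‖y - k.removeNth a.ofLp‖, by fun_prop, ?_, ?_⟩⟩
  · intro t y
    exact ha (norm_nonneg _) (norm_nonneg _) (norm_sub_removeNth_le k a t y)
  · exact (lintegral_sub_right_eq_self (fun y : Fin n → ℝ => h ‖y‖) _).le

theorem SliceBound.add {n : ℕ} {ω₁ ω₂ : Space (n + 1) → ℝ≥0∞} {B₁ B₂ : ℝ≥0∞}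
    (h₁ : SliceBound ω₁ B₁) (h₂ : SliceBound ω₂ B₂) :
    SliceBound (fun x => ω₁ x + ω₂ x) (B₁ + B₂) := by
  refine ⟨h₁.1.add h₂.1, fun k => ?_⟩
  obtain ⟨u, hu, hu', hu''⟩ := h₁.2 k
  obtain ⟨v, hv, hv', hv''⟩ := h₂.2 k
  refine ⟨fun y => u y + v y, hu.add hv, fun t y => add_le_add (hu' t y) (hv' t y), ?_⟩
  rw [lintegral_add_left hu]
  exact add_le_add hu'' hv''

theorem antitoneOn_bracket_rpow {ρ : ℝ} (hρ : 0 ≤ ρ) :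
    AntitoneOn (fun r => ENNReal.ofReal (bracket r ^ (-ρ))) (Set.Ici 0) := by
  intro a ha b _ hab
  refine ENNReal.ofReal_le_ofReal
    (Real.rpow_le_rpow_of_nonpos (bracket_pos a) ?_ (by linarith))
  simpa using bracket_le_mul le_rfl ha (by simpa using hab)

/-- The weight `⟨r⟩^(-γ)` with values in `[0, ∞]`. -/
noncomputable def decay (γ r : ℝ) : ℝ≥0∞ := ENNReal.ofReal (bracket r ^ (-γ))

@[fun_prop]
theorem measurable_decay (γ : ℝ) : Measurable (decay γ) := by unfold decay; fun_prop

theorem decay_neg (γ r : ℝ) : decay γ (-r) = decay γ r := by rw [decay, bracket_neg, decay]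

theorem decay_le_one {γ : ℝ} (hγ : 0 ≤ γ) (r : ℝ) : decay γ r ≤ 1 := by
  rw [decay, ENNReal.ofReal_le_one]
  exact Real.rpow_le_one_of_one_le_of_nonpos (one_le_bracket r) (by linarith)

theorem lintegral_decay_lt_top {γ : ℝ} (hγ : 1 < γ) : ∫⁻ t, decay γ t < ∞ := by
  have := lintegral_bracket_rpow_lt_top (E := ℝ) volume (ρ := γ) (by simpa using hγ)
  refine lt_of_eq_of_lt (lintegral_congr fun t => ?_) this
  rw [decay, Real.norm_eq_abs, bracket, bracket, sq_abs]

/-- For fixed frequency each half-cone contributes at most one copy of the integral of `decay γ` in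
τ. -/
theorem lintegral_decay_modulation_le {d : ℕ} {γ : ℝ} {ω : Space d → ℝ≥0∞}
    (hω : Measurable ω) :
    ∫⁻ η : SpaceTime d, ω η.fst * decay γ (|η.snd| - ‖η.fst‖) ≤
      2 * (∫⁻ t, decay γ t) * ∫⁻ x, ω x := by
  rw [lintegral_spaceTime (by fun_prop), lintegral_lintegral_swap (by fun_prop),
    ← lintegral_const_mul _ hω]
  refine lintegral_mono fun x => ?_
  change ∫⁻ τ, ω x * decay γ (|τ| - ‖x‖) ≤ _
  rw [lintegral_const_mul _ (by fun_prop), mul_comm]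
  refine mul_le_mul_left ?_ _
  calc _ ≤ ∫⁻ τ, (decay γ (τ - 1 * ‖x‖) + decay γ (τ - (-1) * ‖x‖)) :=
        lintegral_mono fun τ => even_apply_abs_sub_le (decay_neg γ) _ _
    _ = _ := by
        rw [lintegral_add_left (by fun_prop), lintegral_sub_right_eq_self,
          lintegral_sub_right_eq_self, two_mul]

theorem measurable_wedge_div {d : ℕ} (i j : Fin d) :
    Measurable fun p : SpaceTime d × SpaceTime d =>
      wedge i j (p.1 - p.2).fst p.2.fst / (‖(p.1 - p.2).fst‖ * ‖p.2.fst‖) := by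
  unfold wedge
  fun_prop

theorem lintegral_wedge_decay_le {n : ℕ} (hn : 1 ≤ n) (i j : Fin (n + 1)) (ζ : SpaceTime (n + 1))
    (γ : ℝ) {ω : Space (n + 1) → ℝ≥0∞} {B : ℝ≥0∞} (hω : SliceBound ω B) :
    ∫⁻ η : SpaceTime (n + 1),
      ω η.fst * ENNReal.ofReal (wedge i j (ζ - η).fst η.fst / (‖(ζ - η).fst‖ * ‖η.fst‖) *
        (modulation (ζ - η) * modulation η) ^ (-γ)) ≤
      16 * (∫⁻ t, decay γ t) ^ 2 * B := by
  refine le_trans (lintegral_mono fun η => le_of_eq ?_)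
    (lintegral_wedge_le hn i j ζ (measurable_decay γ) (decay_neg γ) hω)
  have b1 : 0 < modulation (ζ - η) := bracket_pos _
  have b2 : 0 < modulation η := bracket_pos _
  have hw := wedge_nonneg i j (ζ - η).fst η.fst
  rw [Real.mul_rpow b1.le b2.le, ENNReal.ofReal_mul (by positivity),
    ENNReal.ofReal_mul (by positivity), wedge_comm, mul_comm ‖(ζ - η).fst‖]
  unfold decay modulation
  ring

/-- The integration variable is ξ₂, and ξ₁ = ξ₀ - ξ₂, so the weights are centred at `0` and at
`ζ.fst`; `ρ > n` makes them integrable over the `n` slice variables. -/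
theorem exists_lintegral_low_factor_le {n : ℕ} (hn : 1 ≤ n) {ρ γ : ℝ} (hρ : n < ρ) (hγ : 1 < γ) :
    ∃ A : ℝ≥0, ∀ (i j : Fin (n + 1)) (ζ : SpaceTime (n + 1)), ∫⁻ η : SpaceTime (n + 1),
      ENNReal.ofReal (wedge i j (ζ - η).fst η.fst / (‖(ζ - η).fst‖ * ‖η.fst‖) *
        (bracket ‖(ζ - η).fst‖ ^ (-ρ) + bracket ‖η.fst‖ ^ (-ρ)) *
          (modulation (ζ - η) * modulation η) ^ (-γ)) ≤ A := by
  have hρ0 : 0 ≤ ρ := (Nat.cast_nonneg n).trans hρ.le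
  set B : ℝ≥0∞ := ∫⁻ y : Fin n → ℝ, decay ρ ‖y‖ with hB
  have hBt : B ≠ ∞ := (lintegral_bracket_rpow_lt_top volume (by simpa using hρ)).ne
  have hIt : ∫⁻ t, decay γ t ≠ ∞ := (lintegral_decay_lt_top hγ).ne
  refine ⟨(16 * (∫⁻ t, decay γ t) ^ 2 * (B + B)).toNNReal, fun i j ζ => ?_⟩
  rw [ENNReal.coe_toNNReal (by finiteness)]
  have hω : SliceBound (fun x : Space (n + 1) => decay ρ ‖x - ζ.fst‖ + decay ρ ‖x - 0‖) (B + B) :=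
    (sliceBound_norm_sub (measurable_decay ρ) (antitoneOn_bracket_rpow hρ0) _).add
      (sliceBound_norm_sub (measurable_decay ρ) (antitoneOn_bracket_rpow hρ0) _)
  refine le_trans (lintegral_mono fun η => le_of_eq ?_)
    (lintegral_wedge_decay_le hn i j ζ γ hω)
  have b1 : 0 < modulation (ζ - η) := bracket_pos _
  have b2 : 0 < modulation η := bracket_pos _
  have b3 := bracket_pos ‖(ζ - η).fst‖
  have b4 := bracket_pos ‖η.fst‖
  have hw := wedge_nonneg i j (ζ - η).fst η.fst
  rw [sub_zero, norm_sub_rev, show ζ.fst - η.fst = (ζ - η).fst from rfl, decay, decay,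
    ← ENNReal.ofReal_add (by positivity) (by positivity), ← ENNReal.ofReal_mul (by positivity)]
  congr 1
  ring

/-- With R = ⟨ζ.fst⟩, a ball of radius R has slices of volume about R^n and volume about R^(n+1).
Multiplied by R^(-ρ) and R^(-(ρ+1)), both terms give R^(-(ρ-n)). The second term has no Jacobian:
one modulation is discarded and the other integrated in τ. -/
theorem exists_lintegral_low_product_le {n : ℕ} (hn : 1 ≤ n) {ρ γ : ℝ} (hγ : 1 < γ) :
    ∃ A : ℝ≥0, ∀ (i j : Fin (n + 1)) (ζ : SpaceTime (n + 1)) (y : Space (n + 1)),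
      ∫⁻ η : SpaceTime (n + 1),
        {ξ : Space (n + 1) | ‖ξ - y‖ ≤ bracket ‖ζ.fst‖}.indicator 1 η.fst *
          ENNReal.ofReal ((wedge i j (ζ - η).fst η.fst / (‖(ζ - η).fst‖ * ‖η.fst‖) *
            bracket ‖ζ.fst‖ ^ (-ρ) + bracket ‖ζ.fst‖ ^ (-(ρ + 1))) *
          (modulation (ζ - η) * modulation η) ^ (-γ)) ≤
      A * ENNReal.ofReal (bracket ‖ζ.fst‖ ^ (-(ρ - n))) := by
  have hγ0 : 0 ≤ γ := by linarith
  have hIt : ∫⁻ t, decay γ t ≠ ∞ := (lintegral_decay_lt_top hγ).ne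
  set c₁ : ℝ≥0∞ := volume (Metric.ball (0 : Fin n → ℝ) 1) with hc₁
  set c₂ : ℝ≥0∞ := volume (Metric.ball (0 : Space (n + 1)) 1) with hc₂
  have h1 : c₁ ≠ ∞ := measure_ball_lt_top.ne
  have h2 : c₂ ≠ ∞ := measure_ball_lt_top.ne
  refine ⟨(16 * (∫⁻ t, decay γ t) ^ 2 * c₁ + 2 * (∫⁻ t, decay γ t) * c₂).toNNReal,
    fun i j ζ y => ?_⟩
  rw [ENNReal.coe_toNNReal (by finiteness)]
  have hR := bracket_pos ‖ζ.fst‖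
  set R := bracket ‖ζ.fst‖ with hRdef
  set ω : Space (n + 1) → ℝ≥0∞ := {ξ | ‖ξ - y‖ ≤ R}.indicator 1 with hω
  have hωm : Measurable ω :=
    measurable_one.indicator (measurableSet_le (by fun_prop) (by fun_prop))
  have hslice : SliceBound ω (ENNReal.ofReal (R ^ n) * c₁) := by
    have := sliceBound_norm_sub (n := n) (h := (Set.Iic R).indicator 1)
      (measurable_one.indicator measurableSet_Iic) (by
        intro a _ b _ hab
        simp only [Set.indicator_apply, Set.mem_Iic, Pi.one_apply]
        split_ifs <;> first | linarith | simp) y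
    have e : ∫⁻ y : Fin n → ℝ, (Set.Iic R).indicator 1 ‖y‖ = ENNReal.ofReal (R ^ n) * c₁ := by
      have : (fun y : Fin n → ℝ => (Set.Iic R).indicator (1 : ℝ → ℝ≥0∞) ‖y‖) =
          (Metric.closedBall (0 : Fin n → ℝ) R).indicator 1 := by
        ext y
        by_cases h : ‖y‖ ≤ R
        · rw [Set.indicator_of_mem (show ‖y‖ ∈ Set.Iic R from h),
            Set.indicator_of_mem (mem_closedBall_zero_iff.2 h)]; rfl
        · rw [Set.indicator_of_notMem (show ‖y‖ ∉ Set.Iic R from h),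
            Set.indicator_of_notMem (fun h' => h (mem_closedBall_zero_iff.1 h'))]
      rw [this, lintegral_indicator_one Metric.isClosed_closedBall.measurableSet,
        Measure.addHaar_closedBall volume _ hR.le]
      simp [hc₁]
    rw [e] at this
    exact this
  have hvol : ∫⁻ x, ω x = ENNReal.ofReal (R ^ (n + 1)) * c₂ := by
    rw [hc₂, ← lintegral_indicator_closedBall y hR.le]
    refine lintegral_congr fun x => ?_
    simp only [hω, Set.indicator_apply, Set.mem_ofPred_eq, norm_sub_rev]
  have hpt : ∀ η : SpaceTime (n + 1), ω η.fst *
          ENNReal.ofReal ((wedge i j (ζ - η).fst η.fst / (‖(ζ - η).fst‖ * ‖η.fst‖) *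
            R ^ (-ρ) + R ^ (-(ρ + 1))) * (modulation (ζ - η) * modulation η) ^ (-γ)) ≤
      ENNReal.ofReal (R ^ (-ρ)) * (ω η.fst *
        ENNReal.ofReal (wedge i j (ζ - η).fst η.fst / (‖(ζ - η).fst‖ * ‖η.fst‖) *
        (modulation (ζ - η) * modulation η) ^ (-γ))) +
      ENNReal.ofReal (R ^ (-(ρ + 1))) * (ω η.fst * decay γ (|η.snd| - ‖η.fst‖)) := by
    intro η
    have b1 : 0 < modulation (ζ - η) := bracket_pos _
    have b2 : 0 < modulation η := bracket_pos _
    have hw := wedge_nonneg i j (ζ - η).fst η.fst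
    rw [add_mul, ENNReal.ofReal_add (by positivity) (by positivity), mul_add]
    refine add_le_add (le_of_eq ?_) ?_
    · rw [mul_right_comm, mul_comm _ (R ^ (-ρ)), ENNReal.ofReal_mul (by positivity)]
      ring
    · rw [ENNReal.ofReal_mul (by positivity), Real.mul_rpow b1.le b2.le,
        ENNReal.ofReal_mul (by positivity)]
      calc _ ≤ ω η.fst * (ENNReal.ofReal (R ^ (-(ρ + 1))) *
            (1 * ENNReal.ofReal (modulation η ^ (-γ)))) := by
            gcongr
            exact decay_le_one hγ0 (|(ζ - η).snd| - ‖(ζ - η).fst‖)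
        _ = _ := by unfold decay modulation; ring
  have hm1 : Measurable fun η : SpaceTime (n + 1) => ω η.fst *
        ENNReal.ofReal (wedge i j (ζ - η).fst η.fst / (‖(ζ - η).fst‖ * ‖η.fst‖) *
        (modulation (ζ - η) * modulation η) ^ (-γ)) := by
    have := (measurable_wedge_div i j).comp (measurable_prodMk_left (x := ζ))
    simp only [Function.comp_def] at this
    unfold modulation
    fun_prop
  calc _ ≤ _ := lintegral_mono hpt
    _ = ENNReal.ofReal (R ^ (-ρ)) * (∫⁻ η : SpaceTime (n + 1), ω η.fst *
        ENNReal.ofReal (wedge i j (ζ - η).fst η.fst / (‖(ζ - η).fst‖ * ‖η.fst‖) *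
        (modulation (ζ - η) * modulation η) ^ (-γ))) +
      ENNReal.ofReal (R ^ (-(ρ + 1))) *
        ∫⁻ η : SpaceTime (n + 1), (ω η.fst * decay γ (|η.snd| - ‖η.fst‖)) := by
        rw [lintegral_add_left (by fun_prop), lintegral_const_mul _ hm1,
          lintegral_const_mul _ (by fun_prop)]
    _ ≤ ENNReal.ofReal (R ^ (-ρ)) *
          (16 * (∫⁻ t, decay γ t) ^ 2 * (ENNReal.ofReal (R ^ n) * c₁)) +
        ENNReal.ofReal (R ^ (-(ρ + 1))) *
          (2 * (∫⁻ t, decay γ t) * (ENNReal.ofReal (R ^ (n + 1)) * c₂)) := by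
        gcongr
        · exact lintegral_wedge_decay_le hn i j ζ γ hslice
        · rw [← hvol]; exact lintegral_decay_modulation_le hωm
    _ = _ := by
        have e : ∀ (m : ℕ) (r : ℝ), r + m = -(ρ - n) →
            ENNReal.ofReal (R ^ r) * ENNReal.ofReal (R ^ m) =
              ENNReal.ofReal (R ^ (-(ρ - n))) := by
          intro m r h
          rw [← ENNReal.ofReal_mul (by positivity), ← Real.rpow_natCast, ← Real.rpow_add hR, h]
        rw [add_mul, ← e n (-ρ) (by ring)]
        congr 1
        · ring
        · rw [e n (-ρ) (by ring), ← e (n + 1) (-(ρ + 1)) (by push_cast; ring)]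
          ring

theorem measurable_waveWeight {d : ℕ} (s b : ℝ) : Measurable (waveWeight s b : SpaceTime d → ℝ) := by
  unfold waveWeight
  fun_prop

/-- From `κ ≤ √κ₁ + √κ₂` and (x + y)² ≤ 2x² + 2y², the two parts of the kernel can be treated by
different methods. -/
theorem lintegral_sq_bilinear_le_of_sq_le {d : ℕ} {κ κ₁ κ₂ : SpaceTime d → SpaceTime d → ℝ}
    (h₁ : ∀ ζ η, 0 ≤ κ₁ ζ η) (h₂ : ∀ ζ η, 0 ≤ κ₂ ζ η) (h : ∀ ζ η, κ ζ η ^ 2 ≤ κ₁ ζ η + κ₂ ζ η)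
    (hm₁ : Measurable (Function.uncurry κ₁)) {f g : SpaceTime d → ℝ≥0∞} (hf : Measurable f)
    (hg : Measurable g) :
    ∫⁻ ζ, (∫⁻ η, ENNReal.ofReal (κ ζ η) * (f (ζ - η) * g η)) ^ 2 ≤
      2 * (∫⁻ ζ, (∫⁻ η, ENNReal.ofReal (√(κ₁ ζ η)) * (f (ζ - η) * g η)) ^ 2) +
      2 * ∫⁻ ζ, (∫⁻ η, ENNReal.ofReal (√(κ₂ ζ η)) * (f (ζ - η) * g η)) ^ 2 := by
  have hκ : ∀ ζ η, ENNReal.ofReal (κ ζ η) ≤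
      ENNReal.ofReal (√(κ₁ ζ η)) + ENNReal.ofReal (√(κ₂ ζ η)) := by
    intro ζ η
    rw [← ENNReal.ofReal_add (Real.sqrt_nonneg _) (Real.sqrt_nonneg _)]
    refine ENNReal.ofReal_le_ofReal (le_of_abs_le (abs_le_of_sq_le_sq ?_ (by positivity)))
    have e1 := Real.sq_sqrt (h₁ ζ η)
    have e2 := Real.sq_sqrt (h₂ ζ η)
    have e3 := mul_nonneg (Real.sqrt_nonneg (κ₁ ζ η)) (Real.sqrt_nonneg (κ₂ ζ η))
    nlinarith [h ζ η]
  have hm : Measurable fun p : SpaceTime d × SpaceTime d =>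
      ENNReal.ofReal (√(κ₁ p.1 p.2)) * (f (p.1 - p.2) * g p.2) :=
    hm₁.sqrt.ennreal_ofReal.mul (by fun_prop)
  have hI : Measurable fun ζ => ∫⁻ η, ENNReal.ofReal (√(κ₁ ζ η)) * (f (ζ - η) * g η) :=
    Measurable.lintegral_prod_right' hm
  rw [← lintegral_const_mul' _ _ (by simp), ← lintegral_const_mul' _ _ (by simp),
    ← lintegral_add_left (by fun_prop)]
  refine lintegral_mono fun ζ => ?_
  have hmζ : Measurable fun η => ENNReal.ofReal (√(κ₁ ζ η)) * (f (ζ - η) * g η) :=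
    hm.comp measurable_prodMk_left
  calc _ ≤ ((∫⁻ η, ENNReal.ofReal (√(κ₁ ζ η)) * (f (ζ - η) * g η)) +
        ∫⁻ η, ENNReal.ofReal (√(κ₂ ζ η)) * (f (ζ - η) * g η)) ^ 2 := by
        rw [← lintegral_add_left hmζ]
        gcongr with η
        rw [← add_mul]
        gcongr
        exact hκ ζ η
    _ ≤ _ := by
        have := ENNReal.rpow_add_le_mul_rpow_add_rpow
          (∫⁻ η, ENNReal.ofReal (√(κ₁ ζ η)) * (f (ζ - η) * g η))
          (∫⁻ η, ENNReal.ofReal (√(κ₂ ζ η)) * (f (ζ - η) * g η)) (p := 2) (by norm_num)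
        simp only [ENNReal.rpow_two] at this
        refine this.trans_eq ?_
        rw [mul_add]
        norm_num

theorem exists_lintegral_sq_nullKernel_le {n : ℕ} (hn : 1 ≤ n) {s ε : ℝ} (hs : 3 / 4 ≤ s)
    (hε : 0 < ε) (hε' : ε ≤ 1 / 4) (hns : n + 2 * ε ≤ 2 * s + (1 / 2 - 2 * ε)) :
    ∃ C : ℝ≥0, ∀ i j : Fin (n + 1), i ≠ j → ∀ f g : SpaceTime (n + 1) → ℝ≥0∞,
      Measurable f → Measurable g →
      ∫⁻ ζ, (∫⁻ η, ENNReal.ofReal (nullKernel i j s ε ζ η) * (f (ζ - η) * g η)) ^ 2 ≤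
        C * ((∫⁻ ζ, f ζ ^ 2) * ∫⁻ η, g η ^ 2) := by
  -- The excess `2ε` over `n` makes the slice integrals converge for `κ₁` and is the surplus decay
  -- required on balls for `κ₂`.
  set ρ : ℝ := n + 2 * ε with hρ
  set γ : ℝ := 1 + 2 * ε with hγ
  have hγ1 : 1 < γ := by linarith
  obtain ⟨C, hC, hker⟩ := exists_nullKernel_sq_le hs hε.le hε' (by positivity) hns
  obtain ⟨A₁, hA₁⟩ := exists_lintegral_low_factor_le hn (by linarith : (n : ℝ) < ρ) hγ1
  obtain ⟨A₂, hA₂⟩ := exists_lintegral_low_product_le hn (ρ := ρ) hγ1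
  obtain ⟨C₂, hC₂⟩ := exists_lintegral_sq_bilinear_le_of_ball (n + 1)
    (by linarith : (0 : ℝ) < ρ - n)
  refine ⟨2 * (C.toNNReal * A₁) + 2 * (C₂ * (C.toNNReal * A₂)), fun i j hij f g hf hg => ?_⟩
  set κ₁ : SpaceTime (n + 1) → SpaceTime (n + 1) → ℝ := fun ζ η =>
    C * (wedge i j (ζ - η).fst η.fst / (‖(ζ - η).fst‖ * ‖η.fst‖) *
      (bracket ‖(ζ - η).fst‖ ^ (-ρ) + bracket ‖η.fst‖ ^ (-ρ)) *
      (modulation (ζ - η) * modulation η) ^ (-γ)) with hκ₁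
  set κ₂ : SpaceTime (n + 1) → SpaceTime (n + 1) → ℝ := fun ζ η =>
    C * ((wedge i j (ζ - η).fst η.fst / (‖(ζ - η).fst‖ * ‖η.fst‖) * bracket ‖ζ.fst‖ ^ (-ρ) +
        bracket ‖ζ.fst‖ ^ (-(ρ + 1))) * (modulation (ζ - η) * modulation η) ^ (-γ)) with hκ₂
  have hmod : ∀ η : SpaceTime (n + 1), 0 < modulation η := fun η => bracket_pos _
  have hbr : ∀ r : ℝ, 0 < bracket r := bracket_pos
  have h₁ : ∀ ζ η, 0 ≤ κ₁ ζ η := fun ζ η => by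
    have b1 := hmod (ζ - η)
    have b2 := hmod η
    have b3 := hbr ‖(ζ - η).fst‖
    have b4 := hbr ‖η.fst‖
    have hw := wedge_nonneg i j (ζ - η).fst η.fst
    simp only [hκ₁]; positivity
  have h₂ : ∀ ζ η, 0 ≤ κ₂ ζ η := fun ζ η => by
    have b1 := hmod (ζ - η)
    have b2 := hmod η
    have b3 := hbr ‖ζ.fst‖
    have hw := wedge_nonneg i j (ζ - η).fst η.fst
    simp only [hκ₂]; positivity
  have hwm := measurable_wedge_div i j
  have hm₁ : Measurable (Function.uncurry κ₁) := by
    simp only [hκ₁, Function.uncurry_def]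
    unfold modulation
    fun_prop
  have hm₂ : Measurable (Function.uncurry κ₂) := by
    simp only [hκ₂, Function.uncurry_def]
    unfold modulation
    fun_prop
  have hsq : ∀ {x : ℝ}, 0 ≤ x → ENNReal.ofReal (√x) ^ 2 = ENNReal.ofReal x := fun {x} hx => by
    rw [← ENNReal.ofReal_pow (Real.sqrt_nonneg x), Real.sq_sqrt hx]
  have hCr : ENNReal.ofReal C = (C.toNNReal : ℝ≥0∞) := rfl
  refine (lintegral_sq_bilinear_le_of_sq_le h₁ h₂ (fun ζ η => ?_) hm₁ hf hg).trans ?_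
  · refine (hker (n + 1) i j hij ζ η).trans_eq ?_
    simp only [hκ₁, hκ₂]
    ring
  -- `κ₁` carries the cases with an input frequency smallest, where plain Cauchy-Schwarz works; `κ₂`
  -- those with the output frequency smallest, which need the localization to balls.
  have e1 := lintegral_sq_bilinear_le (μ := (volume : Measure (SpaceTime (n + 1))))
    (k := fun ζ η => ENNReal.ofReal (√(κ₁ ζ η))) hm₁.sqrt.ennreal_ofReal
    (A := C.toNNReal * A₁) (fun ζ => by
      simp only [hsq (h₁ _ _)]
      simp only [hκ₁, ENNReal.ofReal_mul hC]
      rw [lintegral_const_mul' _ _ ENNReal.ofReal_ne_top]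
      exact mul_le_mul_right (hA₁ i j ζ) _) hf hg
  have e2 := hC₂ (fun ζ η => ENNReal.ofReal (√(κ₂ ζ η))) hm₂.sqrt.ennreal_ofReal
    (C.toNNReal * A₂) (fun ζ y => by
      simp only [hsq (h₂ _ _)]
      simp only [hκ₂, ENNReal.ofReal_mul hC, mul_left_comm _ (ENNReal.ofReal C)]
      rw [lintegral_const_mul' _ _ ENNReal.ofReal_ne_top, mul_assoc]
      exact mul_le_mul_right (hA₂ i j ζ y) _) f g hf hg
  refine (add_le_add (mul_le_mul_right e1 2) (mul_le_mul_right e2 2)).trans_eq ?_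
  push_cast
  ring

/-! ### Distributions whose Fourier transform is a function -/

theorem HasFourierTransform.congr {d : ℕ} {u : 𝓢'(SpaceTime d, ℂ)} {f g : SpaceTime d → ℂ}
    (h : HasFourierTransform u f) (hfg : f =ᵐ[volume] g) : HasFourierTransform u g := by
  refine ⟨h.1.congr hfg, fun θ => ?_⟩
  have e : (fun ζ => θ ζ * f ζ) =ᵐ[volume] fun ζ => θ ζ * g ζ := by
    filter_upwards [hfg] with ζ hζ
    rw [hζ]
  exact ⟨(h.2 θ).1.congr e, (h.2 θ).2.trans (integral_congr_ae e)⟩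

theorem HasFourierTransform.sub {d : ℕ} {u v : 𝓢'(SpaceTime d, ℂ)} {f g : SpaceTime d → ℂ}
    (hu : HasFourierTransform u f) (hv : HasFourierTransform v g) :
    HasFourierTransform (u - v) (fun ζ => f ζ - g ζ) := by
  refine ⟨hu.1.sub hv.1, fun θ => ?_⟩
  obtain ⟨h1, h1'⟩ := hu.2 θ
  obtain ⟨h2, h2'⟩ := hv.2 θ
  simp only [mul_sub]
  refine ⟨h1.sub h2, ?_⟩
  rw [integral_sub h1 h2, ← h1', ← h2']
  rfl

theorem hasFourierTransform_schwartz {d : ℕ} (φ : 𝓢(SpaceTime d, ℂ)) :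
    HasFourierTransform (φ : 𝓢'(SpaceTime d, ℂ)) (fun ζ => (𝓕 φ : 𝓢(SpaceTime d, ℂ)) ζ) := by
  refine ⟨(𝓕 φ : 𝓢(SpaceTime d, ℂ)).continuous.aestronglyMeasurable, fun θ => ⟨?_, ?_⟩⟩
  · exact ((𝓕 φ : 𝓢(SpaceTime d, ℂ)).memLp 2).integrable_mul (θ.memLp 2) |>.congr
      (Filter.Eventually.of_forall fun ζ => mul_comm _ _)
  · rw [TemperedDistribution.fourier_toTemperedDistributionCLM_eq]
    simp

theorem HasFourierTransform.locallyIntegrable {d : ℕ} {u : 𝓢'(SpaceTime d, ℂ)}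
    {f : SpaceTime d → ℂ} (h : HasFourierTransform u f) : LocallyIntegrable f volume := by
  intro ζ
  let b : ContDiffBump ζ := default
  have hb₁ : HasCompactSupport (Complex.ofRealCLM ∘ b) := b.hasCompactSupport.comp_left rfl
  have hb₂ : ContDiff ℝ ((⊤ : ℕ∞) : WithTop ℕ∞) (Complex.ofRealCLM ∘ b) :=
    Complex.ofRealCLM.contDiff.comp b.contDiff
  have hi := (h.2 (hb₁.toSchwartzMap hb₂)).1
  refine ⟨Metric.closedBall ζ b.rIn, Metric.closedBall_mem_nhds _ b.rIn_pos, ?_⟩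
  refine hi.integrableOn.congr_fun (fun η hη => ?_) Metric.isClosed_closedBall.measurableSet
  simp [b.one_of_mem_closedBall hη]

theorem HasFourierTransform.ae_eq {d : ℕ} {u : 𝓢'(SpaceTime d, ℂ)} {f g : SpaceTime d → ℂ}
    (hf : HasFourierTransform u f) (hg : HasFourierTransform u g) : f =ᵐ[volume] g := by
  refine ae_eq_of_integral_contDiff_smul_eq hf.locallyIntegrable hg.locallyIntegrable ?_
  intro b hb hbc
  have hb₁ : HasCompactSupport (Complex.ofRealCLM ∘ b) := hbc.comp_left rfl
  have hb₂ : ContDiff ℝ ((⊤ : ℕ∞) : WithTop ℕ∞) (Complex.ofRealCLM ∘ b) :=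
    Complex.ofRealCLM.contDiff.comp hb
  have e1 := (hf.2 (hb₁.toSchwartzMap hb₂)).2
  have e2 := (hg.2 (hb₁.toSchwartzMap hb₂)).2
  simpa [Complex.real_smul] using e1.symm.trans e2

theorem xNorm_eq {d : ℕ} (s b : ℝ) {u : 𝓢'(SpaceTime d, ℂ)} {f : SpaceTime d → ℂ}
    (h : HasFourierTransform u f) :
    xNorm s b u = eLpNorm (fun ζ => (waveWeight s b ζ : ℂ) * f ζ) 2 volume := by
  refine le_antisymm (iInf₂_le f h) (le_iInf₂ fun g hg => le_of_eq (eLpNorm_congr_ae ?_))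
  filter_upwards [h.ae_eq hg] with ζ hζ
  rw [hζ]

/-- `f` is a function of tempered growth times an L^p function, hence itself a tempered
distribution, whose inverse Fourier transform is taken. -/
theorem exists_hasFourierTransform_of_memLp {d : ℕ} {p : ℝ≥0∞} [hp : Fact (1 ≤ p)] (r : ℝ)
    {f : SpaceTime d → ℂ}
    (hf : MemLp (fun ζ => (((1 + ‖ζ‖ ^ 2) ^ (-r) : ℝ) : ℂ) * f ζ) p volume) :
    ∃ u : 𝓢'(SpaceTime d, ℂ), HasFourierTransform u f := by
  set w : SpaceTime d → ℂ := fun ζ => (((1 + ‖ζ‖ ^ 2) ^ r : ℝ) : ℂ) with hw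
  have hwt : w.HasTemperateGrowth := by
    rw [hw]; fun_prop
  have hcancel : ∀ ζ, w ζ * ((((1 + ‖ζ‖ ^ 2) ^ (-r) : ℝ) : ℂ) * f ζ) = f ζ := fun ζ => by
    have : (0 : ℝ) < 1 + ‖ζ‖ ^ 2 := by positivity
    rw [← mul_assoc, hw, ← Complex.ofReal_mul, ← Real.rpow_add this]
    simp
  have hmeas : AEStronglyMeasurable f volume := by
    refine (hwt.1.continuous.aestronglyMeasurable.mul hf.1).congr
      (Filter.Eventually.of_forall hcancel)
  refine ⟨𝓕⁻ (smulLeftCLM ℂ w (hf.toLp _ : 𝓢'(SpaceTime d, ℂ))), hmeas, fun θ => ⟨?_, ?_⟩⟩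
  · have := ENNReal.HolderConjugate.inv_one_sub_inv' hp.out
    have h1 := ((SchwartzMap.smulLeftCLM ℂ w θ).memLp ((1 - p⁻¹)⁻¹) volume)
    have h2 := hf.integrable_mul h1
    refine h2.congr (Filter.Eventually.of_forall fun ζ => ?_)
    rw [Pi.mul_apply, SchwartzMap.smulLeftCLM_apply_apply hwt, smul_eq_mul]
    change _ = θ ζ * f ζ
    conv_rhs => rw [← hcancel ζ]
    ring
  · rw [fourier_fourierInv_eq, smulLeftCLM_apply_apply, Lp.toTemperedDistribution_apply]
    refine integral_congr_ae ?_
    filter_upwards [hf.coeFn_toLp] with ζ hζ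
    rw [hζ, SchwartzMap.smulLeftCLM_apply_apply hwt, smul_eq_mul, smul_eq_mul]
    conv_rhs => rw [← hcancel ζ]
    ring

theorem HasFourierTransform.lineDeriv {d : ℕ} {u : 𝓢'(SpaceTime d, ℂ)} {f : SpaceTime d → ℂ}
    (h : HasFourierTransform u f) (i : Fin d) :
    HasFourierTransform (∂_{spaceVec i} u)
      (fun ζ => 2 * Real.pi * Complex.I * (ζ.fst i : ℝ) * f ζ) := by
  have hin : ∀ ζ : SpaceTime d, inner ℝ ζ (spaceVec i) = ζ.fst i := fun ζ => by
    simp [spaceVec, WithLp.prod_inner_apply, EuclideanSpace.inner_single_right]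
  have ht : (fun ζ : SpaceTime d => ((inner ℝ ζ (spaceVec i) : ℝ) : ℂ)).HasTemperateGrowth := by
    fun_prop
  refine ⟨?_, fun θ => ?_⟩
  · refine AEStronglyMeasurable.mul ?_ h.1
    have : Measurable fun ζ : SpaceTime d => 2 * (Real.pi : ℂ) * Complex.I * ((ζ.fst i : ℝ) : ℂ) := by
      fun_prop
    exact this.aestronglyMeasurable
  · obtain ⟨h1, h2⟩ := h.2 (SchwartzMap.smulLeftCLM ℂ (fun ζ : SpaceTime d =>
      ((inner ℝ ζ (spaceVec i) : ℝ) : ℂ)) θ)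
    have e : ∀ ζ, θ ζ * (2 * Real.pi * Complex.I * (ζ.fst i : ℝ) * f ζ) =
        (2 * Real.pi * Complex.I) * (SchwartzMap.smulLeftCLM ℂ (fun ζ : SpaceTime d =>
          ((inner ℝ ζ (spaceVec i) : ℝ) : ℂ)) θ ζ * f ζ) := fun ζ => by
      rw [SchwartzMap.smulLeftCLM_apply_apply ht, hin, smul_eq_mul]; ring
    simp only [e]
    refine ⟨h1.const_mul _, ?_⟩
    rw [integral_const_mul, ← h2, TemperedDistribution.fourier_lineDerivOp_eq]
    rfl

/-! ### Products and the Fourier transform -/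

theorem SchwartzMap.exists_norm_le {d : ℕ} (θ : 𝓢(SpaceTime d, ℂ)) : ∃ C, ∀ ζ, ‖θ ζ‖ ≤ C := by
  obtain ⟨C, hC⟩ := θ.decay 0 0
  exact ⟨C, fun ζ => by simpa using hC.2 ζ⟩

/-- The transpose of convolution with the transform of `χ`. The character in the inverse transform
amounts to a translation of `θ`, and the Fourier transform is then moved from `θ` onto `χ`. -/
theorem fourierInv_smulLeftCLM_fourier {d : ℕ} (χ θ : 𝓢(SpaceTime d, ℂ)) (ζ : SpaceTime d) :
    (𝓕⁻ (SchwartzMap.smulLeftCLM ℂ (fun z => χ z) (𝓕 θ)) : 𝓢(SpaceTime d, ℂ)) ζ =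
      ∫ η, (𝓕 χ : 𝓢(SpaceTime d, ℂ)) η * θ (ζ + η) := by
  have hχ : (fun z => χ z).HasTemperateGrowth := χ.hasTemperateGrowth
  have hshift : ∀ x, (𝓕 (θ.compSubConstCLM ℂ (-ζ)) : 𝓢(SpaceTime d, ℂ)) x =
      Real.fourierChar (inner ℝ x ζ) • (𝓕 θ : 𝓢(SpaceTime d, ℂ)) x := fun x => by
    have h := congrFun (VectorFourier.fourierIntegral_comp_add_right Real.fourierChar volume
      (innerₗ (SpaceTime d)) θ ζ) x
    rw [SchwartzMap.fourier_coe, SchwartzMap.fourier_coe]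
    rw [real_inner_comm]
    convert h using 1
    swap
    · rfl
    change VectorFourier.fourierIntegral _ _ _ _ _ = _
    congr 1
    ext v
    simp
  rw [SchwartzMap.fourierInv_coe, Real.fourierInv_eq]
  calc _ = ∫ x, χ x * (𝓕 (θ.compSubConstCLM ℂ (-ζ)) : 𝓢(SpaceTime d, ℂ)) x := by
        refine integral_congr_ae (Filter.Eventually.of_forall fun x => ?_)
        simp only [hshift, SchwartzMap.smulLeftCLM_apply_apply hχ, smul_eq_mul, Circle.smul_def]
        ring
    _ = _ := by
        rw [← SchwartzMap.integral_fourier_mul_eq]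
        refine integral_congr_ae (Filter.Eventually.of_forall fun x => ?_)
        simp [add_comm]

theorem HasFourierTransform.smulLeftCLM {d : ℕ} {u : 𝓢'(SpaceTime d, ℂ)} {f : SpaceTime d → ℂ}
    (h : HasFourierTransform u f) (hf : Integrable f) (χ : 𝓢(SpaceTime d, ℂ)) :
    HasFourierTransform (smulLeftCLM ℂ (fun z => χ z) u)
      (fun ζ => ∫ η, f (ζ - η) * (𝓕 χ : 𝓢(SpaceTime d, ℂ)) η) := by
  set g : 𝓢(SpaceTime d, ℂ) := 𝓕 χ with hg
  have hH : Integrable (fun p : SpaceTime d × SpaceTime d => f (p.1 - p.2) * g p.2)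
      (volume.prod volume) :=
    Integrable.convolution_integrand (ContinuousLinearMap.mul ℂ ℂ).flip g.integrable hf
  refine ⟨hH.1.integral_prod_right', fun θ => ?_⟩
  obtain ⟨C, hC⟩ := θ.exists_norm_le
  have h1 : Integrable (fun p : SpaceTime d × SpaceTime d => θ p.1 * (f (p.1 - p.2) * g p.2))
      (volume.prod volume) :=
    hH.bdd_mul (c := C) (θ.continuous.comp continuous_fst).aestronglyMeasurable
      (Filter.Eventually.of_forall fun p => hC _)
  have h2 : Integrable (fun p : SpaceTime d × SpaceTime d => θ (p.1 + p.2) * (f p.1 * g p.2))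
      (volume.prod volume) :=
    (hf.mul_prod g.integrable).bdd_mul (c := C)
      (θ.continuous.comp (continuous_fst.add continuous_snd)).aestronglyMeasurable
      (Filter.Eventually.of_forall fun p => hC _)
  refine ⟨?_, ?_⟩
  · refine (h1.integral_prod_left).congr (Filter.Eventually.of_forall fun ζ => ?_)
    exact integral_const_mul (μ := volume) (θ ζ) fun η => f (ζ - η) * g η
  · have e : (𝓕 (TemperedDistribution.smulLeftCLM ℂ (fun z => χ z) u)) θ =
        (𝓕 u) (𝓕⁻ (SchwartzMap.smulLeftCLM ℂ (fun z => χ z) (𝓕 θ))) := by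
      rw [TemperedDistribution.fourier_apply, TemperedDistribution.fourier_apply, fourier_fourierInv_eq, smulLeftCLM_apply_apply]
    rw [e, (h.2 _).2]
    calc _ = ∫ ζ, ∫ η, θ (ζ + η) * (f ζ * g η) := by
          refine integral_congr_ae (Filter.Eventually.of_forall fun ζ => ?_)
          simp only [fourierInv_smulLeftCLM_fourier]
          rw [← integral_mul_const]
          refine integral_congr_ae (Filter.Eventually.of_forall fun η => ?_)
          simp only [← hg]
          ring
      _ = ∫ η, ∫ ζ, θ (ζ + η) * (f ζ * g η) := integral_integral_swap h2
      _ = ∫ η, ∫ ζ, θ ζ * (f (ζ - η) * g η) := by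
          refine integral_congr_ae (Filter.Eventually.of_forall fun η => ?_)
          simp only
          rw [← integral_add_right_eq_self (fun ζ => θ ζ * (f (ζ - η) * g η)) η]
          simp
      _ = ∫ ζ, ∫ η, θ ζ * (f (ζ - η) * g η) := (integral_integral_swap h1).symm
      _ = _ := by
          refine integral_congr_ae (Filter.Eventually.of_forall fun ζ => ?_)
          exact integral_const_mul (μ := volume) (θ ζ) fun η => f (ζ - η) * g η

theorem fourier_lineDeriv_spaceVec {d : ℕ} (ψ : 𝓢(SpaceTime d, ℂ)) (j : Fin d) (ζ : SpaceTime d) :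
    (𝓕 (∂_{spaceVec j} ψ) : 𝓢(SpaceTime d, ℂ)) ζ =
      2 * Real.pi * Complex.I * (ζ.fst j : ℝ) * (𝓕 ψ : 𝓢(SpaceTime d, ℂ)) ζ := by
  have ht : (fun ζ : SpaceTime d => inner ℝ ζ (spaceVec j)).HasTemperateGrowth := by
    fun_prop
  rw [SchwartzMap.fourier_lineDerivOp_eq, smul_apply,
    SchwartzMap.smulLeftCLM_apply_apply ht]
  simp [spaceVec, WithLp.prod_inner_apply, EuclideanSpace.inner_single_right, mul_assoc]

/-- Only the products of `f` with the coordinates need be integrable, since every term of the null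
form differentiates `u`. For the transform of D⁻¹φ this holds because ξₖ p(ξ) is bounded. -/
theorem hasFourierTransform_nullForm {d : ℕ} {u : 𝓢'(SpaceTime d, ℂ)} {f : SpaceTime d → ℂ}
    (h : HasFourierTransform u f) (hf : ∀ k : Fin d, Integrable fun ζ => (ζ.fst k : ℂ) * f ζ)
    (ψ : 𝓢(SpaceTime d, ℂ)) (i j : Fin d) :
    HasFourierTransform (nullForm i j u ψ) (fun ζ => ∫ η,
      nullSymbol i j (ζ - η).fst η.fst * f (ζ - η) * (𝓕 ψ : 𝓢(SpaceTime d, ℂ)) η) := by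
  have hint : ∀ k : Fin d, Integrable fun ζ : SpaceTime d =>
      2 * Real.pi * Complex.I * (ζ.fst k : ℝ) * f ζ := fun k => by
    simpa only [mul_assoc] using (hf k).const_mul (2 * Real.pi * Complex.I)
  have hconv : ∀ k l : Fin d, ∀ᵐ ζ : SpaceTime d, Integrable fun η =>
      2 * Real.pi * Complex.I * ((ζ - η).fst k : ℝ) * f (ζ - η) *
        (𝓕 (∂_{spaceVec l} ψ) : 𝓢(SpaceTime d, ℂ)) η := fun k l =>
    (Integrable.convolution_integrand (ContinuousLinearMap.mul ℂ ℂ).flip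
      (𝓕 (∂_{spaceVec l} ψ) : 𝓢(SpaceTime d, ℂ)).integrable (hint k)).prod_right_ae
  refine (((h.lineDeriv i).smulLeftCLM (hint i) (∂_{spaceVec j} ψ)).sub
    ((h.lineDeriv j).smulLeftCLM (hint j) (∂_{spaceVec i} ψ))).congr ?_
  filter_upwards [hconv i j, hconv j i] with ζ h1 h2
  rw [← integral_sub h1 h2]
  refine integral_congr_ae (Filter.Eventually.of_forall fun η => ?_)
  simp only [fourier_lineDeriv_spaceVec, nullSymbol]
  push_cast
  ring

/-! ### Symbols of order `-1` acting on Schwartz functions -/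

theorem ae_spaceTime_fst_ne_zero {d : ℕ} (hd : 1 ≤ d) : ∀ᵐ ζ : SpaceTime d, ζ.fst ≠ 0 := by
  have : Nonempty (Fin d) := ⟨⟨0, hd⟩⟩
  have h : ∀ᵐ ξ : Space d, ξ ≠ 0 := compl_mem_ae_iff.2 (measure_singleton 0)
  exact (Measure.quasiMeasurePreserving_fst.comp
    (WithLp.volume_preserving_ofLp (Space d) ℝ).quasiMeasurePreserving).ae h

/-- `‖ξ‖⁻¹` is integrable near the origin because `d ≥ 2`; there the decay of `g` in τ suffices, and
for `‖ξ‖ ≥ 1` the factor is at most 1. -/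
theorem integrable_inv_norm_fst_mul {d : ℕ} (hd : 2 ≤ d) (g : 𝓢(SpaceTime d, ℂ)) :
    Integrable fun ζ : SpaceTime d => ‖ζ.fst‖⁻¹ * ‖g ζ‖ := by
  obtain ⟨C₀, hC₀⟩ := g.decay 0 0
  obtain ⟨C₂, hC₂⟩ := g.decay 2 0
  have h1 : Integrable fun ξ : Space d => (Metric.ball (0 : Space d) 1).indicator
      (fun ξ => ‖ξ‖⁻¹) ξ := by
    rw [integrable_indicator_iff Metric.isOpen_ball.measurableSet]
    refine integrableOn_ball_of_norm_le_rpow (α := 1) (C := 1) ?_ ?_ ?_ ?_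
    · rw [finrank_euclideanSpace_fin]; omega
    · rw [finrank_euclideanSpace_fin]; exact_mod_cast hd
    · refine Filter.Eventually.of_forall fun ξ => ?_
      simp [Real.rpow_neg_one]
    · exact (by fun_prop : Measurable fun ξ : Space d => ‖ξ‖⁻¹).aestronglyMeasurable
  have h2 := (h1.mul_prod (integrable_inv_one_add_sq.const_mul (C₀ + C₂)))
  have h3 := ((WithLp.volume_preserving_ofLp (Space d) ℝ).integrable_comp h2.1).2 h2
  refine Integrable.mono' (h3.add g.integrable.norm) ?_ ?_
  · have : Measurable fun ζ : SpaceTime d => ‖ζ.fst‖⁻¹ := by fun_prop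
    exact this.aestronglyMeasurable.mul g.continuous.norm.aestronglyMeasurable
  · refine Filter.Eventually.of_forall fun ζ => ?_
    have b0 : ‖g ζ‖ ≤ C₀ := by simpa using hC₀.2 ζ
    have b2 : ‖ζ‖ ^ 2 * ‖g ζ‖ ≤ C₂ := by simpa using hC₂.2 ζ
    rw [norm_mul, norm_inv, norm_norm, norm_norm]
    change _ ≤ (Metric.ball (0 : Space d) 1).indicator (fun ξ => ‖ξ‖⁻¹) ζ.fst *
      ((C₀ + C₂) * (1 + ζ.snd ^ 2)⁻¹) + ‖g ζ‖
    by_cases hζ : ζ.fst ∈ Metric.ball (0 : Space d) 1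
    · rw [Set.indicator_of_mem hζ]
      have hn : ‖ζ‖ ^ 2 = ‖ζ.fst‖ ^ 2 + ‖ζ.snd‖ ^ 2 := WithLp.prod_norm_sq_eq_of_L2 ζ
      have hb : ‖g ζ‖ ≤ (C₀ + C₂) * (1 + ζ.snd ^ 2)⁻¹ := by
        rw [← div_eq_mul_inv, le_div_iff₀ (by positivity)]
        rw [Real.norm_eq_abs, sq_abs] at hn
        nlinarith [mul_nonneg (sq_nonneg ‖ζ.fst‖) (norm_nonneg (g ζ))]
      have := mul_le_mul_of_nonneg_left hb (inv_nonneg.2 (norm_nonneg ζ.fst))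
      linarith [norm_nonneg (g ζ)]
    · rw [Set.indicator_of_notMem hζ, zero_mul, zero_add]
      have : 1 ≤ ‖ζ.fst‖ := by simpa using hζ
      exact mul_le_of_le_one_left (norm_nonneg _) (inv_le_one_of_one_le₀ this)

theorem integrable_symbol_mul {d : ℕ} (hd : 2 ≤ d) {p : Space d → ℂ} (hp : HasSymbolBound (-1) p)
    (g : 𝓢(SpaceTime d, ℂ)) : Integrable fun ζ : SpaceTime d => p ζ.fst * g ζ := by
  obtain ⟨hpm, A, hA⟩ := hp
  refine ((integrable_inv_norm_fst_mul hd g).const_mul A).mono' ?_ ?_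
  · exact (hpm.comp measurable_spaceTime_fst).aestronglyMeasurable.mul
      g.continuous.aestronglyMeasurable
  · filter_upwards [ae_spaceTime_fst_ne_zero (by omega : 1 ≤ d)] with ζ hζ
    rw [norm_mul, ← mul_assoc, ← Real.rpow_neg_one]
    exact mul_le_mul_of_nonneg_right (hA _ hζ) (norm_nonneg _)

theorem norm_coord_le {d : ℕ} (ξ : Space d) (k : Fin d) : ‖((ξ k : ℝ) : ℂ)‖ ≤ ‖ξ‖ := by
  rw [Complex.norm_real]
  exact PiLp.norm_apply_le ξ k

theorem integrable_coord_mul_symbol_mul {d : ℕ} (hd : 1 ≤ d) {p : Space d → ℂ}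
    (hp : HasSymbolBound (-1) p) (g : 𝓢(SpaceTime d, ℂ)) (k : Fin d) :
    Integrable fun ζ : SpaceTime d => (ζ.fst k : ℂ) * (p ζ.fst * g ζ) := by
  obtain ⟨hpm, A, hA⟩ := hp
  refine (g.integrable.norm.const_mul A).mono' ?_ ?_
  · have : Measurable fun ζ : SpaceTime d => (ζ.fst k : ℂ) := by fun_prop
    exact this.aestronglyMeasurable.mul
      ((hpm.comp measurable_spaceTime_fst).aestronglyMeasurable.mul
        g.continuous.aestronglyMeasurable)
  · filter_upwards [ae_spaceTime_fst_ne_zero hd] with ζ hζ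
    have hn : 0 < ‖ζ.fst‖ := norm_pos_iff.2 hζ
    have h := hA _ hζ
    rw [Real.rpow_neg_one] at h
    rw [norm_mul, norm_mul, ← mul_assoc]
    refine mul_le_mul_of_nonneg_right ?_ (norm_nonneg _)
    calc _ ≤ ‖ζ.fst‖ * (A * ‖ζ.fst‖⁻¹) :=
          mul_le_mul (norm_coord_le _ _) h (norm_nonneg _) hn.le
      _ = A := by field_simp

theorem integrable_coord_mul {d : ℕ} (g : 𝓢(SpaceTime d, ℂ)) (k : Fin d) :
    Integrable fun ζ : SpaceTime d => (ζ.fst k : ℂ) * g ζ := by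
  refine (g.integrable_pow_mul volume 1).mono' ?_ (Filter.Eventually.of_forall fun ζ => ?_)
  · have : Measurable fun ζ : SpaceTime d => (ζ.fst k : ℂ) := by fun_prop
    exact this.aestronglyMeasurable.mul g.continuous.aestronglyMeasurable
  · rw [norm_mul, pow_one]
    refine mul_le_mul_of_nonneg_right ((norm_coord_le _ _).trans ?_) (norm_nonneg _)
    exact WithLp.norm_fst_le _ ζ

/-! ### The weights -/

theorem waveWeight_pos {d : ℕ} (s b : ℝ) (ζ : SpaceTime d) : 0 < waveWeight s b ζ :=
  mul_pos (Real.rpow_pos_of_pos (bracket_pos _) _) (Real.rpow_pos_of_pos (bracket_pos _) _)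

theorem bracket_rpow_le {x y : ℝ} (h : |x| ≤ y) (s : ℝ) : bracket x ^ s ≤ bracket y ^ |s| := by
  have hxy : bracket x ≤ bracket y :=
    Real.sqrt_le_sqrt (by linarith [sq_le_sq' (by linarith [neg_abs_le x]) ((le_abs_self x).trans h)])
  exact (Real.rpow_le_rpow_of_exponent_le (one_le_bracket x) (le_abs_self s)).trans
    (Real.rpow_le_rpow (bracket_pos x).le hxy (abs_nonneg s))

theorem waveWeight_le {d : ℕ} (s b : ℝ) (ζ : SpaceTime d) :
    waveWeight s b ζ ≤ (1 + ‖ζ‖ ^ 2) ^ ((|s| + |b|) / 2) := by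
  have hB : (1 + ‖ζ‖ ^ 2 : ℝ) ^ ((|s| + |b|) / 2) = bracket ‖ζ‖ ^ |s| * bracket ‖ζ‖ ^ |b| := by
    rw [← Real.rpow_add (bracket_pos _), ← bracket_sq, ← Real.rpow_natCast,
      ← Real.rpow_mul (bracket_pos _).le]
    congr 1
    push_cast
    ring
  have h1 : ‖ζ.fst‖ ≤ ‖ζ‖ := WithLp.norm_fst_le _ ζ
  have h2 : |ζ.snd| ≤ ‖ζ‖ := WithLp.norm_snd_le _ ζ
  rw [hB]
  refine mul_le_mul (bracket_rpow_le (by rwa [abs_norm]) s) (bracket_rpow_le ?_ b)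
    (Real.rpow_nonneg (bracket_pos _).le _) (Real.rpow_nonneg (bracket_pos _).le _)
  exact abs_le.2 ⟨by linarith [abs_nonneg ζ.snd], by linarith [norm_nonneg ζ.fst]⟩

theorem waveWeight_neg {d : ℕ} (s b : ℝ) (ζ : SpaceTime d) :
    waveWeight (-s) (-b) ζ = (waveWeight s b ζ)⁻¹ := by
  rw [waveWeight, waveWeight, Real.rpow_neg (bracket_pos _).le, Real.rpow_neg (bracket_pos _).le,
    mul_inv]

/-- The weight is bounded below by a negative power of `1 + ‖ζ‖²`: this is `waveWeight_le` with both
exponents negated. -/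
theorem exists_hasFourierTransform_of_eLpNorm_lt_top {d : ℕ} (s b : ℝ) {f : SpaceTime d → ℂ}
    (hf : AEStronglyMeasurable f volume)
    (h : eLpNorm (fun ζ => (waveWeight s b ζ : ℂ) * f ζ) 2 volume < ∞) :
    ∃ u : 𝓢'(SpaceTime d, ℂ), HasFourierTransform u f := by
  have hw : AEStronglyMeasurable (fun ζ : SpaceTime d => (waveWeight s b ζ : ℂ)) volume :=
    (Complex.measurable_ofReal.comp (measurable_waveWeight s b)).aestronglyMeasurable
  have hr : Measurable fun ζ : SpaceTime d => (((1 + ‖ζ‖ ^ 2) ^ (-((|s| + |b|) / 2)) : ℝ) : ℂ) := by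
    fun_prop
  refine exists_hasFourierTransform_of_memLp (p := 2) ((|s| + |b|) / 2)
    (MemLp.mono ⟨hw.mul hf, h⟩ (hr.aestronglyMeasurable.mul hf)
      (Filter.Eventually.of_forall fun ζ => ?_))
  have h1 := waveWeight_le (-s) (-b) ζ
  have hpos := waveWeight_pos s b ζ
  rw [waveWeight_neg, abs_neg, abs_neg] at h1
  rw [norm_mul, Pi.mul_apply, norm_mul, Complex.norm_real, Complex.norm_real, Real.norm_of_nonneg hpos.le,
    Real.norm_of_nonneg (by positivity), Real.rpow_neg (by positivity)]
  refine mul_le_mul_of_nonneg_right ?_ (norm_nonneg _)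
  exact inv_le_of_inv_le₀ hpos h1

theorem xNorm_schwartz_lt_top {d : ℕ} (s b : ℝ) (φ : 𝓢(SpaceTime d, ℂ)) :
    xNorm s b (φ : 𝓢'(SpaceTime d, ℂ)) < ∞ := by
  rw [xNorm_eq s b (hasFourierTransform_schwartz φ)]
  have ht : (fun ζ : SpaceTime d => (((1 + ‖ζ‖ ^ 2) ^ ((|s| + |b|) / 2) : ℝ) : ℂ)).HasTemperateGrowth := by
    fun_prop
  have hw : AEStronglyMeasurable (fun ζ : SpaceTime d => (waveWeight s b ζ : ℂ)) volume :=
    (Complex.measurable_ofReal.comp (measurable_waveWeight s b)).aestronglyMeasurable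
  have h := (SchwartzMap.smulLeftCLM ℂ (fun ζ : SpaceTime d =>
    (((1 + ‖ζ‖ ^ 2) ^ ((|s| + |b|) / 2) : ℝ) : ℂ)) (𝓕 φ : 𝓢(SpaceTime d, ℂ))).memLp 2 volume
  refine (MemLp.mono h (hw.mul (𝓕 φ : 𝓢(SpaceTime d, ℂ)).continuous.aestronglyMeasurable)
    (Filter.Eventually.of_forall fun ζ => ?_)).2
  rw [SchwartzMap.smulLeftCLM_apply_apply ht, smul_eq_mul, norm_mul, Pi.mul_apply, norm_mul, Complex.norm_real,
    Complex.norm_real, Real.norm_of_nonneg (waveWeight_pos s b ζ).le,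
    Real.norm_of_nonneg (by positivity)]
  exact mul_le_mul_of_nonneg_right (waveWeight_le s b ζ) (norm_nonneg _)

/-! ### The bilinear estimate for symbols -/

theorem sq_eLpNorm_two {α : Type*} [MeasurableSpace α] {μ : Measure α} (f : α → ℂ) :
    eLpNorm f 2 μ ^ 2 = ∫⁻ x, ‖f x‖ₑ ^ 2 ∂μ := by
  simpa using eLpNorm_nnreal_pow_eq_lintegral (f := f) (μ := μ) (p := 2) two_ne_zero

/-- The symbol `m` is measurable and dominated by
`A |ξ₁ ∧ ξ₂| / min (|ξ₁ + ξ₂|, |ξ₁|, |ξ₂|)`. -/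
def IsNullBounded {d : ℕ} (i j : Fin d) (A : ℝ≥0) (m : Space d → Space d → ℂ) : Prop :=
  Measurable (fun q : Space d × Space d => m q.1 q.2) ∧ ∀ ξ₁ ξ₂ : Space d,
    ‖m ξ₁ ξ₂‖ ≤ A * (wedge i j ξ₁ ξ₂ / min ‖ξ₁ + ξ₂‖ (min ‖ξ₁‖ ‖ξ₂‖))

theorem enorm_waveWeight {d : ℕ} (s b : ℝ) (ζ : SpaceTime d) :
    ‖(waveWeight s b ζ : ℂ)‖ₑ = ENNReal.ofReal (waveWeight s b ζ) := by
  rw [← ofReal_norm, Complex.norm_real, Real.norm_of_nonneg (waveWeight_pos s b ζ).le]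

theorem IsNullBounded.enorm_le {d : ℕ} {i j : Fin d} {A : ℝ≥0} {m : Space d → Space d → ℂ}
    (hm : IsNullBounded i j A m) (s ε : ℝ) (f g : SpaceTime d → ℂ) (ζ η : SpaceTime d) :
    ‖(waveWeight (s - 1) (-1 / 4 + ε) ζ : ℂ)‖ₑ * ‖m (ζ - η).fst η.fst * f (ζ - η) * g η‖ₑ ≤
      A * (ENNReal.ofReal (nullKernel i j s ε ζ η) *
        (‖(waveWeight s (3 / 4 + ε) (ζ - η) : ℂ) * f (ζ - η)‖ₑ *
          ‖(waveWeight s (3 / 4 + ε) η : ℂ) * g η‖ₑ)) := by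
  have hw₀ := waveWeight_pos (s - 1) (-1 / 4 + ε) ζ
  have hw₁ := waveWeight_pos s (3 / 4 + ε) (ζ - η)
  have hw₂ := waveWeight_pos s (3 / 4 + ε) η
  have hb := hm.2 (ζ - η).fst η.fst
  rw [← WithLp.add_fst, sub_add_cancel] at hb
  have hR : 0 ≤ wedge i j (ζ - η).fst η.fst / min ‖ζ.fst‖ (min ‖(ζ - η).fst‖ ‖η.fst‖) :=
    div_nonneg (wedge_nonneg _ _ _ _) (by positivity)
  unfold nullKernel
  simp only [enorm_mul, enorm_waveWeight]
  generalize hRd : wedge i j (ζ - η).fst η.fst / min ‖ζ.fst‖ (min ‖(ζ - η).fst‖ ‖η.fst‖) = R at *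
  generalize waveWeight (s - 1) (-1 / 4 + ε) ζ = w₀ at *
  generalize waveWeight s (3 / 4 + ε) (ζ - η) = w₁ at *
  generalize waveWeight s (3 / 4 + ε) η = w₂ at *
  have hme : ‖m (ζ - η).fst η.fst‖ₑ ≤ A * ENNReal.ofReal R := by
    rw [← ofReal_norm, ← ENNReal.ofReal_coe_nnreal, ← ENNReal.ofReal_mul A.coe_nonneg]
    exact ENNReal.ofReal_le_ofReal hb
  have hk : ENNReal.ofReal R * ENNReal.ofReal w₀ =
      ENNReal.ofReal (R * w₀ / (w₁ * w₂)) * (ENNReal.ofReal w₁ * ENNReal.ofReal w₂) := by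
    rw [← ENNReal.ofReal_mul hR, ← ENNReal.ofReal_mul hw₁.le, ← ENNReal.ofReal_mul (by positivity)]
    congr 1
    field_simp
  calc _ ≤ ENNReal.ofReal w₀ * (A * ENNReal.ofReal R * ‖f (ζ - η)‖ₑ * ‖g η‖ₑ) := by gcongr
    _ = A * ((ENNReal.ofReal R * ENNReal.ofReal w₀) * (‖f (ζ - η)‖ₑ * ‖g η‖ₑ)) := by ring
    _ = _ := by rw [hk]; ring

theorem IsNullBounded.aestronglyMeasurable {d : ℕ} {i j : Fin d} {A : ℝ≥0}
    {m : Space d → Space d → ℂ} (hm : IsNullBounded i j A m) {f g : SpaceTime d → ℂ}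
    (hf : AEStronglyMeasurable f volume) (hg : AEStronglyMeasurable g volume) :
    AEStronglyMeasurable (fun q : SpaceTime d × SpaceTime d =>
      m (q.1 - q.2).fst q.2.fst * f (q.1 - q.2) * g q.2) (volume.prod volume) := by
  have h1 : Measurable fun q : SpaceTime d × SpaceTime d => m (q.1 - q.2).fst q.2.fst :=
    hm.1.comp (g := fun q : Space d × Space d => m q.1 q.2)
      (f := fun q : SpaceTime d × SpaceTime d => ((q.1 - q.2).fst, q.2.fst)) (by fun_prop)
  have h2 : AEStronglyMeasurable (fun q : SpaceTime d × SpaceTime d => f (q.1 - q.2) * g q.2)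
      (volume.prod volume) :=
    hg.convolution_integrand (ContinuousLinearMap.mul ℂ ℂ).flip hf
  exact (h1.aestronglyMeasurable.mul h2).congr
    (Filter.Eventually.of_forall fun q => (mul_assoc _ _ _).symm)

/-- With absolute values inside the `η`-integral, the same bound yields both the norm estimate and
absolute convergence for almost every `ζ`. -/
theorem IsNullBounded.lintegral_sq_le {d : ℕ} {i j : Fin d} {A C : ℝ≥0} {s ε : ℝ}
    (hC : ∀ f g : SpaceTime d → ℝ≥0∞, Measurable f → Measurable g →
      ∫⁻ ζ, (∫⁻ η, ENNReal.ofReal (nullKernel i j s ε ζ η) * (f (ζ - η) * g η)) ^ 2 ≤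
        C * ((∫⁻ ζ, f ζ ^ 2) * ∫⁻ η, g η ^ 2))
    {m : Space d → Space d → ℂ} (hm : IsNullBounded i j A m) {f g : SpaceTime d → ℂ}
    (hf : AEStronglyMeasurable f volume) (hg : AEStronglyMeasurable g volume) :
    ∫⁻ ζ : SpaceTime d, (‖(waveWeight (s - 1) (-1 / 4 + ε) ζ : ℂ)‖ₑ *
        ∫⁻ η, ‖m (ζ - η).fst η.fst * f (ζ - η) * g η‖ₑ) ^ 2 ≤
      (A * NNReal.sqrt C * eLpNorm (fun ζ => (waveWeight s (3 / 4 + ε) ζ : ℂ) * f ζ) 2 volume *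
        eLpNorm (fun ζ => (waveWeight s (3 / 4 + ε) ζ : ℂ) * g ζ) 2 volume) ^ 2 := by
  set F : SpaceTime d → ℝ≥0∞ := fun ζ => ‖(waveWeight s (3 / 4 + ε) ζ : ℂ) * hf.mk f ζ‖ₑ with hF
  set G : SpaceTime d → ℝ≥0∞ := fun ζ => ‖(waveWeight s (3 / 4 + ε) ζ : ℂ) * hg.mk g ζ‖ₑ with hG
  have hw : Measurable fun ζ : SpaceTime d => (waveWeight s (3 / 4 + ε) ζ : ℂ) :=
    Complex.measurable_ofReal.comp (measurable_waveWeight _ _)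
  have hFm : Measurable F := (hw.mul hf.stronglyMeasurable_mk.measurable).enorm
  have hGm : Measurable G := (hw.mul hg.stronglyMeasurable_mk.measurable).enorm
  have eF : eLpNorm (fun ζ => (waveWeight s (3 / 4 + ε) ζ : ℂ) * f ζ) 2 volume ^ 2 =
      ∫⁻ ζ, F ζ ^ 2 := by
    rw [sq_eLpNorm_two]
    refine lintegral_congr_ae ?_
    filter_upwards [hf.ae_eq_mk] with ζ hζ
    rw [hF, hζ]
  have eG : eLpNorm (fun ζ => (waveWeight s (3 / 4 + ε) ζ : ℂ) * g ζ) 2 volume ^ 2 =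
      ∫⁻ ζ, G ζ ^ 2 := by
    rw [sq_eLpNorm_two]
    refine lintegral_congr_ae ?_
    filter_upwards [hg.ae_eq_mk] with ζ hζ
    rw [hG, hζ]
  calc _ ≤ ∫⁻ ζ, (A * ∫⁻ η, ENNReal.ofReal (nullKernel i j s ε ζ η) * (F (ζ - η) * G η)) ^ 2 := by
        refine lintegral_mono fun ζ => ?_
        refine pow_le_pow_left' ?_ 2
        rw [← lintegral_const_mul' _ _ enorm_ne_top, ← lintegral_const_mul' _ _ ENNReal.coe_ne_top]
        refine lintegral_mono_ae ?_
        -- The reflection `η ↦ ζ - η` preserves null sets, so `f` may be replaced by its measurable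
        -- representative inside the integral.
        have hs := (quasiMeasurePreserving_sub_left_of_right_invariant
          (volume : Measure (SpaceTime d)) ζ).ae hf.ae_eq_mk
        filter_upwards [hs, hg.ae_eq_mk] with η h1 h2
        refine (hm.enorm_le s ε f g ζ η).trans_eq ?_
        rw [h1, h2]
    _ = A ^ 2 * ∫⁻ ζ, (∫⁻ η, ENNReal.ofReal (nullKernel i j s ε ζ η) * (F (ζ - η) * G η)) ^ 2 := by
        simp only [mul_pow]
        exact lintegral_const_mul' _ _ (by simp)
    _ ≤ A ^ 2 * (C * ((∫⁻ ζ, F ζ ^ 2) * ∫⁻ η, G η ^ 2)) := by gcongr; exact hC F G hFm hGm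
    _ = _ := by
        have : (C : ℝ≥0∞) = (NNReal.sqrt C : ℝ≥0∞) ^ 2 := by
          rw [← ENNReal.coe_pow, NNReal.sq_sqrt]
        rw [← eF, ← eG, this]
        ring

theorem IsNullBounded.eLpNorm_le {d : ℕ} {i j : Fin d} {A C : ℝ≥0} {s ε : ℝ}
    (hC : ∀ f g : SpaceTime d → ℝ≥0∞, Measurable f → Measurable g →
      ∫⁻ ζ, (∫⁻ η, ENNReal.ofReal (nullKernel i j s ε ζ η) * (f (ζ - η) * g η)) ^ 2 ≤
        C * ((∫⁻ ζ, f ζ ^ 2) * ∫⁻ η, g η ^ 2))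
    {m : Space d → Space d → ℂ} (hm : IsNullBounded i j A m) {f g : SpaceTime d → ℂ}
    (hf : AEStronglyMeasurable f volume) (hg : AEStronglyMeasurable g volume) :
    eLpNorm (fun ζ : SpaceTime d => (waveWeight (s - 1) (-1 / 4 + ε) ζ : ℂ) *
        ∫ η, m (ζ - η).fst η.fst * f (ζ - η) * g η) 2 volume ≤
      A * NNReal.sqrt C * eLpNorm (fun ζ => (waveWeight s (3 / 4 + ε) ζ : ℂ) * f ζ) 2 volume *
        eLpNorm (fun ζ => (waveWeight s (3 / 4 + ε) ζ : ℂ) * g ζ) 2 volume := by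
  refine (ENNReal.pow_le_pow_left_iff two_ne_zero).1 ?_
  rw [sq_eLpNorm_two]
  refine le_trans (lintegral_mono fun ζ => ?_) (hm.lintegral_sq_le hC hf hg)
  rw [enorm_mul]
  gcongr
  exact enorm_integral_le_lintegral_enorm _

theorem IsNullBounded.ae_integrable {d : ℕ} {i j : Fin d} {A C : ℝ≥0} {s ε : ℝ}
    (hC : ∀ f g : SpaceTime d → ℝ≥0∞, Measurable f → Measurable g →
      ∫⁻ ζ, (∫⁻ η, ENNReal.ofReal (nullKernel i j s ε ζ η) * (f (ζ - η) * g η)) ^ 2 ≤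
        C * ((∫⁻ ζ, f ζ ^ 2) * ∫⁻ η, g η ^ 2))
    {m : Space d → Space d → ℂ} (hm : IsNullBounded i j A m) {f g : SpaceTime d → ℂ}
    (hf : AEStronglyMeasurable f volume) (hg : AEStronglyMeasurable g volume)
    (hf' : eLpNorm (fun ζ => (waveWeight s (3 / 4 + ε) ζ : ℂ) * f ζ) 2 volume < ∞)
    (hg' : eLpNorm (fun ζ => (waveWeight s (3 / 4 + ε) ζ : ℂ) * g ζ) 2 volume < ∞) :
    ∀ᵐ ζ : SpaceTime d, Integrable fun η => m (ζ - η).fst η.fst * f (ζ - η) * g η := by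
  have hmeas := hm.aestronglyMeasurable hf hg
  have hw : Measurable fun ζ : SpaceTime d => ‖(waveWeight (s - 1) (-1 / 4 + ε) ζ : ℂ)‖ₑ :=
    (Complex.measurable_ofReal.comp (measurable_waveWeight _ _)).enorm
  have hfin := ae_lt_top' ((hw.aemeasurable.mul hmeas.enorm.lintegral_prod_right').pow_const 2)
    ((hm.lintegral_sq_le hC hf hg).trans_lt (ENNReal.pow_lt_top (by finiteness))).ne
  filter_upwards [hfin, hmeas.prodMk_left] with ζ h1 h2
  refine ⟨h2, ?_⟩
  by_contra h
  have h3 : ∫⁻ η, ‖m (ζ - η).fst η.fst * f (ζ - η) * g η‖ₑ = ∞ := not_lt_top_iff.1 h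
  have h4 : ‖(waveWeight (s - 1) (-1 / 4 + ε) ζ : ℂ)‖ₑ ≠ 0 := by
    rw [enorm_waveWeight]
    simpa using waveWeight_pos _ _ ζ
  rw [Pi.mul_apply, h3, ENNReal.mul_top h4] at h1
  simp at h1

/-! ### The symbols of the two null forms -/

theorem norm_nullSymbol {d : ℕ} (i j : Fin d) (ξ₁ ξ₂ : Space d) :
    ‖nullSymbol i j ξ₁ ξ₂‖ = (2 * Real.pi) ^ 2 * wedge i j ξ₁ ξ₂ := by
  rw [nullSymbol, norm_mul, norm_pow, Complex.norm_real, wedge, Real.norm_eq_abs]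
  simp [abs_of_pos Real.pi_pos]

theorem measurable_nullSymbol {d : ℕ} (i j : Fin d) :
    Measurable fun q : Space d × Space d => nullSymbol i j q.1 q.2 := by
  unfold nullSymbol
  fun_prop

/-- A nonzero minor forces all three frequencies to be nonzero, so the uncontrolled value `p 0`
never enters. -/
theorem symbol_mul_wedge_le {d : ℕ} {p : Space d → ℂ} {A : ℝ≥0}
    (hA : ∀ ξ, ξ ≠ 0 → ‖p ξ‖ ≤ A * ‖ξ‖⁻¹) {i j : Fin d} (hij : i ≠ j) {ξ₁ ξ₂ ξ : Space d}
    (hξ : ξ = ξ₁ + ξ₂ ∨ ξ = ξ₁) :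
    ‖p ξ‖ * wedge i j ξ₁ ξ₂ ≤ A * (wedge i j ξ₁ ξ₂ / min ‖ξ₁ + ξ₂‖ (min ‖ξ₁‖ ‖ξ₂‖)) := by
  have hw := wedge_nonneg i j ξ₁ ξ₂
  have b1 := wedge_le hij ξ₁ ξ₂
  have b0 := wedge_le hij (ξ₁ + ξ₂) ξ₂
  rw [wedge_add_left] at b0
  rcases hw.eq_or_lt with h | h
  · simp [← h]
  have n1 : 0 < ‖ξ₁‖ := pos_of_mul_pos_left (h.trans_le b1) (norm_nonneg _)
  have n2 : 0 < ‖ξ₂‖ := pos_of_mul_pos_right (h.trans_le b1) (norm_nonneg _)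
  have n0 : 0 < ‖ξ₁ + ξ₂‖ := pos_of_mul_pos_left (h.trans_le b0) (norm_nonneg _)
  have hmin : 0 < min ‖ξ₁ + ξ₂‖ (min ‖ξ₁‖ ‖ξ₂‖) := lt_min n0 (lt_min n1 n2)
  have hle : ξ ≠ 0 ∧ min ‖ξ₁ + ξ₂‖ (min ‖ξ₁‖ ‖ξ₂‖) ≤ ‖ξ‖ := by
    rcases hξ with rfl | rfl
    · exact ⟨norm_pos_iff.1 n0, min_le_left _ _⟩
    · exact ⟨norm_pos_iff.1 n1, (min_le_right _ _).trans (min_le_left _ _)⟩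
  calc _ ≤ (A * ‖ξ‖⁻¹) * wedge i j ξ₁ ξ₂ := mul_le_mul_of_nonneg_right (hA ξ hle.1) hw
    _ ≤ (A * (min ‖ξ₁ + ξ₂‖ (min ‖ξ₁‖ ‖ξ₂‖))⁻¹) * wedge i j ξ₁ ξ₂ := by
        gcongr
        exact hle.2
    _ = _ := by rw [div_eq_mul_inv]; ring

theorem HasSymbolBound.exists_nnreal {d : ℕ} {p : Space d → ℂ} (hp : HasSymbolBound (-1) p) :
    ∃ A : ℝ≥0, ∀ ξ, ξ ≠ 0 → ‖p ξ‖ ≤ A * ‖ξ‖⁻¹ := by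
  obtain ⟨A, hA⟩ := hp.2
  refine ⟨A.toNNReal, fun ξ hξ => (hA ξ hξ).trans ?_⟩
  rw [Real.rpow_neg_one]
  exact mul_le_mul_of_nonneg_right (Real.le_coe_toNNReal A) (inv_nonneg.2 (norm_nonneg _))

theorem isNullBounded_of_eq {d : ℕ} {p : Space d → ℂ} {A : ℝ≥0} (hp : Measurable p)
    (hA : ∀ ξ, ξ ≠ 0 → ‖p ξ‖ ≤ A * ‖ξ‖⁻¹) {i j : Fin d} (hij : i ≠ j)
    {L : Space d × Space d → Space d} (hL : Measurable L)
    (hL' : ∀ q, L q = q.1 + q.2 ∨ L q = q.1) :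
    IsNullBounded i j (((2 * Real.pi) ^ 2).toNNReal * A)
      (fun ξ₁ ξ₂ => p (L (ξ₁, ξ₂)) * nullSymbol i j ξ₁ ξ₂) := by
  refine ⟨(hp.comp hL).mul (measurable_nullSymbol i j), fun ξ₁ ξ₂ => ?_⟩
  rw [norm_mul, norm_nullSymbol, mul_left_comm, NNReal.coe_mul, Real.coe_toNNReal _ (by positivity),
    mul_assoc]
  exact mul_le_mul_of_nonneg_left (symbol_mul_wedge_le hA hij (hL' (ξ₁, ξ₂))) (by positivity)

/-! ### The null form estimates -/

theorem mainTheorem5 (d : ℕ) (hd : 3 ≤ d) :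
    ∃ C₀ ε₀ : ℝ, 0 < C₀ ∧ 0 < ε₀ ∧
      ∀ C ε s : ℝ, C₀ ≤ C → 0 < ε → ε < ε₀ → s = (d : ℝ) / 2 - 3 / 4 + C * ε →
        ∀ p : Space d → ℂ, HasSymbolBound (-1) p →
          ∃ K : ℝ≥0, ∀ i j : Fin d, i < j →
            -- the estimates for Schwartz functions
            (∀ φ ψ : 𝓢(SpaceTime d, ℂ),
              (∃ u : 𝓢'(SpaceTime d, ℂ),
                IsFourierMultiplier p (nullForm i j (φ : 𝓢'(SpaceTime d, ℂ)) ψ) u ∧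
                xNorm (s - 1) (-1 / 4 + ε) u ≤
                  K * xNorm s (3 / 4 + ε) (φ : 𝓢'(SpaceTime d, ℂ)) *
                    xNorm s (3 / 4 + ε) (ψ : 𝓢'(SpaceTime d, ℂ))) ∧
              (∃ v : 𝓢'(SpaceTime d, ℂ),
                IsFourierMultiplier p (φ : 𝓢'(SpaceTime d, ℂ)) v ∧
                xNorm (s - 1) (-1 / 4 + ε) (nullForm i j v ψ) ≤
                  K * xNorm s (3 / 4 + ε) (φ : 𝓢'(SpaceTime d, ℂ)) *
                    xNorm s (3 / 4 + ε) (ψ : 𝓢'(SpaceTime d, ℂ)))) ∧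
            -- the estimates for arbitrary elements of the space
            (∀ φ ψ : 𝓢'(SpaceTime d, ℂ),
              xNorm s (3 / 4 + ε) φ < ∞ → xNorm s (3 / 4 + ε) ψ < ∞ →
              (∃ u : 𝓢'(SpaceTime d, ℂ), IsInvNullForm p i j φ ψ u ∧
                xNorm (s - 1) (-1 / 4 + ε) u ≤
                  K * xNorm s (3 / 4 + ε) φ * xNorm s (3 / 4 + ε) ψ) ∧
              (∃ u : 𝓢'(SpaceTime d, ℂ), IsNullFormInv p i j φ ψ u ∧
                xNorm (s - 1) (-1 / 4 + ε) u ≤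
                  K * xNorm s (3 / 4 + ε) φ * xNorm s (3 / 4 + ε) ψ)) := by
  obtain ⟨n, rfl⟩ : ∃ n, d = n + 1 := ⟨d - 1, by omega⟩
  -- The requirement `n + 2ε ≤ 2s + (1/2 - 2ε)` reads `n + 2ε ≤ n + (2C - 2)ε`, that is `C ≥ 2`. The
  -- bound `ε < 1/4` keeps `1/2 - 2ε` positive, and `d ≥ 3` gives `s ≥ 3/4`.
  refine ⟨2, 1 / 4, by norm_num, by norm_num, fun C ε s hC hε hε' hs p hp => ?_⟩
  have hCε : 2 * ε ≤ C * ε := mul_le_mul_of_nonneg_right hC hε.le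
  have hn : (2 : ℝ) ≤ n := by exact_mod_cast (by omega : 2 ≤ n)
  push_cast at hs
  obtain ⟨M, hM⟩ := exists_lintegral_sq_nullKernel_le (n := n) (s := s) (ε := ε) (by omega)
    (by linarith) hε hε'.le (by linarith)
  obtain ⟨A, hA⟩ := hp.exists_nnreal
  set B : ℝ≥0 := ((2 * Real.pi) ^ 2).toNNReal * A with hB
  refine ⟨B * NNReal.sqrt M, fun i j hij => ?_⟩
  have hM' := hM i j hij.ne
  rw [ENNReal.coe_mul]
  have hm₁ : IsNullBounded i j B (fun ξ₁ ξ₂ => p (ξ₁ + ξ₂) * nullSymbol i j ξ₁ ξ₂) :=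
    isNullBounded_of_eq hp.1 hA hij.ne (L := fun q => q.1 + q.2) (by fun_prop) fun q => Or.inl rfl
  have hm₂ : IsNullBounded i j B (fun ξ₁ ξ₂ => p ξ₁ * nullSymbol i j ξ₁ ξ₂) :=
    isNullBounded_of_eq hp.1 hA hij.ne (L := fun q => q.1) (by fun_prop) fun q => Or.inr rfl
  have general : ∀ m : Space (n + 1) → Space (n + 1) → ℂ, IsNullBounded i j B m →
      ∀ φ ψ : 𝓢'(SpaceTime (n + 1), ℂ), xNorm s (3 / 4 + ε) φ < ∞ → xNorm s (3 / 4 + ε) ψ < ∞ →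
      ∃ u : 𝓢'(SpaceTime (n + 1), ℂ), IsBilinearMultiplier m φ ψ u ∧
        xNorm (s - 1) (-1 / 4 + ε) u ≤
          B * NNReal.sqrt M * xNorm s (3 / 4 + ε) φ * xNorm s (3 / 4 + ε) ψ := by
    intro m hm φ ψ hφ hψ
    obtain ⟨f, hf, hf'⟩ : ∃ f, HasFourierTransform φ f ∧
        eLpNorm (fun ζ => (waveWeight s (3 / 4 + ε) ζ : ℂ) * f ζ) 2 volume < ∞ := by
      simpa [xNorm, iInf_lt_iff] using hφ
    obtain ⟨g, hg, hg'⟩ : ∃ g, HasFourierTransform ψ g ∧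
        eLpNorm (fun ζ => (waveWeight s (3 / 4 + ε) ζ : ℂ) * g ζ) 2 volume < ∞ := by
      simpa [xNorm, iInf_lt_iff] using hψ
    have hle := hm.eLpNorm_le hM' hf.1 hg.1
    obtain ⟨u, hu⟩ := exists_hasFourierTransform_of_eLpNorm_lt_top (s - 1) (-1 / 4 + ε)
      (hm.aestronglyMeasurable hf.1 hg.1).integral_prod_right'
      (hle.trans_lt (by finiteness))
    refine ⟨u, ⟨f, g, hf, hg, hm.ae_integrable hM' hf.1 hg.1 hf' hg', hu⟩, ?_⟩
    rw [xNorm_eq _ _ hu, xNorm_eq _ _ hf, xNorm_eq _ _ hg]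
    exact hle
  refine ⟨fun φ ψ => ⟨?_, ?_⟩, fun φ ψ hφ hψ => ⟨general _ hm₁ φ ψ hφ hψ, general _ hm₂ φ ψ hφ hψ⟩⟩
  · have hf := hasFourierTransform_schwartz φ
    have hg := hasFourierTransform_schwartz ψ
    obtain ⟨u, ⟨f, g, hf', hg', -, hu⟩, hle⟩ := general _ hm₁ φ ψ (xNorm_schwartz_lt_top _ _ φ)
      (xNorm_schwartz_lt_top _ _ ψ)
    refine ⟨u, ⟨_, hasFourierTransform_nullForm hf (integrable_coord_mul _) ψ i j, ?_⟩, hle⟩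
    -- The factor p(ξ₀) is constant in `η` and leaves the integral; uniqueness of the representing
    -- functions replaces `f`, `g` by the transforms of `φ`, `ψ`.
    refine hu.congr (Filter.Eventually.of_forall fun ζ => ?_)
    simp only
    rw [← integral_const_mul]
    refine integral_congr_ae ?_
    have hs := (quasiMeasurePreserving_sub_left_of_right_invariant
      (volume : Measure (SpaceTime (n + 1))) ζ).ae (hf'.ae_eq hf)
    filter_upwards [hs, hg'.ae_eq hg] with η h1 h2
    rw [h1, h2, ← WithLp.add_fst, sub_add_cancel]
    ring
  · have hf := hasFourierTransform_schwartz φ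
    have hg := hasFourierTransform_schwartz ψ
    -- The transform of D⁻¹φ is integrable despite the singularity of `p`, so exponent 1 and the
    -- trivial weight suffice.
    obtain ⟨v, hv⟩ := exists_hasFourierTransform_of_memLp (p := 1) 0
      (f := fun ζ : SpaceTime (n + 1) => p ζ.fst * (𝓕 φ : 𝓢(SpaceTime (n + 1), ℂ)) ζ)
      (by simpa using memLp_one_iff_integrable.2 (integrable_symbol_mul (by omega) hp (𝓕 φ)))
    refine ⟨v, ⟨_, hf, hv⟩, ?_⟩
    have hq := hasFourierTransform_nullForm hv
      (integrable_coord_mul_symbol_mul (by omega) hp (𝓕 φ)) ψ i j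
    rw [xNorm_eq _ _ hq, xNorm_eq _ _ hf, xNorm_eq _ _ hg]
    refine le_trans (le_of_eq ?_) (hm₂.eLpNorm_le hM' hf.1 hg.1)
    congr 1
    ext ζ
    congr 2
    ext η
    ring
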